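/- **Conventions.** Let $T$ be a complete first-order theory in a language $L$, and put $|T| = |L| + \aleph_0$. All variables $x, y$ denote finite tuples. A formula $\varphi(x;y)$ *has SOP$_1$* if, in a model of $T$, there are tuples $(a_\eta)_{\eta \in 2^{<\omega}}$ such that $\{\varphi(x;a_{\eta|k}) : k<\omega\}$ is consistent for every $\eta \in 2^\omega$, and $\{\varphi(x;a_\nu), \varphi(x;a_{\eta\frown\langle 1\rangle})\}$ is inconsistent whenever $\eta\in 2^{<\omega}$ and $\nu \unrhd \eta\frown\langle 0\rangle$. $T$ is *NSOP$_1$* if no formula has SOP$_1$. Let $\mathbb{M}$ be a sufficiently saturated (monster) model of $T$; all sets of parameters and all models considered are small subsets, respectively elementary submodels, of $\mathbb{M}$. A global type $q \in S(\mathbb{M})$ is *$A$-invariant* if $\varphi(y;e)\in q \iff \varphi(y;e')\in q$ whenever $e \equiv_A e'$; a *Morley sequence* in $q$ over $A$ is a sequence $(b_i)_{i<\omega}$ with $b_i \models q|_{A b_{<i}}$ for all $i$. A formula $\varphi(x;b)$ *Kim-divides* over $A$ if there are an $A$-invariant global type $q \supseteq \mathrm{tp}(b/A)$ and a Morley sequence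 $(b_i)_{i<\omega}$ in $q$ over $A$ with $\{\varphi(x;b_i): i<\omega\}$ inconsistent. It *Kim-forks* over $A$ if it implies a finite disjunction of formulas (with parameters in $\mathbb{M}$) each of which Kim-divides over $A$. A type *Kim-forks* over $A$ if it implies a formula that Kim-forks over $A$. **Theorem.** (A) Suppose $T$ is NSOP$_1$. Then for every model $M \models T$ and every type $p \in S(M)$ in finitely many variables there is an elementary submodel $M' \preceq M$ with $|M'| \le 2^{|T|}$ such that $p$ does not Kim-fork over $M'$. (B) The following are equivalent. 1. For some cardinal $\kappa > |T|$ there is no sequence $\langle N_i, \varphi_i(x,y_i), c_i : i<\kappa\rangle$ such that $\langle N_i : i<\kappa\rangle$ is an increasing continuous sequence of models of $T$ of size $<\kappa$, each $\varphi_i(x,y_i)$ is a formula over $N_i$, $c_i \in N_{i+1}$, each $\varphi_i(x,c_i)$ Kim-forks over $N_i$, and $\{\varphi_i(x,c_i) : i<\kappa\}$ is consistent. 2. $T$ is NSOP$_1$. -/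

import Mathlib

universe u v w w'

open FirstOrder Cardinal

namespace KimIndependence

open FirstOrder.Language

section Types

variable {L : FirstOrder.Language.{u, v}}

/-- `|T|` for a theory `T` in the language `L`: the usual convention `|T| = |L| + ℵ₀`. -/
noncomputable def theoryCard (_T : L.Theory) : Cardinal.{max u v} :=
  max ℵ₀ L.card

variable {M : Type w} [L.Structure M] {α γ : Type}

/-- The formula `φ(x; e)` with parameters in `M`, obtained from the formula `φ(x; z)` by plugging
in the tuple `e` for `z`. -/
noncomputable def plug (φ : L.Formula (α ⊕ γ)) (e : γ → M) : L[[M]].Formula α :=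
  BoundedFormula.constantsVarsEquiv.symm (φ.relabel (Sum.elim Sum.inr (Sum.inl ∘ e)))

/-- `φ(x; e) ∈ q`, where `q` is a complete type over the structure `M`, i.e. a complete type of the
theory of `M` with all elements of `M` named. -/
def Has (q : (L.elementaryDiagram M).CompleteType α) (φ : L.Formula (α ⊕ γ)) (e : γ → M) : Prop :=
  Formula.equivSentence (plug φ e) ∈ q

end Types

section Saturation

variable (L : FirstOrder.Language.{u, v}) (U : Type w) [L.Structure U]

/-- `U` is `μ`-saturated: over any set `A` of fewer than `μ` parameters, every finitely satisfiable
set of formulas in finitely many variables is realized in `U`. -/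
def IsSaturated (μ : Cardinal.{w}) : Prop :=
  ∀ A : Set U, #A < μ → ∀ (n : ℕ) (Γ : Set (L[[A]].Formula (Fin n))),
    (∀ s : Finset (L[[A]].Formula (Fin n)), (s : Set (L[[A]].Formula (Fin n))) ⊆ Γ →
      ∃ a : Fin n → U, ∀ φ ∈ s, φ.Realize a) →
    ∃ a : Fin n → U, ∀ φ ∈ Γ, φ.Realize a

end Saturation

section Kim

/- In this section `U` plays the role of the monster model. The notions have their usual meaning
over a base `A` when `U` is `|A|⁺`-saturated. -/

variable {L : FirstOrder.Language.{u, v}} {U : Type w} [L.Structure U]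

/-- `b ≡_A b'`. -/
def EquivOver (A : Set U) {γ : Type} (b b' : γ → U) : Prop :=
  ∀ (k : ℕ) (φ : L.Formula (γ ⊕ Fin k)) (a : Fin k → U), (∀ i, a i ∈ A) →
    (φ.Realize (Sum.elim b a) ↔ φ.Realize (Sum.elim b' a))

/-- The global type `q` is `A`-invariant. -/
def IsInvariant (A : Set U) {β : Type} (q : (L.elementaryDiagram U).CompleteType β) : Prop :=
  ∀ (k : ℕ) (φ : L.Formula (β ⊕ Fin k)) (e e' : Fin k → U), EquivOver (L := L) A e e' →
    (Has q φ e ↔ Has q φ e')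

/-- `b ⊨ q|_C`; equivalently, `q` extends `tp(b/C)`. -/
def RealizesOver (C : Set U) {β : Type} (q : (L.elementaryDiagram U).CompleteType β)
    (b : β → U) : Prop :=
  ∀ (k : ℕ) (φ : L.Formula (β ⊕ Fin k)) (e : Fin k → U), (∀ i, e i ∈ C) →
    (Has q φ e ↔ φ.Realize (Sum.elim b e))

/-- `(b i)_{i < ω}` is a Morley sequence in `q` over `A`: `b i ⊨ q|_{A ∪ b_{<i}}` for all `i`. -/
def IsMorley (A : Set U) {β : Type} (q : (L.elementaryDiagram U).CompleteType β)
    (b : ℕ → β → U) : Prop :=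
  ∀ i, RealizesOver (A ∪ ⋃ j < i, Set.range (b j)) q (b i)

/-- The family of conditions `P i` on a tuple `x` (each given by a formula with parameters in `U`)
is consistent, i.e. finitely satisfiable in `U`. -/
def Consistent {ι : Type w'} {n : ℕ} (P : ι → (Fin n → U) → Prop) : Prop :=
  ∀ s : Finset ι, ∃ x : Fin n → U, ∀ i ∈ s, P i x

/-- `φ(x; y)` `q`-divides over `A`. -/
def QDivides (A : Set U) {n : ℕ} {β : Type} (φ : L.Formula (Fin n ⊕ β))
    (q : (L.elementaryDiagram U).CompleteType β) : Prop :=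
  ∃ b : ℕ → β → U, IsMorley A q b ∧ ¬ Consistent fun i x => φ.Realize (Sum.elim x (b i))

/-- `φ(x; b)` Kim-divides over `A`: `φ(x; y)` `q`-divides over `A` for some global `A`-invariant
type `q ⊇ tp(b/A)`. -/
def KimDivides (A : Set U) {n : ℕ} {β : Type} (φ : L.Formula (Fin n ⊕ β)) (b : β → U) : Prop :=
  ∃ q : (L.elementaryDiagram U).CompleteType β,
    IsInvariant A q ∧ RealizesOver A q b ∧ QDivides A φ q

/-- `φ(x; b)` Kim-forks over `A`: it implies a finite disjunction of formulas that Kim-divide over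
`A`. -/
def KimForks (A : Set U) {n : ℕ} {β : Type} (φ : L.Formula (Fin n ⊕ β)) (b : β → U) : Prop :=
  ∃ (k : ℕ) (m : Fin k → ℕ) (ψ : ∀ i, L.Formula (Fin n ⊕ Fin (m i))) (c : ∀ i, Fin (m i) → U),
    (∀ x : Fin n → U, φ.Realize (Sum.elim x b) → ∃ i, (ψ i).Realize (Sum.elim x (c i))) ∧
      ∀ i, KimDivides A (ψ i) (c i)

/-- The complete type `p ∈ S_n(M)`, for `M` an elementary submodel of `U`, Kim-forks over `A`: it
implies a formula `φ(x; b)` which Kim-forks over `A`. As `p` is closed under conjunction,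
`p ⊢ φ(x; b)` means that some `θ(x; m) ∈ p` implies `φ(x; b)`. -/
def TypeKimForks (A : Set U) {M : L.ElementarySubstructure U} {n : ℕ}
    (p : (L.elementaryDiagram M).CompleteType (Fin n)) : Prop :=
  ∃ (k : ℕ) (θ : L.Formula (Fin n ⊕ Fin k)) (m : Fin k → M)
    (l : ℕ) (φ : L.Formula (Fin n ⊕ Fin l)) (b : Fin l → U),
    Has p θ m ∧
    (∀ x : Fin n → U, θ.Realize (Sum.elim x fun i => (m i : U)) → φ.Realize (Sum.elim x b)) ∧
    KimForks A φ b

/-- In `U` there is a consistent Kim-forking chain of length `κ`: an increasing continuous sequence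
`(N i)_{i < κ}` of models of size `< κ`, formulas `φ i (x, y_i)` over `N i` (the parameters from
`N i` are displayed as the tuple `d i`) and tuples `c i ∈ N (i + 1)`, such that `φ i (x, c i)`
Kim-forks over `N i` and `{φ i (x, c i) : i < κ}` is consistent. -/
def HasKimForkingChain (L : FirstOrder.Language.{u, v}) (U : Type w) [L.Structure U]
    (κ : Cardinal.{w}) : Prop :=
  ∃ (n : ℕ) (N : Ordinal.{w} → L.ElementarySubstructure U) (m k : Ordinal.{w} → ℕ)
    (φ : ∀ i, L.Formula (Fin n ⊕ (Fin (m i) ⊕ Fin (k i))))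
    (c : ∀ i, Fin (m i) → U) (d : ∀ i, Fin (k i) → U),
    (∀ i j, i ≤ j → j < κ.ord → N i ≤ N j) ∧
    (∀ i < κ.ord, Order.IsSuccLimit i → (N i : Set U) = ⋃ j < i, (N j : Set U)) ∧
    (∀ i < κ.ord, #(N i) < κ) ∧
    (∀ i < κ.ord, ∀ t, d i t ∈ N i) ∧
    (∀ i < κ.ord, ∀ t, c i t ∈ N (i + 1)) ∧
    (∀ i < κ.ord, KimForks (N i : Set U) (φ i) (Sum.elim (c i) (d i))) ∧
    Consistent fun (i : Set.Iio κ.ord) (x : Fin n → U) =>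
      (φ i).Realize (Sum.elim x (Sum.elim (c i) (d i)))

end Kim

section SOP

variable {L : FirstOrder.Language.{u, v}}

/-- The formula `φ(x; y)` has SOP₁, witnessed by a tree of tuples `(a η)_{η ∈ 2^{<ω}}` in the
structure `N`. Nodes are lists of Booleans (root first), `0` being `false` and `1` being `true`. -/
def FormulaSOP1 (N : Type w) [L.Structure N] {n m : ℕ} (φ : L.Formula (Fin n ⊕ Fin m)) : Prop :=
  ∃ a : List Bool → Fin m → N,
    (∀ η : ℕ → Bool, Consistent fun (k : ℕ) (x : Fin n → N) =>
      φ.Realize (Sum.elim x (a ((List.range k).map η)))) ∧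
    ∀ η ν : List Bool, (η ++ [false]) <+: ν →
      ¬ ∃ x : Fin n → N, φ.Realize (Sum.elim x (a ν)) ∧
        φ.Realize (Sum.elim x (a (η ++ [true])))

/-- `T` has SOP₁: some formula has SOP₁ in a model of `T`. -/
def SOP1 (T : L.Theory) : Prop :=
  ∃ (N : Theory.ModelType.{u, v, max u v} T) (n m : ℕ) (φ : L.Formula (Fin n ⊕ Fin m)),
    FormulaSOP1 N φ

/-- `T` is NSOP₁. -/
def NSOP1 (T : L.Theory) : Prop := ¬ SOP1 T

end SOP

end KimIndependence

/-! Everything on the NSOP₁ side rests on one fact: there is no consistent Kim-forking chain of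
length |T|⁺ (`not_hasKimForkingChain`). Given such a chain, let b_i be the full parameter tuple of
the i-th formula. A pressing-down argument (`exists_reflecting_ordinal`) gives a limit δ such that
every formula over N_δ true of b_δ is already true of some b_j with j < δ and φ_j = φ_δ. So
tp(b_δ/N_δ) is the restriction of an ultrafilter concentrating on such b_j. The instances φ_δ(x;
b_j) belong to the chain, hence are jointly consistent, and `KimForks.not_consistent` forbids this
for a Kim-forking formula.

That lemma extends the ultrafilter to the parameters of the disjuncts witnessing Kim-forking, takes
a Morley sequence, chooses by pigeonhole one disjunct that holds infinitely often, and applies Kim's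
lemma (`QDivides.of_nsop1`): under NSOP₁, dividing along one invariant extension of tp(b/A) implies
dividing along every other. If Kim's lemma fails for q and r, a sequence realizing r and q
alternately, read backwards, is an array of pairs with equal types over the previous pairs;
`exists_tree` and `sop1_of_arrays` unfold it into an SOP₁ tree.

For (A), if p Kim-forked over all submodels of M of size at most |T|, a recursion would produce a
Kim-forking chain of formulas of p, which is consistent. This even gives |M'| ≤ |T|.

Conversely, an SOP₁ tree yields, by pigeonhole, an ultrafilter limit and compactness, an array over
any linear order whose entries all have the same type over what precedes them, with one consistent
column and one pairwise inconsistent column (`exists_indexed_array`). Working in a Skolemized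
language, hulls of initial segments form a chain of models. The inconsistent entries below a point
converge to an invariant type along which the consistent entry at that point Kim-divides
(`kimDivides_of_array`). A saturated model to house the chain comes from a Henkin construction
(`exists_isSaturated`). -/

namespace KimIndependence

open FirstOrder.Language

/-! ### Finite supports, compactness, equality of types. -/

section Basics

variable {L : FirstOrder.Language.{u, v}}

open Classical in
/-- The finite set of parameter variables occurring in `φ`. -/
noncomputable def support {γ : Type*} {δ : Type*} (φ : L.Formula (γ ⊕ δ)) : Finset δ :=
  φ.freeVarFinset.toRight

/-- An enumeration of the parameter variables occurring in `φ`. -/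
noncomputable def supportMap {γ : Type*} {δ : Type*} (φ : L.Formula (γ ⊕ δ)) :
    Fin (support φ).card → δ :=
  fun i => ((support φ).equivFin.symm i : δ)

open Classical in
/-- The formula `φ` with its parameter variables renamed to an initial segment of `ℕ`. -/
noncomputable def supportFormula {γ : Type*} {δ : Type*} (φ : L.Formula (γ ⊕ δ)) :
    L.Formula (γ ⊕ Fin (support φ).card) :=
  φ.restrictFreeVar fun x =>
    match x with
    | ⟨Sum.inl c, _⟩ => Sum.inl c
    | ⟨Sum.inr d, h⟩ => Sum.inr ((support φ).equivFin ⟨d, Finset.mem_toRight.2 h⟩)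

/-- The basic notions only quantify over parameter tuples indexed by `Fin k`; this reduces arbitrary
index types to that case. -/
theorem realize_supportFormula {γ : Type*} {δ : Type*} (φ : L.Formula (γ ⊕ δ)) {N : Type*}
    [L.Structure N] (b : γ → N) (a : δ → N) :
    (supportFormula φ).Realize (Sum.elim b (a ∘ supportMap φ)) ↔ φ.Realize (Sum.elim b a) := by
  classical
  refine BoundedFormula.realize_restrictFreeVar (Sum.elim b a) ?_
  rintro ⟨c | d, h⟩ <;> simp [supportMap]

/-- Compactness for sets of formulas. -/
theorem exists_realize_of_finite {α : Type w'} (Γ : Set (L.Formula α))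
    (h : ∀ s : Finset (L.Formula α), (s : Set (L.Formula α)) ⊆ Γ →
      ∃ (N : Type w) (_ : L.Structure N) (_ : Nonempty N) (v : α → N), ∀ φ ∈ s, φ.Realize v) :
    ∃ (N : Type (max u v w')) (_ : L.Structure N) (_ : Nonempty N) (v : α → N),
      ∀ φ ∈ Γ, φ.Realize v := by
  classical
  have hsat : Theory.IsSatisfiable (Formula.equivSentence '' Γ : L[[α]].Theory) := by
    rw [Theory.isSatisfiable_iff_isFinitelySatisfiable]
    intro t ht
    obtain ⟨s, hs, rfl⟩ := Finset.subset_set_image_iff.1 ht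
    obtain ⟨N, _, _, v, hv⟩ := h s hs
    let := constantsOn.structure v
    have : N ⊨ ((s.image Formula.equivSentence : Finset _) : L[[α]].Theory) := by
      rw [Theory.model_iff]
      intro φ hφ
      obtain ⟨ψ, hψ, rfl⟩ := Finset.mem_image.1 (Finset.mem_coe.1 hφ)
      rw [Formula.realize_equivSentence]
      exact hv ψ hψ
    exact Theory.Model.isSatisfiable N
  obtain ⟨N⟩ := hsat
  let : L.Structure N := (L.lhomWithConstants α).reduct N
  have : (L.lhomWithConstants α).IsExpansionOn N := LHom.isExpansionOn_reduct _ _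
  refine ⟨N, inferInstance, inferInstance, fun a => (L.con a : N), fun φ hφ => ?_⟩
  rw [← Formula.realize_equivSentence]
  exact N.is_model.realize_of_mem _ ⟨φ, hφ, rfl⟩

/-- Two tuples have the same type over the empty set. -/
def TpEq (L : FirstOrder.Language.{u, v}) {U : Type*} [L.Structure U] {γ : Type*}
    (a b : γ → U) : Prop :=
  ∀ φ : L.Formula γ, φ.Realize a ↔ φ.Realize b

theorem TpEq.symm {U : Type*} [L.Structure U] {γ : Type*} {a b : γ → U} (h : TpEq L a b) :
    TpEq L b a := fun φ => (h φ).symm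

theorem TpEq.trans {U : Type*} [L.Structure U] {γ : Type*} {a b c : γ → U} (h : TpEq L a b)
    (h' : TpEq L b c) : TpEq L a c := fun φ => (h φ).trans (h' φ)

theorem TpEq.comp {U : Type*} [L.Structure U] {γ δ : Type*} {a b : γ → U} (h : TpEq L a b)
    (f : δ → γ) : TpEq L (a ∘ f) (b ∘ f) := fun φ => by
  simpa using h (φ.relabel f)

/-- The formula stating that the instances of `φ` at the subtuples selected by `f` have a common
solution. -/
noncomputable def commonSolution {n : ℕ} {β γ ι : Type*} [Finite ι] (φ : L.Formula (Fin n ⊕ β))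
    (f : ι → β → γ) : L.Formula γ :=
  (Formula.iInf fun i => φ.relabel (Sum.elim Sum.inr (Sum.inl ∘ f i))).iExs (Fin n)

theorem realize_commonSolution {U : Type*} [L.Structure U] {n : ℕ} {β γ ι : Type*} [Finite ι]
    (φ : L.Formula (Fin n ⊕ β)) (f : ι → β → γ) (a : γ → U) :
    (commonSolution φ f).Realize a ↔ ∃ x : Fin n → U, ∀ i, φ.Realize (Sum.elim x (a ∘ f i)) := by
  simp only [commonSolution, Formula.realize_iExs, Formula.realize_iInf, Formula.realize_relabel]
  refine exists_congr fun x => forall_congr' fun i => ?_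
  rw [Sum.comp_elim, Sum.elim_comp_inr, ← Function.comp_assoc, Sum.elim_comp_inl]

theorem TpEq.exists_solution {U : Type*} [L.Structure U] {n : ℕ} {β γ ι : Type*} [Finite ι]
    {a b : γ → U} (h : TpEq L a b) (φ : L.Formula (Fin n ⊕ β)) (f : ι → β → γ)
    (ha : ∃ x : Fin n → U, ∀ i, φ.Realize (Sum.elim x (a ∘ f i))) :
    ∃ x : Fin n → U, ∀ i, φ.Realize (Sum.elim x (b ∘ f i)) := by
  rw [← realize_commonSolution] at ha ⊢
  exact (h _).1 ha

end Basics

/-! ### Global types as types in elementary extensions and as ultrafilter limits. -/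

section GlobalTypes

variable {L : FirstOrder.Language.{u, v}} {U : Type w}

theorem realize_plug {N : Type*} [L.Structure N] [L[[U]].Structure N]
    [(L.lhomWithConstants U).IsExpansionOn N] {α γ : Type} (φ : L.Formula (α ⊕ γ)) (e : γ → U)
    (v : α → N) :
    (plug φ e).Realize v ↔ φ.Realize (Sum.elim v fun i => (L.con (e i) : N)) := by
  rw [plug, Formula.Realize, ← BoundedFormula.realize_constantsVarsEquiv, Equiv.apply_symm_apply,
    ← Formula.Realize, Formula.realize_relabel, Sum.comp_elim, Sum.elim_comp_inr]
  rfl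

variable [L.Structure U]

/-- A complete type over `U` is the type of a tuple in an elementary extension of `U`. -/
theorem exists_realization [Nonempty U] {β : Type} (q : (L.elementaryDiagram U).CompleteType β) :
    ∃ (N : Type (max u v w)) (_ : L.Structure N) (g : U ↪ₑ[L] N) (v : β → N),
      ∀ {γ : Type} (φ : L.Formula (β ⊕ γ)) (e : γ → U),
        Has q φ e ↔ φ.Realize (Sum.elim v (g ∘ e)) := by
  obtain ⟨N, v, rfl⟩ := (L.elementaryDiagram U).exists_modelType_is_realized_in q
  let : L.Structure N := (L.lhomWithConstants U).reduct N
  have : (L.lhomWithConstants U).IsExpansionOn N := LHom.isExpansionOn_reduct _ _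
  refine ⟨N, inferInstance, ElementaryEmbedding.ofModelsElementaryDiagram L U N, v,
    fun φ e => ?_⟩
  rw [Has, Theory.CompleteType.formula_mem_typeOf, realize_plug]
  rfl

/-- By Łoś, the average of `D` is the type of the class of the identity in the ultrapower along `D`.
If `D` concentrates on tuples from `A`, this type is `A`-invariant; all invariant types constructed
below arise in this way. -/
theorem exists_has_iff_eventually [Nonempty U] {β : Type} (D : Ultrafilter (β → U)) :
    ∃ q : (L.elementaryDiagram U).CompleteType β,
      ∀ {γ : Type} (φ : L.Formula (β ⊕ γ)) (e : γ → U),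
        Has q φ e ↔ ∀ᶠ b in D, φ.Realize (Sum.elim b e) := by
  let N := (D : Filter (β → U)).Product fun _ => U
  let str : L[[U]].Structure N := Ultraproduct.structure
  have hN : N ⊨ L.elementaryDiagram U := by
    rw [Theory.model_iff]
    intro φ hφ
    exact (Ultraproduct.sentence_realize φ).2 (Filter.Eventually.of_forall fun _ => hφ)
  have : Nonempty N := Ultraproduct.Product.instNonempty
  let v : β → N := fun j => ((fun b => b j : (β → U) → U) : N)
  refine ⟨(L.elementaryDiagram U).typeOf v, fun φ e => ?_⟩
  rw [Has, Theory.CompleteType.formula_mem_typeOf]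
  refine (Ultraproduct.realize_formula_cast (plug φ e) (fun j (b : β → U) => b j)).trans ?_
  refine Filter.eventually_congr (Filter.Eventually.of_forall fun b => ?_)
  exact realize_plug φ e b

end GlobalTypes

/-! ### Realizing types and moving tuples in saturated models. -/

section Saturated

variable {L : FirstOrder.Language.{u, v}} {U : Type w} [L.Structure U]

/-- In a saturated structure, a finitely satisfiable family of formulas over a small set is
realized. -/
theorem IsSaturated.exists_realize {μ : Cardinal.{w}} (hU : IsSaturated L U μ) {β : Type}
    [Finite β] {ι : Type*} {A : Set U} (hA : #A < μ) {γ : ι → Type*}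
    (φ : ∀ i, L.Formula (β ⊕ γ i)) (e : ∀ i, γ i → U) (he : ∀ i t, e i t ∈ A)
    (hfin : ∀ s : Finset ι, ∃ b : β → U, ∀ i ∈ s, (φ i).Realize (Sum.elim b (e i))) :
    ∃ b : β → U, ∀ i, (φ i).Realize (Sum.elim b (e i)) := by
  classical
  obtain ⟨n, ⟨ε⟩⟩ := Finite.exists_equiv_fin β
  let χ : ι → L[[A]].Formula (Fin n) := fun i =>
    BoundedFormula.constantsVarsEquiv.symm
      ((φ i).relabel (Sum.elim (Sum.inr ∘ ε) (Sum.inl ∘ fun t => (⟨e i t, he i t⟩ : A))))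
  have hχ : ∀ i (a : Fin n → U), (χ i).Realize a ↔ (φ i).Realize (Sum.elim (a ∘ ε) (e i)) := by
    intro i a
    rw [Formula.Realize, ← BoundedFormula.realize_constantsVarsEquiv, Equiv.apply_symm_apply,
      ← Formula.Realize, Formula.realize_relabel, Sum.comp_elim, ← Function.comp_assoc,
      Sum.elim_comp_inr]
    rfl
  obtain ⟨a, ha⟩ := hU A hA n (Set.range χ) (by
    intro s hs
    obtain ⟨t, ht⟩ : ∃ t : Finset ι, s = t.image χ := by
      obtain ⟨t, -, ht⟩ := Finset.subset_set_image_iff.1 (by simpa using hs :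
        (s : Set _) ⊆ χ '' Set.univ)
      exact ⟨t, ht.symm⟩
    obtain ⟨b, hb⟩ := hfin t
    refine ⟨b ∘ ε.symm, ?_⟩
    subst ht
    intro ψ hψ
    obtain ⟨i, hi, rfl⟩ := Finset.mem_image.1 hψ
    rw [hχ]
    have : (b ∘ ε.symm) ∘ ε = b := by ext; simp
    rw [this]
    exact hb i hi)
  exact ⟨a ∘ ε, fun i => (hχ i a).1 (ha _ ⟨i, rfl⟩)⟩

theorem IsSaturated.mono {μ μ' : Cardinal.{w}} (hU : IsSaturated L U μ) (h : μ' ≤ μ) :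
    IsSaturated L U μ' :=
  fun A hA => hU A (hA.trans_le h)

theorem sumElim_comp_swap {α β γ : Type*} (f : α → γ) (g : β → γ) :
    Sum.elim f g ∘ Sum.swap = Sum.elim g f := by
  ext (x | x) <;> rfl

/-- Types of finite tuples can be moved along equality of types. -/
theorem TpEq.exists_extend {μ : Cardinal.{w}} (hU : IsSaturated L U μ) (hμ : ℵ₀ ≤ μ)
    {γ δ : Type} [Finite γ] [Finite δ] {a a' : γ → U} (h : TpEq L a a') (t : δ → U) :
    ∃ t' : δ → U, TpEq L (Sum.elim a t) (Sum.elim a' t') := by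
  have hfin : (Set.range a').Finite := Set.finite_range _
  obtain ⟨t', ht'⟩ := hU.exists_realize (β := δ) (A := Set.range a')
    ((Cardinal.lt_aleph0_iff_set_finite.2 hfin).trans_le hμ)
    (ι := {φ : L.Formula (γ ⊕ δ) // φ.Realize (Sum.elim a t)})
    (fun φ => φ.1.relabel Sum.swap) (fun _ => a') (fun _ i => ⟨i, rfl⟩) (by
      intro s
      have h1 : ((Formula.iInf fun φ : s => φ.1.1).iExs δ).Realize a := by
        simp only [Formula.realize_iExs, Formula.realize_iInf]
        exact ⟨t, fun φ => φ.1.2⟩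
      rw [h] at h1
      simp only [Formula.realize_iExs, Formula.realize_iInf] at h1
      obtain ⟨b, hb⟩ := h1
      refine ⟨b, fun φ hφ => ?_⟩
      rw [Formula.realize_relabel, sumElim_comp_swap]
      exact hb ⟨φ, hφ⟩)
  have key : ∀ φ : L.Formula (γ ⊕ δ), φ.Realize (Sum.elim a t) →
      φ.Realize (Sum.elim a' t') := by
    intro φ hφ
    have := ht' ⟨φ, hφ⟩
    rwa [Formula.realize_relabel, sumElim_comp_swap] at this
  refine ⟨t', fun φ => ⟨key φ, fun h => ?_⟩⟩
  by_contra hn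
  exact key φ.not hn h

end Saturated

/-! ### Invariant types and sequences realizing them. -/

section Has

variable {L : FirstOrder.Language.{u, v}} {U : Type w} [L.Structure U] {β : Type}
  {q : (L.elementaryDiagram U).CompleteType β}

theorem EquivOver.comp {A : Set U} {γ δ : Type} {a a' : γ → U} (h : EquivOver (L := L) A a a')
    (f : δ → γ) : EquivOver (L := L) A (a ∘ f) (a' ∘ f) := by
  intro k φ d hd
  have := h k (φ.relabel (Sum.map f id)) d hd
  simpa [Formula.realize_relabel, Sum.elim_comp_map] using this

theorem EquivOver.realize_iff {A : Set U} {γ δ : Type} {a a' : γ → U}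
    (h : EquivOver (L := L) A a a') (φ : L.Formula (γ ⊕ δ)) {d : δ → U} (hd : ∀ i, d i ∈ A) :
    φ.Realize (Sum.elim a d) ↔ φ.Realize (Sum.elim a' d) := by
  rw [← realize_supportFormula, ← realize_supportFormula φ]
  exact h _ _ _ fun i => hd _

theorem EquivOver.tpEq {A : Set U} {γ : Type} {a a' : γ → U} (h : EquivOver (L := L) A a a') :
    TpEq L a a' := by
  intro φ
  have := h 0 (φ.relabel Sum.inl) Fin.elim0 fun i => i.elim0
  simpa using this

theorem RealizesOver.mono {C C' : Set U} {b : β → U} (h : RealizesOver C q b) (hC : C' ⊆ C) :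
    RealizesOver C' q b :=
  fun k φ e he => h k φ e fun i => hC (he i)

theorem RealizesOver.equivOver {A : Set U} {b b' : β → U} (h : RealizesOver A q b)
    (h' : RealizesOver A q b') : EquivOver (L := L) A b b' :=
  fun k φ e he => (h k φ e he).symm.trans (h' k φ e he)

variable [Nonempty U]

theorem has_not {γ : Type} (φ : L.Formula (β ⊕ γ)) (e : γ → U) : Has q φ.not e ↔ ¬Has q φ e := by
  obtain ⟨N, _, g, v, h⟩ := exists_realization q
  rw [h, h, Formula.realize_not]

/-- Finitely many formulas of a complete type over `U` have a common solution in `U`. -/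
theorem Has.exists_realize [Finite β] {ι : Type} [Finite ι] {γ : ι → Type} [∀ i, Finite (γ i)]
    {φ : ∀ i, L.Formula (β ⊕ γ i)} {e : ∀ i, γ i → U} (h : ∀ i, Has q (φ i) (e i)) :
    ∃ b : β → U, ∀ i, (φ i).Realize (Sum.elim b (e i)) := by
  obtain ⟨N, _, g, v, hq⟩ := exists_realization q
  let ψ : L.Formula ((Σ i, γ i) ⊕ β) :=
    Formula.iInf fun i => (φ i).relabel (Sum.elim Sum.inr fun t => Sum.inl ⟨i, t⟩)
  have hψ : ∀ {K : Type (max u v w)} [L.Structure K] (b : β → K) (c : ∀ i, γ i → K),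
      ψ.Realize (Sum.elim (fun p => c p.1 p.2) b) ↔ ∀ i, (φ i).Realize (Sum.elim b (c i)) := by
    intro K _ b c
    simp only [ψ, Formula.realize_iInf, Formula.realize_relabel, Sum.comp_elim, Sum.elim_comp_inr]
    rfl
  have hψ' : ∀ (b : β → U) (c : ∀ i, γ i → U),
      ψ.Realize (Sum.elim (fun p => c p.1 p.2) b) ↔ ∀ i, (φ i).Realize (Sum.elim b (c i)) := by
    intro b c
    simp only [ψ, Formula.realize_iInf, Formula.realize_relabel, Sum.comp_elim, Sum.elim_comp_inr]
    rfl
  have h1 : (ψ.iExs β).Realize (g ∘ fun p : Σ i, γ i => e p.1 p.2) := by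
    rw [Formula.realize_iExs]
    exact ⟨v, (hψ v fun i => g ∘ e i).2 fun i => (hq _ _).1 (h i)⟩
  rw [g.map_formula, Formula.realize_iExs] at h1
  obtain ⟨b, hb⟩ := h1
  exact ⟨b, (hψ' b e).1 hb⟩

/-- Formulas with parameter variables of any type can be reduced to finitely many variables. -/
theorem has_supportFormula {γ : Type} (φ : L.Formula (β ⊕ γ)) (e : γ → U) :
    Has q (supportFormula φ) (e ∘ supportMap φ) ↔ Has q φ e := by
  obtain ⟨N, _, g, v, h⟩ := exists_realization q
  rw [h, h, ← realize_supportFormula φ]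
  rfl

theorem RealizesOver.has_iff {C : Set U} {b : β → U} (h : RealizesOver C q b) {γ : Type}
    (φ : L.Formula (β ⊕ γ)) {e : γ → U} (he : ∀ i, e i ∈ C) :
    Has q φ e ↔ φ.Realize (Sum.elim b e) := by
  rw [← has_supportFormula, ← realize_supportFormula]
  exact h _ _ _ fun i => he _

theorem IsInvariant.has_iff {A : Set U} (hq : IsInvariant A q) {γ : Type}
    (φ : L.Formula (β ⊕ γ)) {e e' : γ → U} (h : EquivOver (L := L) A e e') :
    Has q φ e ↔ Has q φ e' := by
  rw [← has_supportFormula, ← has_supportFormula φ]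
  exact hq _ _ _ _ (h.comp _)

/-- Realizations of an invariant type over equivalent tuples are equivalent. -/
theorem EquivOver.extend {A C C' : Set U} (hq : IsInvariant A q) {γ : Type} {a a' : γ → U}
    (h : EquivOver (L := L) A a a') {b b' : β → U} (hb : RealizesOver C q b)
    (hb' : RealizesOver C' q b') (hA : A ⊆ C) (hA' : A ⊆ C') (ha : ∀ i, a i ∈ C)
    (ha' : ∀ i, a' i ∈ C') : EquivOver (L := L) A (Sum.elim a b) (Sum.elim a' b') := by
  intro k φ d hd
  let ψ : L.Formula (β ⊕ (γ ⊕ Fin k)) :=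
    φ.relabel (Sum.elim (Sum.elim (Sum.inr ∘ Sum.inl) Sum.inl) (Sum.inr ∘ Sum.inr))
  have hψ : ∀ (b : β → U) (a : γ → U),
      ψ.Realize (Sum.elim b (Sum.elim a d)) ↔ φ.Realize (Sum.elim (Sum.elim a b) d) := by
    intro b a
    rw [Formula.realize_relabel]
    simp only [Sum.comp_elim, ← Function.comp_assoc, Sum.elim_comp_inr, Sum.elim_comp_inl]
  rw [← hψ, ← hψ, ← hb.has_iff ψ (Sum.rec ha fun i => hA (hd i)),
    ← hb'.has_iff ψ (Sum.rec ha' fun i => hA' (hd i))]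
  -- It remains to compare membership in `q` at the parameters `(a, d)` and `(a', d)`. These are
  -- equivalent over `A` because `d` lies in `A`.
  refine hq.has_iff ψ fun l χ c hc => ?_
  have hχ : ∀ a : γ → U, (χ.relabel (Sum.elim (Sum.elim Sum.inl (Sum.inr ∘ Sum.inl))
      (Sum.inr ∘ Sum.inr) : (γ ⊕ Fin k) ⊕ Fin l → γ ⊕ (Fin k ⊕ Fin l))).Realize
        (Sum.elim a (Sum.elim d c)) ↔ χ.Realize (Sum.elim (Sum.elim a d) c) := by
    intro a
    rw [Formula.realize_relabel]
    simp only [Sum.comp_elim, ← Function.comp_assoc, Sum.elim_comp_inr, Sum.elim_comp_inl]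
  rw [← hχ, ← hχ]
  exact h.realize_iff _ (Sum.rec hd hc)

/-- Sequences whose terms successively realize the same invariant types over the previous terms
are equivalent. -/
theorem EquivOver.extend_seq {A : Set U} {ρ : ℕ → (L.elementaryDiagram U).CompleteType β}
    (hρ : ∀ i, IsInvariant A (ρ i)) {γ : Type} {a a' : γ → U} (h : EquivOver (L := L) A a a')
    {b b' : ℕ → β → U} (k : ℕ)
    (hb : ∀ i < k, RealizesOver (A ∪ Set.range a ∪ ⋃ j < i, Set.range (b j)) (ρ i) (b i))
    (hb' : ∀ i < k, RealizesOver (A ∪ Set.range a' ∪ ⋃ j < i, Set.range (b' j)) (ρ i) (b' i)) :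
    EquivOver (L := L) A (Sum.elim a fun p : Fin k × β => b p.1 p.2)
      (Sum.elim a' fun p : Fin k × β => b' p.1 p.2) := by
  induction k with
  | zero =>
    have := h.comp (Sum.elim id fun p : Fin 0 × β => p.1.elim0)
    convert this using 1 <;>
    · ext (x | x)
      · rfl
      · exact x.1.elim0
  | succ k ih =>
    have h1 := EquivOver.extend (hρ k)
      (ih (fun i hi => hb i (hi.trans k.lt_succ_self)) fun i hi => hb' i (hi.trans k.lt_succ_self))
      (hb k k.lt_succ_self) (hb' k k.lt_succ_self)
      (fun x hx => Or.inl (Or.inl hx)) (fun x hx => Or.inl (Or.inl hx))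
      (by
        rintro (i | i)
        · exact Or.inl (Or.inr ⟨i, rfl⟩)
        · exact Or.inr (Set.mem_iUnion₂.2 ⟨i.1, i.1.2, i.2, rfl⟩))
      (by
        rintro (i | i)
        · exact Or.inl (Or.inr ⟨i, rfl⟩)
        · exact Or.inr (Set.mem_iUnion₂.2 ⟨i.1, i.1.2, i.2, rfl⟩))
    have h2 := h1.comp (Sum.elim (Sum.inl ∘ Sum.inl) fun p : Fin (k + 1) × β =>
      Fin.lastCases (motive := fun _ => (γ ⊕ Fin k × β) ⊕ β) (Sum.inr p.2)
        (fun i => Sum.inl (Sum.inr (i, p.2))) p.1)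
    convert h2 using 1 <;>
    · ext (x | ⟨i, x⟩)
      · rfl
      · induction i using Fin.lastCases <;> simp

/-- Sequences whose terms successively realize the same invariant types over the previous terms
have the same type. -/
theorem tpEq_of_realizesOver {A : Set U} {ρ : ℕ → (L.elementaryDiagram U).CompleteType β}
    (hρ : ∀ i, IsInvariant A (ρ i)) {b b' : ℕ → β → U} (k : ℕ)
    (hb : ∀ i < k, RealizesOver (A ∪ ⋃ j < i, Set.range (b j)) (ρ i) (b i))
    (hb' : ∀ i < k, RealizesOver (A ∪ ⋃ j < i, Set.range (b' j)) (ρ i) (b' i)) :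
    TpEq L (fun p : Fin k × β => b p.1 p.2) (fun p : Fin k × β => b' p.1 p.2) := by
  have hr : Set.range (Empty.elim : Empty → U) = ∅ := Set.range_eq_empty _
  have h0 : EquivOver (L := L) A (Empty.elim : Empty → U) Empty.elim := fun _ _ _ _ => Iff.rfl
  exact (EquivOver.extend_seq hρ h0 (b := b) (b' := b') k
    (by simpa only [hr, Set.union_empty] using hb)
    (by simpa only [hr, Set.union_empty] using hb')).tpEq.comp Sum.inr

theorem exists_realizesOver [Finite β] {μ : Cardinal.{w}} (hU : IsSaturated L U μ) {C : Set U}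
    (hC : #C < μ) (q : (L.elementaryDiagram U).CompleteType β) : ∃ b, RealizesOver C q b := by
  classical
  obtain ⟨b, hb⟩ := hU.exists_realize (β := β) hC
    (ι := {p : Σ k : ℕ, L.Formula (β ⊕ Fin k) × (Fin k → C) //
      Has q p.2.1 fun i => (p.2.2 i : U)})
    (γ := fun p => Fin p.1.1) (fun p => p.1.2.1) (fun p i => (p.1.2.2 i : U))
    (fun p i => (p.1.2.2 i).2) (by
      intro s
      obtain ⟨b, hb⟩ := Has.exists_realize (q := q) (ι := Fin s.card)
        (γ := fun i => Fin (s.equivFin.symm i).1.1.1)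
        (φ := fun i => (s.equivFin.symm i).1.1.2.1)
        (e := fun i t => ((s.equivFin.symm i).1.1.2.2 t : U))
        (fun i => (s.equivFin.symm i).1.2)
      refine ⟨b, fun p hp => ?_⟩
      have := hb (s.equivFin ⟨p, hp⟩)
      rw [Equiv.symm_apply_apply] at this
      exact this)
  have key : ∀ (k : ℕ) (φ : L.Formula (β ⊕ Fin k)) (e : Fin k → U), (∀ i, e i ∈ C) →
      Has q φ e → φ.Realize (Sum.elim b e) :=
    fun k φ e he h => hb ⟨⟨k, φ, fun i => ⟨e i, he i⟩⟩, h⟩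
  refine ⟨b, fun k φ e he => ⟨key k φ e he, fun h => ?_⟩⟩
  by_contra hn
  exact key k φ.not e he ((has_not φ e).2 hn) h

theorem mk_union_lt_of_finite {α : Type w} {μ : Cardinal.{w}} (hμ : ℵ₀ ≤ μ) {A B : Set α}
    (hA : #A < μ) (hB : B.Finite) : #(A ∪ B : Set α) < μ :=
  (Cardinal.mk_union_le A B).trans_lt
    (Cardinal.add_lt_of_lt hμ hA ((Cardinal.lt_aleph0_iff_set_finite.2 hB).trans_le hμ))

theorem exists_realizesOver_seq [Finite β] {μ : Cardinal.{w}} (hU : IsSaturated L U μ)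
    (hμ : ℵ₀ ≤ μ) {A : Set U} (hA : #A < μ)
    (ρ : ℕ → (L.elementaryDiagram U).CompleteType β) :
    ∃ b : ℕ → β → U, ∀ i, RealizesOver (A ∪ ⋃ j < i, Set.range (b j)) (ρ i) (b i) := by
  have hex : ∀ i (c : ∀ j < i, β → U),
      ∃ b, RealizesOver (A ∪ ⋃ j, ⋃ h : j < i, Set.range (c j h)) (ρ i) b := by
    intro i c
    refine exists_realizesOver hU (mk_union_lt_of_finite hμ hA ?_) _
    exact Set.Finite.iUnion (Set.finite_lt_nat i) (fun j _ => Set.finite_iUnion fun h =>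
      Set.finite_range _) (fun j hj => by simp only [Set.iUnion_eq_empty]; exact fun h => (hj h).elim)
  choose F hF using hex
  let b : ℕ → β → U := fun i => Nat.strongRec (fun i c => F i c) i
  have hb : ∀ i, b i = F i fun j _ => b j := by
    intro i
    simp only [b]
    rw [Nat.strongRec]
  exact ⟨b, fun i => by rw [hb i]; exact hF i fun j _ => b j⟩

end Has

/-! ### Unfolding an array of pairs into a binary tree. -/

section Tree

variable {L : FirstOrder.Language.{u, v}} {U : Type w} [L.Structure U]

/-- From an array of pairs `c j false`, `c j true` having the same type over the previous pairs,
one builds a binary tree all of whose branches look like `(c j false)_j`, and where a node branching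
off to the right of a branch looks like `c j true` from the point of view of this branch. -/
theorem exists_tree {μ : Cardinal.{w}} (hU : IsSaturated L U μ) (hμ : ℵ₀ ≤ μ) {β : Type}
    [Finite β] (k : ℕ) : ∀ {γ : Type} [Finite γ] (z : γ → U) (c : ℕ → Bool → β → U),
    (∀ j < k, TpEq L
      (Sum.elim (Sum.elim z fun p : Fin j × Bool × β => c p.1 p.2.1 p.2.2) (c j false))
      (Sum.elim (Sum.elim z fun p : Fin j × Bool × β => c p.1 p.2.1 p.2.2) (c j true))) →
    ∃ e : List Bool → β → U,
      (∀ η : List Bool, η.length = k →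
        TpEq L (Sum.elim z fun p : Fin k × β => e (η.take (p.1 + 1)) p.2)
          (Sum.elim z fun p : Fin k × β => c p.1 false p.2)) ∧
      ∀ η ν : List Bool, ν.length = k → (η ++ [false]) <+: ν →
        TpEq L
          (Sum.elim (Sum.elim z (e (η ++ [true])))
            fun p : Fin k × β => e (ν.take (p.1 + 1)) p.2)
          (Sum.elim (Sum.elim z (c η.length true)) fun p : Fin k × β => c p.1 false p.2) := by
  induction k with
  | zero =>
    intro γ _ z c _
    refine ⟨fun _ => c 0 false, fun η _ => ?_, fun η ν hν h => ?_⟩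
    · have : (fun p : Fin 0 × β => c 0 false p.2) = fun p => c p.1 false p.2 :=
        funext fun p => p.1.elim0
      rw [this]
      exact fun _ => Iff.rfl
    · have := h.length_le
      simp [hν] at this
  | succ k ih =>
    intro γ _ z c h
    -- The first pair joins the base, so the subtree obtained from the remaining pairs is controlled
    -- over both `c 0 false` and `c 0 true`.
    obtain ⟨e', hP, hQ⟩ := ih (Sum.elim z fun p : Bool × β => c 0 p.1 p.2) (fun j => c (j + 1)) (by
      intro j hj
      have h1 := (h (j + 1) (by omega)).comp (Sum.map (Sum.elim
        (Sum.elim Sum.inl fun p : Bool × β => Sum.inr (0, p))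
        fun p : Fin j × Bool × β => Sum.inr (p.1.succ, p.2)) id :
          ((γ ⊕ Bool × β) ⊕ (Fin j × Bool × β)) ⊕ β → (γ ⊕ (Fin (j + 1) × Bool × β)) ⊕ β)
      convert h1 using 1 <;> ext (((x | x) | x) | x) <;> rfl)
    let I := {η : List Bool // η.length ≤ k}
    have : Finite I := List.finite_length_le Bool k
    have h0 : TpEq L (Sum.elim z (c 0 false)) (Sum.elim z (c 0 true)) := by
      have h1 := (h 0 (by omega)).comp (Sum.map Sum.inl id :
        γ ⊕ β → (γ ⊕ (Fin 0 × Bool × β)) ⊕ β)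
      convert h1 using 1 <;> ext (x | x) <;> rfl
    -- As `c 0 false` and `c 0 true` have the same type over `z`, the finitely many relevant nodes
    -- of the subtree have a copy lying over `c 0 true` as the original lies over `c 0 false`.
    obtain ⟨t', ht'⟩ := h0.exists_extend hU hμ fun p : I × β => e' p.1 p.2
    let e'' : List Bool → β → U := fun η s =>
      if h : η.length ≤ k then t' (⟨η, h⟩, s) else e' η s
    let e : List Bool → β → U := fun η =>
      match η with
      -- A dummy root: only nonempty nodes occur in the conclusion.
      | [] => c 0 false
      | [b] => c 0 b
      | false :: a :: η => e' (a :: η)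
      | true :: a :: η => e'' (a :: η)
    -- The two halves of the tree, with their roots, have the same type over `z`, so statements
    -- about the right half reduce to the left half.
    have hS : TpEq L (Sum.elim z fun p : I × β => e (false :: p.1) p.2)
        (Sum.elim z fun p : I × β => e (true :: p.1) p.2) := by
      have h1 := ht'.comp (Sum.elim (Sum.inl ∘ Sum.inl) fun p : I × β =>
        match p with
        | (⟨[], _⟩, s) => Sum.inl (Sum.inr s)
        | (⟨a :: η, h⟩, s) => Sum.inr (⟨a :: η, h⟩, s))
      convert h1 using 1
      · ext (x | ⟨⟨_ | ⟨a, η⟩, hη⟩, s⟩) <;> rfl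
      · ext (x | ⟨⟨_ | ⟨a, η⟩, hη⟩, s⟩)
        · rfl
        · rfl
        · simp only [Sum.elim_inr, Function.comp, e, e'']
          rw [dif_pos hη]
    have htake : ∀ (b : Bool) (η : List Bool) (i : Fin (k + 1)),
        (b :: η).take (i + 1) = b :: η.take i := fun b η i => rfl
    have he' : ∀ (η : List Bool), η.length = k → ∀ (i : Fin k) s,
        e (false :: η.take (i + 1)) s = e' (η.take (i + 1)) s := by
      intro η hη i s
      match η with
      | [] => exact absurd (i.2.trans_eq hη.symm) (Nat.not_lt_zero _)
      | a :: η => rfl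
    have hPf : ∀ η : List Bool, η.length = k →
        TpEq L (Sum.elim z fun p : Fin (k + 1) × β => e ((false :: η).take (p.1 + 1)) p.2)
          (Sum.elim z fun p : Fin (k + 1) × β => c p.1 false p.2) := by
      intro η hη
      have h1 := (hP η hη).comp (Sum.elim (Sum.inl ∘ Sum.inl) fun p : Fin (k + 1) × β =>
        Fin.cases (motive := fun _ => (γ ⊕ Bool × β) ⊕ Fin k × β) (Sum.inl (Sum.inr (false, p.2)))
          (fun i => Sum.inr (i, p.2)) p.1)
      convert h1 using 1
      · ext (x | ⟨i, s⟩)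
        · rfl
        · induction i using Fin.cases with
          | zero => rfl
          | succ i => exact he' η hη i s
      · ext (x | ⟨i, s⟩)
        · rfl
        · induction i using Fin.cases <;> rfl
    have hQf : ∀ η ν : List Bool, ν.length = k → (η ++ [false]) <+: ν →
        TpEq L
          (Sum.elim (Sum.elim z (e (false :: (η ++ [true]))))
            fun p : Fin (k + 1) × β => e ((false :: ν).take (p.1 + 1)) p.2)
          (Sum.elim (Sum.elim z (c (η.length + 1) true))
            fun p : Fin (k + 1) × β => c p.1 false p.2) := by
      intro η ν hν hην
      have h1 := (hQ η ν hν hην).comp (Sum.elim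
        (Sum.elim (Sum.inl ∘ Sum.inl ∘ Sum.inl) (Sum.inl ∘ Sum.inr))
        fun p : Fin (k + 1) × β =>
        Fin.cases (motive := fun _ => ((γ ⊕ Bool × β) ⊕ β) ⊕ Fin k × β)
          (Sum.inl (Sum.inl (Sum.inr (false, p.2)))) (fun i => Sum.inr (i, p.2)) p.1)
      convert h1 using 1
      · ext ((x | x) | ⟨i, s⟩)
        · rfl
        · match η with
          | [] => rfl
          | a :: η => rfl
        · induction i using Fin.cases with
          | zero => rfl
          | succ i => exact he' ν hν i s
      · ext ((x | x) | ⟨i, s⟩)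
        · rfl
        · rfl
        · induction i using Fin.cases <;> rfl
    refine ⟨e, fun η hη => ?_, fun η ν hν hην => ?_⟩
    · match η with
      | false :: η => exact hPf η (by simpa using hη)
      | true :: η =>
        have hη' : η.length = k := by simpa using hη
        refine TpEq.trans (TpEq.symm ?_) (hPf η hη')
        have h1 := hS.comp (Sum.map id fun p : Fin (k + 1) × β =>
          ((⟨η.take p.1, by simp [hη']⟩, p.2) : I × β))
        convert h1 using 1 <;> ext (x | x) <;> rfl
    · match η, ν with
      | _, [] => simp at hν
      -- The node branching off is `c 0 true` itself. It lies in the enlarged base, so `hP` already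
      -- describes its type together with the left branch.
      | [], b :: ν =>
        have hν' : ν.length = k := by simpa using hν
        obtain rfl : b = false := (List.cons_prefix_cons.1 hην).1.symm
        have h1 := (hP ν hν').comp (Sum.elim
          (Sum.elim (Sum.inl ∘ Sum.inl) fun s => Sum.inl (Sum.inr (true, s)))
          fun p : Fin (k + 1) × β =>
          Fin.cases (motive := fun _ => (γ ⊕ Bool × β) ⊕ Fin k × β)
            (Sum.inl (Sum.inr (false, p.2))) (fun i => Sum.inr (i, p.2)) p.1)
        convert h1 using 1
        · ext ((x | x) | ⟨i, s⟩)
          · rfl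
          · rfl
          · induction i using Fin.cases with
            | zero => rfl
            | succ i => exact he' ν hν' i s
        · ext ((x | x) | ⟨i, s⟩)
          · rfl
          · rfl
          · induction i using Fin.cases <;> rfl
      | a :: η, b :: ν =>
        have hν' : ν.length = k := by simpa using hν
        obtain ⟨rfl, hην'⟩ : a = b ∧ (η ++ [false]) <+: ν := by
          simpa [List.cons_prefix_cons] using hην
        match a with
        | false => exact hQf η ν hν' hην'
        | true =>
          refine TpEq.trans (TpEq.symm ?_) (hQf η ν hν' hην')
          have hlen : η.length + 1 ≤ k := by simpa [hν'] using hην'.length_le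
          have h1 := hS.comp (Sum.elim (Sum.elim Sum.inl
            fun s : β => Sum.inr ((⟨η ++ [true], by simpa using hlen⟩, s) : I × β))
            fun p : Fin (k + 1) × β => Sum.inr ((⟨ν.take p.1, by simp [hν']⟩, p.2) : I × β))
          convert h1 using 1 <;> ext ((x | x) | x) <;> rfl

end Tree

/-! ### SOP₁ from finite trees and from arrays. -/

section SOP

variable {L : FirstOrder.Language.{u, v}} {U : Type w} [L.Structure U]

/-- SOP₁ follows by compactness from the existence of SOP₁ trees of every finite height. -/
theorem sop1_of_finite_trees [Nonempty U] {T : L.Theory} [U ⊨ T] {n : ℕ} {β : Type} [Finite β]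
    (φ : L.Formula (Fin n ⊕ β))
    (h : ∀ K : ℕ, ∃ a : List Bool → β → U,
      (∀ η : List Bool, η.length = K →
        ∃ x : Fin n → U, ∀ i ≤ K, φ.Realize (Sum.elim x (a (η.take i)))) ∧
      ∀ η ν : List Bool, ν.length ≤ K → (η ++ [false]) <+: ν →
        ¬∃ x : Fin n → U, φ.Realize (Sum.elim x (a ν)) ∧
          φ.Realize (Sum.elim x (a (η ++ [true])))) : SOP1 T := by
  classical
  let path : List Bool → L.Formula (List Bool × β) := fun η =>
    commonSolution φ fun (i : Fin (η.length + 1)) s => (η.take i, s)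
  let pair : List Bool → List Bool → L.Formula (List Bool × β) := fun η ν =>
    (commonSolution φ fun (b : Bool) s => (bif b then ν else η ++ [true], s)).not
  let Γ : ℕ → Set (L.Formula (List Bool × β)) := fun K =>
    {χ | (∃ σ ∈ T, χ = Formula.relabel Empty.elim σ) ∨
      (∃ η : List Bool, η.length ≤ K ∧ χ = path η) ∨
      ∃ η ν : List Bool, ν.length ≤ K ∧ (η ++ [false]) <+: ν ∧ χ = pair η ν}
  have hmono : ∀ {K K'}, K ≤ K' → Γ K ⊆ Γ K' := by
    rintro K K' hK χ (h | ⟨η, h, h'⟩ | ⟨η, ν, h, h'⟩)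
    · exact Or.inl h
    · exact Or.inr (Or.inl ⟨η, h.trans hK, h'⟩)
    · exact Or.inr (Or.inr ⟨η, ν, h.trans hK, h'⟩)
  obtain ⟨N, _, _, v, hv⟩ := exists_realize_of_finite (⋃ K, Γ K) (by
    intro s hs
    have hs' : ∀ χ : s, ∃ K, χ.1 ∈ Γ K := fun χ => Set.mem_iUnion.1 (hs χ.2)
    choose f hf using hs'
    let K := s.attach.sup f
    obtain ⟨a, h1, h2⟩ := h K
    refine ⟨U, inferInstance, inferInstance, fun p => a p.1 p.2, fun χ hχ => ?_⟩
    have hχK : χ ∈ Γ K := hmono (Finset.le_sup (Finset.mem_attach s ⟨χ, hχ⟩)) (hf ⟨χ, hχ⟩)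
    rcases hχK with
      ⟨σ, hσ, hc⟩ | ⟨η, hη, hc⟩ | ⟨η, ν, hν, hην, hc⟩
    · rw [hc, Formula.realize_relabel, Subsingleton.elim (_ ∘ _) default]
      exact T.realize_sentence_of_mem (M := U) hσ
    · rw [hc, realize_commonSolution]
      obtain ⟨x, hx⟩ := h1 (η ++ List.replicate (K - η.length) false) (by simp; omega)
      refine ⟨x, fun i => ?_⟩
      have := hx i (by omega)
      rw [List.take_append_of_le_length (by omega)] at this
      exact this
    · rw [hc, Formula.realize_not, realize_commonSolution]
      rintro ⟨x, hx⟩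
      exact h2 η ν hν hην ⟨x, hx true, hx false⟩)
  have hT : N ⊨ T := ⟨fun σ hσ => by
    have := hv _ (Set.mem_iUnion.2 ⟨0, Or.inl ⟨σ, hσ, rfl⟩⟩)
    rwa [Formula.realize_relabel, Subsingleton.elim (_ ∘ _) default] at this⟩
  obtain ⟨m, ⟨ε⟩⟩ := Finite.exists_equiv_fin β
  suffices hN : FormulaSOP1 N (φ.relabel (Sum.map id ε)) from
    ⟨Theory.ModelType.of T N, n, m, _, hN⟩
  refine ⟨fun η t => v (η, ε.symm t), fun η s => ?_, fun η ν hην => ?_⟩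
  · let K := s.sup id
    have := hv (path ((List.range K).map η)) (Set.mem_iUnion.2 ⟨K, Or.inr (Or.inl ⟨_, by simp, rfl⟩)⟩)
    rw [realize_commonSolution] at this
    obtain ⟨x, hx⟩ := this
    refine ⟨x, fun i hi => ?_⟩
    have hiK : i ≤ K := Finset.le_sup (f := id) hi
    have := hx ⟨i, by simp; omega⟩
    beta_reduce
    rw [Formula.realize_relabel, Sum.elim_comp_map, Function.comp_id]
    convert this using 3
    ext s
    simp [← List.map_take, List.take_range, hiK]
  · have := hv (pair η ν) (Set.mem_iUnion.2 ⟨ν.length, Or.inr (Or.inr ⟨η, ν, le_rfl, hην, rfl⟩)⟩)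
    rw [Formula.realize_not, realize_commonSolution] at this
    rintro ⟨x, h1, h2⟩
    rw [Formula.realize_relabel, Sum.elim_comp_map, Function.comp_id] at h1 h2
    refine this ⟨x, fun b => ?_⟩
    cases b
    · convert h2 using 3
      ext s; simp
    · convert h1 using 3
      ext s; simp

/-- Spreads the letters of a word, leaving room for `l` letters `false` after each of them. -/
def spread (l : ℕ) (η : List Bool) : List Bool :=
  η.flatMap fun b => b :: List.replicate l false

theorem length_spread (l : ℕ) (η : List Bool) : (spread l η).length = (l + 1) * η.length := by
  induction η with
  | nil => rfl
  | cons b η ih =>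
    simp only [spread, List.flatMap_cons, List.length_append, List.length_cons,
      List.length_replicate] at ih ⊢
    rw [ih]
    ring

theorem spread_append (l : ℕ) (η ν : List Bool) :
    spread l (η ++ ν) = spread l η ++ spread l ν := by
  simp [spread]

/-- SOP₁ from arrays of arbitrary finite length, such that `c j false` and `c j true` have the same
type over the previous pairs. -/
theorem sop1_of_arrays [Nonempty U] {T : L.Theory} [U ⊨ T] {μ : Cardinal.{w}}
    (hU : IsSaturated L U μ) (hμ : ℵ₀ ≤ μ) {n : ℕ} {β : Type} [Finite β]
    (φ : L.Formula (Fin n ⊕ β)) (r l : ℕ)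
    (h : ∀ k : ℕ, ∃ (z : Fin r × β → U) (c : ℕ → Bool → β → U),
      (∀ j < k, TpEq L
        (Sum.elim (Sum.elim z fun p : Fin j × Bool × β => c p.1 p.2.1 p.2.2) (c j false))
        (Sum.elim (Sum.elim z fun p : Fin j × Bool × β => c p.1 p.2.1 p.2.2) (c j true))) ∧
      (∃ x : Fin n → U, (∀ s, φ.Realize (Sum.elim x fun b => z (s, b))) ∧
        ∀ j < k, φ.Realize (Sum.elim x (c j false))) ∧
      ∀ j < k, ∀ i, j ≤ i → i + l ≤ k →
        ¬∃ x : Fin n → U, (∀ s, φ.Realize (Sum.elim x fun b => z (s, b))) ∧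
          φ.Realize (Sum.elim x (c j true)) ∧ ∀ t < l, φ.Realize (Sum.elim x (c (i + t) false))) :
    SOP1 T := by
  -- The formula with SOP₁ is a conjunction of instances of `φ`: `r` fixed ones and a block of `l +
  -- 1` consecutive tree nodes. The first node of a block follows a letter of the word, the other
  -- `l` follow zeros.
  let ψ : L.Formula (Fin n ⊕ ((Fin r ⊕ Fin (l + 1)) × β)) :=
    Formula.iInf fun i : Fin r ⊕ Fin (l + 1) => φ.relabel (Sum.map id fun b => (i, b))
  have hψ : ∀ (x : Fin n → U) (d : (Fin r ⊕ Fin (l + 1)) × β → U),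
      ψ.Realize (Sum.elim x d) ↔ ∀ i, φ.Realize (Sum.elim x fun b => d (i, b)) := by
    intro x d
    simp only [ψ, Formula.realize_iInf, Formula.realize_relabel, Sum.elim_comp_map]
    rfl
  refine sop1_of_finite_trees (U := U) ψ fun K => ?_
  -- One block for each of the `K + 1` letters of `false :: η`; the extra leading letter provides
  -- the block of the root.
  obtain ⟨z, c, hE, hcon, hinc⟩ := h ((l + 1) * (K + 1))
  obtain ⟨e, hP, hQ⟩ := exists_tree hU hμ _ z c hE
  let a : List Bool → (Fin r ⊕ Fin (l + 1)) × β → U := fun η p =>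
    Sum.elim (fun s => z (s, p.2))
      (fun t : Fin (l + 1) => e ((spread l (false :: η)).take ((l + 1) * η.length + t + 1)) p.2) p.1
  refine ⟨a, fun η hη => ?_, fun η ν hν hην => ?_⟩
  · have hlen : (spread l (false :: η)).length = (l + 1) * (K + 1) := by
      rw [length_spread, List.length_cons, hη]
    obtain ⟨x, hx⟩ := (hP _ hlen).symm.exists_solution φ
      (fun (i : Fin r ⊕ Fin ((l + 1) * (K + 1))) b => Sum.map (fun s => (s, b)) (fun s => (s, b)) i)
      (by
        obtain ⟨x, h1, h2⟩ := hcon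
        refine ⟨x, ?_⟩
        rintro (s | t)
        · exact h1 s
        · exact h2 t t.2)
    refine ⟨x, fun i hi => (hψ _ _).2 ?_⟩
    rintro (s | t)
    · exact hx (Sum.inl s)
    · have hi' : (η.take i).length = i := by simp [hη, hi]
      have hlt : (l + 1) * i + t < (l + 1) * (K + 1) := by
        calc (l + 1) * i + t < (l + 1) * i + (l + 1) := by omega
          _ = (l + 1) * (i + 1) := by ring
          _ ≤ _ := Nat.mul_le_mul_left _ (by omega)
      have h1 := hx (Sum.inr ⟨(l + 1) * i + t, hlt⟩)
      have h2 : (spread l (false :: η.take i)).take ((l + 1) * i + t + 1) =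
          (spread l (false :: η)).take ((l + 1) * i + t + 1) := by
        have : spread l (false :: η) = spread l (false :: η.take i) ++ spread l (η.drop i) := by
          rw [← spread_append, List.cons_append, List.take_append_drop]
        rw [this, List.take_append_of_le_length]
        rw [length_spread, List.length_cons, hi']
        have : (l + 1) * (i + 1) = (l + 1) * i + l + 1 := by ring
        omega
      simp only [a, Sum.elim_inr, hi', h2]
      exact h1
  · rintro ⟨x, h1, h2⟩
    rw [hψ] at h1 h2
    have hη : η.length + 1 ≤ ν.length := by simpa using hην.length_le
    have hlη : (l + 1) * (η.length + 1) ≤ (l + 1) * ν.length := Nat.mul_le_mul_left _ hη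
    have hνK : (l + 1) * (ν.length + 1) ≤ (l + 1) * (K + 1) := Nat.mul_le_mul_left _ (by omega)
    have hexp : (l + 1) * (ν.length + 1) = (l + 1) * ν.length + l + 1 := by ring
    -- Only full branches are controlled by the tree, so the branch through `ν` is padded with
    -- zeros.
    let ξ := spread l (false :: ν) ++
      List.replicate ((l + 1) * (K + 1) - (l + 1) * (ν.length + 1)) false
    have hξ : ξ.length = (l + 1) * (K + 1) := by
      simp only [ξ, List.length_append, length_spread, List.length_cons, List.length_replicate]
      omega
    have hpre : (spread l (false :: η) ++ [false]) <+: ξ := by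
      obtain ⟨τ, rfl⟩ := hην
      refine List.IsPrefix.trans ?_ (List.prefix_append _ _)
      rw [← List.cons_append, ← List.cons_append, spread_append, spread_append, List.append_assoc]
      refine (List.prefix_append_right_inj _).2 ?_
      simp [spread]
    have hQ' := hQ (spread l (false :: η)) ξ hξ hpre
    rw [length_spread, List.length_cons] at hQ'
    obtain ⟨y, hy⟩ := hQ'.exists_solution φ
      (fun (i : Fin r ⊕ Unit ⊕ Fin l) b =>
        Sum.elim (fun s => Sum.inl (Sum.inl (s, b))) (Sum.elim (fun _ => Sum.inl (Sum.inr b))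
          fun t : Fin l => Sum.inr (⟨(l + 1) * ν.length + t, by omega⟩, b)) i)
      (by
        refine ⟨x, ?_⟩
        rintro (s | _ | t)
        · exact h1 (Sum.inl s)
        · have h3 := h2 (Sum.inr 0)
          have h4 : (spread l (false :: (η ++ [true]))).take
              ((l + 1) * (η ++ [true]).length + (0 : Fin (l + 1)) + 1) =
                spread l (false :: η) ++ [true] := by
            rw [← List.cons_append, spread_append]
            have h5 : (l + 1) * (η ++ [true]).length + (0 : Fin (l + 1)) + 1 =
                (spread l (false :: η)).length + 1 := by
              rw [length_spread]; simp
            rw [h5, List.take_length_add_append]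
            simp [spread]
          simp only [a, Sum.elim_inr, h4] at h3
          exact h3
        · have h3 := h1 (Sum.inr t.castSucc)
          have h4 : (spread l (false :: ν)).take ((l + 1) * ν.length + (t.castSucc : ℕ) + 1) =
              ξ.take ((l + 1) * ν.length + t + 1) := by
            simp only [ξ, Fin.val_castSucc]
            rw [List.take_append_of_le_length]
            rw [length_spread, List.length_cons]
            omega
          simp only [a, Sum.elim_inr, h4] at h3
          exact h3)
    -- In array terms, the first index is the level at which the block of `η ++ [true]` leaves the
    -- branch, and the second is the start of the block of `ν`, of which only the first `l` nodes
    -- are used.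
    refine hinc ((l + 1) * (η.length + 1)) (by omega) ((l + 1) * ν.length) hlη (by omega)
      ⟨y, fun s => hy (Sum.inl s), hy (Sum.inr (Sum.inl ())), fun t ht => ?_⟩
    exact hy (Sum.inr (Sum.inr ⟨t, ht⟩))

end SOP

/-! ### Kim's lemma for Kim-dividing. -/

section KimLemma

variable {L : FirstOrder.Language.{u, v}} {U : Type w} [L.Structure U] {β : Type} {A : Set U}

theorem EquivOver.symm {γ : Type} {a a' : γ → U} (h : EquivOver (L := L) A a a') :
    EquivOver (L := L) A a' a := fun k φ d hd => (h k φ d hd).symm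

theorem EquivOver.trans {γ : Type} {a a' a'' : γ → U} (h : EquivOver (L := L) A a a')
    (h' : EquivOver (L := L) A a' a'') : EquivOver (L := L) A a a'' :=
  fun k φ d hd => (h k φ d hd).trans (h' k φ d hd)

theorem realizesOver_subseq {ρ : ℕ → (L.elementaryDiagram U).CompleteType β} {v : ℕ → β → U}
    (hv : ∀ i, RealizesOver (A ∪ ⋃ j < i, Set.range (v j)) (ρ i) (v i)) {τ : ℕ → ℕ} {K : ℕ}
    (hτ : ∀ i < K, ∀ j < i, τ j < τ i) :
    ∀ i < K, RealizesOver (A ∪ ⋃ j < i, Set.range (v (τ j))) (ρ (τ i)) (v (τ i)) := by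
  intro i hi
  refine (hv (τ i)).mono (Set.union_subset_union_right _ ?_)
  exact Set.iUnion₂_subset fun j hj => Set.subset_iUnion₂_of_subset (τ j) (hτ i hi j hj) subset_rfl

variable [Nonempty U]

theorem exists_solution_transfer {ρ : ℕ → (L.elementaryDiagram U).CompleteType β}
    (hρ : ∀ i, IsInvariant A (ρ i)) {b b' : ℕ → β → U} {k n : ℕ} (φ : L.Formula (Fin n ⊕ β))
    (hb : ∀ i < k, RealizesOver (A ∪ ⋃ j < i, Set.range (b j)) (ρ i) (b i))
    (hb' : ∀ i < k, RealizesOver (A ∪ ⋃ j < i, Set.range (b' j)) (ρ i) (b' i))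
    (h : ∃ x : Fin n → U, ∀ i < k, φ.Realize (Sum.elim x (b i))) :
    ∃ x : Fin n → U, ∀ i < k, φ.Realize (Sum.elim x (b' i)) := by
  obtain ⟨x, hx⟩ := (tpEq_of_realizesOver hρ k hb hb').exists_solution φ
    (fun (i : Fin k) s => (i, s)) (by
      obtain ⟨x, hx⟩ := h
      exact ⟨x, fun i => hx i i.2⟩)
  exact ⟨x, fun i hi => hx ⟨i, hi⟩⟩

/-- If some Morley sequence witnesses dividing, then all do. -/
theorem QDivides.not_consistent {q : (L.elementaryDiagram U).CompleteType β}
    (hq : IsInvariant A q) {n : ℕ} {φ : L.Formula (Fin n ⊕ β)} (h : QDivides A φ q)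
    {b : ℕ → β → U} (hb : IsMorley A q b) :
    ¬ Consistent fun i x => φ.Realize (Sum.elim x (b i)) := by
  obtain ⟨b', hb', hcon⟩ := h
  refine fun hc => hcon fun s => ?_
  obtain ⟨x, hx⟩ := exists_solution_transfer (ρ := fun _ => q) (fun _ => hq) (k := s.sup id + 1) φ
    (fun i _ => hb i) (fun i _ => hb' i) (by
      obtain ⟨x, hx⟩ := hc (Finset.range (s.sup id + 1))
      exact ⟨x, fun i hi => hx i (Finset.mem_range.2 hi)⟩)
  exact ⟨x, fun i hi => hx i (Nat.lt_succ_of_le (Finset.le_sup (f := id) hi))⟩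

/-- Kim's lemma for Kim-dividing in NSOP₁ theories: dividing along one invariant type implies
dividing along any other. -/
theorem QDivides.of_nsop1 {T : L.Theory} [U ⊨ T] (hT : NSOP1 T) {μ : Cardinal.{w}}
    (hU : IsSaturated L U μ) (hμ : ℵ₀ ≤ μ) (hA : #A < μ) [Finite β] {n : ℕ}
    {φ : L.Formula (Fin n ⊕ β)} {q r : (L.elementaryDiagram U).CompleteType β}
    (hq : IsInvariant A q) (hr : IsInvariant A r) {b : β → U} (hqb : RealizesOver A q b)
    (hrb : RealizesOver A r b) (h : QDivides A φ q) : QDivides A φ r := by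
  by_contra hndiv
  have hrcon : ∀ b : ℕ → β → U, IsMorley A r b →
      Consistent fun i x => φ.Realize (Sum.elim x (b i)) :=
    fun b hb => by_contra fun hc => hndiv ⟨b, hb, hc⟩
  -- `Con m l` will say that `φ` is consistent along `l` realizations of `r` followed by `m`
  -- realizations of `q`.
  let ρ : ℕ → ℕ → (L.elementaryDiagram U).CompleteType β := fun l i => if i < l then r else q
  have hρ : ∀ l i, IsInvariant A (ρ l i) := by
    intro l i
    by_cases hi : i < l <;> simp [ρ, hi, hq, hr]
  let Con : ℕ → ℕ → Prop := fun m l => ∀ b : ℕ → β → U,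
    (∀ i < l + m, RealizesOver (A ∪ ⋃ j < i, Set.range (b j)) (ρ l i) (b i)) →
      ∃ x : Fin n → U, ∀ i < l + m, φ.Realize (Sum.elim x (b i))
  have hCon0 : ∀ l, Con 0 l := by
    intro l b hb
    obtain ⟨b₀, hb₀⟩ := exists_realizesOver_seq hU hμ hA fun _ => r
    refine exists_solution_transfer (hρ l) φ (b := b₀) (fun i hi => ?_) hb ?_
    · have : ρ l i = r := if_pos (by omega)
      rw [this]
      exact hb₀ i
    · obtain ⟨x, hx⟩ := hrcon b₀ hb₀ (Finset.range (l + 0))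
      exact ⟨x, fun i hi => hx i (Finset.mem_range.2 hi)⟩
  -- `Con 0 l` holds for all `l` since `φ` does not divide along `r`, whereas `Con m 0` for all `m`
  -- would contradict dividing along `q`. So passing from some `m` to `m + 1` loses consistency for
  -- some `l`.
  obtain ⟨m, hm, l, hl⟩ : ∃ m, (∀ l, Con m l) ∧ ∃ l, ¬Con (m + 1) l := by
    by_contra! hcon
    have hall : ∀ m l, Con m l := fun m => by
      induction m with
      | zero => exact hCon0
      | succ m ih => exact hcon m ih
    obtain ⟨b₁, hb₁, hinc⟩ := h
    refine hinc fun s => ?_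
    obtain ⟨x, hx⟩ := hall (s.sup id + 1) 0 b₁ fun i _ => hb₁ i
    exact ⟨x, fun i hi => hx i (by
      have : i ≤ s.sup id := Finset.le_sup (f := id) hi
      omega)⟩
  simp only [Con, not_forall] at hl
  obtain ⟨b₂, hb₂, hinc⟩ := hl
  obtain ⟨v, hv⟩ := exists_realizesOver_seq hU hμ hA fun i => if i % 2 = 0 then r else q
  have hvr : ∀ i, (if (2 * i) % 2 = 0 then r else q) = r := fun i => if_pos (by omega)
  have hvq : ∀ i, (if (2 * i + 1) % 2 = 0 then r else q) = q := fun i => if_neg (by omega)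
  have hAv : ∀ i, EquivOver (L := L) A (v i) b := by
    intro i
    have h1 := (hv i).mono (C' := A) Set.subset_union_left
    by_cases hi : i % 2 = 0
    · rw [if_pos hi] at h1
      exact h1.equivOver hrb
    · rw [if_neg hi] at h1
      exact h1.equivOver hqb
  refine hT (sop1_of_arrays (U := U) hU hμ φ m l fun k => ?_)
  -- Neighbours `v (2 * i)` and `v (2 * i + 1)` are equivalent over `A` and, by invariance, remain
  -- so over all later terms. Reading the pairs backwards makes the later terms the previous ones.
  -- The tuple `z` collects `m` realizations of `q` that come after all `k` pairs.
  let c : ℕ → Bool → β → U := fun j b => v (2 * (k - 1 - j) + b.toNat)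
  let z : Fin m × β → U := fun p => v (2 * (m + k - 1 - p.1) + 1) p.2
  refine ⟨z, c, fun j hj => ?_, ?_, fun j hj i hji hik => ?_⟩
  · let s := 2 * (k - 1 - j) + 2
    have h1 := EquivOver.extend_seq (ρ := fun i => if (s + i) % 2 = 0 then r else q)
      (fun i => by by_cases hi : (s + i) % 2 = 0 <;> simp [hi, hq, hr])
      ((hAv (2 * (k - 1 - j))).trans (hAv (2 * (k - 1 - j) + 1)).symm)
      (b := fun i => v (s + i)) (b' := fun i => v (s + i)) (2 * (m + k))
      (fun i _ => (hv (s + i)).mono (by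
        rw [Set.union_assoc]
        refine Set.union_subset_union_right _ (Set.union_subset ?_ ?_)
        · exact Set.subset_iUnion₂_of_subset (2 * (k - 1 - j)) (by omega) subset_rfl
        · exact Set.iUnion₂_subset fun j' hj' =>
            Set.subset_iUnion₂_of_subset (s + j') (by omega) subset_rfl))
      (fun i _ => (hv (s + i)).mono (by
        rw [Set.union_assoc]
        refine Set.union_subset_union_right _ (Set.union_subset ?_ ?_)
        · exact Set.subset_iUnion₂_of_subset (2 * (k - 1 - j) + 1) (by omega) subset_rfl
        · exact Set.iUnion₂_subset fun j' hj' =>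
            Set.subset_iUnion₂_of_subset (s + j') (by omega) subset_rfl))
    have h2 := h1.tpEq.comp (Sum.elim (Sum.elim
      (fun p : Fin m × β => Sum.inr (⟨2 * (m + k - 1 - p.1) + 1 - s, by omega⟩, p.2))
      (fun p : Fin j × Bool × β => Sum.inr (⟨2 * (k - 1 - p.1) + p.2.1.toNat - s, by
        have := p.2.1.toNat_le
        omega⟩, p.2.2))) Sum.inl)
    have hz : ∀ p : Fin m, s + (2 * (m + k - 1 - p) + 1 - s) = 2 * (m + k - 1 - p) + 1 := by
      intro p
      omega
    have hc : ∀ (p : Fin j) (d : Bool),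
        s + (2 * (k - 1 - p) + d.toNat - s) = 2 * (k - 1 - p) + d.toNat := by
      intro p d
      omega
    convert h2 using 1 <;>
    · ext ((p | p) | p)
      · simp [z, hz]
      · simp [c, hc]
      · simp [c]
  -- The `k` even terms followed by `z` form a sequence of `k` realizations of `r` and then `m` of
  -- `q`.
  · obtain ⟨x, hx⟩ := hm k (fun i => v (if i < k then 2 * i else 2 * i + 1)) (by
      intro i hi
      have := realizesOver_subseq hv (τ := fun i => if i < k then 2 * i else 2 * i + 1)
        (K := k + m) (by intro i _ j _; split_ifs <;> omega) i hi
      have h3 : ρ k i =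
          if (if i < k then 2 * i else 2 * i + 1) % 2 = 0 then r else q := by
        by_cases hik : i < k
        · simp [ρ, hik]
        · simp only [ρ, hik, if_false]
          rw [hvq]
      rw [h3]
      exact this)
    refine ⟨x, fun s => ?_, fun j hj => ?_⟩
    · have := hx (m + k - 1 - s) (by omega)
      rw [if_neg (by omega)] at this
      exact this
    · have := hx (k - 1 - j) (by omega)
      rw [if_pos (by omega)] at this
      exact this
  · rintro ⟨x, hx1, hx2, hx3⟩
    -- In increasing order: the `l` even terms `c (i + t) false`, then `c j true`, then `z`. This is
    -- `l` realizations of `r` followed by `m + 1` of `q`, the pattern for which consistency fails.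
    let τ : ℕ → ℕ := fun s => if s < l then 2 * (k - i - l + s) else
      if s = l then 2 * (k - 1 - j) + 1 else 2 * (k + (s - l - 1)) + 1
    refine hinc (exists_solution_transfer (hρ l) φ (b := fun s => v (τ s)) (fun s hs => ?_) hb₂ ?_)
    · have := realizesOver_subseq hv (τ := τ) (K := l + (m + 1))
        (by intro i _ j _; dsimp only [τ]; split_ifs <;> omega) s hs
      have h3 : ρ l s = if τ s % 2 = 0 then r else q := by
        by_cases hsl : s < l
        · simp [ρ, τ, hsl]
        · simp only [ρ, τ, hsl, if_false]
          split_ifs with h4 h5 h5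
          · omega
          · rfl
          · omega
          · rfl
      rw [h3]
      exact this
    · refine ⟨x, fun s hs => ?_⟩
      by_cases hsl : s < l
      · have h4 := hx3 (l - 1 - s) (by omega)
        have h5 : τ s = 2 * (k - 1 - (i + (l - 1 - s))) + Bool.toNat false := by
          simp only [τ, hsl, if_true, Bool.toNat_false]
          omega
        rw [h5]
        exact h4
      · by_cases hsl' : s = l
        · have h5 : τ s = 2 * (k - 1 - j) + Bool.toNat true := by
            simp [τ, hsl']
          rw [h5]
          exact hx2
        · have h4 := hx1 ⟨m + l - s, by omega⟩
          have h5 : τ s = 2 * (m + k - 1 - (m + l - s)) + 1 := by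
            simp only [τ, hsl, hsl', if_false]
            omega
          rw [h5]
          exact h4

end KimLemma

/-! ### Coheirs and Kim-forking. -/

section Coheir

variable {L : FirstOrder.Language.{u, v}} {U : Type w} [L.Structure U] {β : Type} {A : Set U}

/-- The limit type of an ultrafilter concentrating on `A` is `A`-invariant. -/
theorem isInvariant_of_eventually {D : Ultrafilter (β → U)} (hD : ∀ᶠ b : β → U in D, ∀ i, b i ∈ A)
    {q : (L.elementaryDiagram U).CompleteType β}
    (hq : ∀ {γ : Type} (φ : L.Formula (β ⊕ γ)) (e : γ → U),
      Has q φ e ↔ ∀ᶠ b : β → U in D, φ.Realize (Sum.elim b e)) : IsInvariant A q := by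
  intro k φ e e' h
  rw [hq, hq]
  refine Filter.eventually_congr (hD.mono fun b hb => ?_)
  have := h.realize_iff (φ.relabel Sum.swap) hb
  simpa only [Formula.realize_relabel, sumElim_comp_swap] using this

/-- A coheir extends to a coheir in more variables. -/
theorem exists_ultrafilter_extension (M : L.ElementarySubstructure U) {δ : Type} [Finite δ]
    {b : β → U} (d : δ → U) {D : Ultrafilter (β → U)} (hDM : ∀ᶠ b' : β → U in D, ∀ i, b' i ∈ M)
    (hD : ∀ (k : ℕ) (χ : L.Formula (β ⊕ Fin k)) (a : Fin k → U), (∀ i, a i ∈ M) →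
      χ.Realize (Sum.elim b a) → ∀ᶠ b' : β → U in D, χ.Realize (Sum.elim b' a)) :
    ∃ D' : Ultrafilter (β ⊕ δ → U), (∀ᶠ w : β ⊕ δ → U in D', ∀ i, w i ∈ M) ∧
      (∀ Y ∈ D, ∀ᶠ w : β ⊕ δ → U in D', w ∘ Sum.inl ∈ Y) ∧
      ∀ {γ : Type} (χ : L.Formula ((β ⊕ δ) ⊕ γ)) (a : γ → U), (∀ i, a i ∈ M) →
        χ.Realize (Sum.elim (Sum.elim b d) a) → ∀ᶠ w : β ⊕ δ → U in D', χ.Realize (Sum.elim w a) := by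
  classical
  let S : Set (Set (β ⊕ δ → U)) :=
    {s | (∃ Y ∈ D, s = {w | w ∘ Sum.inl ∈ Y}) ∨
      ∃ (γ : Type) (χ : L.Formula ((β ⊕ δ) ⊕ γ)) (a : γ → U), (∀ i, a i ∈ M) ∧
        χ.Realize (Sum.elim (Sum.elim b d) a) ∧
          s = {w | (∀ i, w i ∈ M) ∧ χ.Realize (Sum.elim w a)}}
  have hS : ∀ t : Finset (Set (β ⊕ δ → U)), (t : Set (Set (β ⊕ δ → U))) ⊆ S →
      ∃ Y ∈ D, ∃ (γ : Type) (χ : L.Formula ((β ⊕ δ) ⊕ γ)) (a : γ → U), (∀ i, a i ∈ M) ∧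
        χ.Realize (Sum.elim (Sum.elim b d) a) ∧
        ∀ w : β ⊕ δ → U, w ∘ Sum.inl ∈ Y → (∀ i, w i ∈ M) → χ.Realize (Sum.elim w a) →
          w ∈ ⋂₀ (t : Set (Set (β ⊕ δ → U))) := by
    intro t
    induction t using Finset.induction_on with
    | empty =>
      exact fun _ => ⟨Set.univ, Filter.univ_mem, Empty, ⊤, Empty.elim, fun i => i.elim, by simp,
        by simp⟩
    | insert s t _ ih =>
      intro hst
      rw [Finset.coe_insert, Set.insert_subset_iff] at hst
      obtain ⟨Y, hY, γ, χ, a, ha, hχ, h⟩ := ih hst.2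
      rcases hst.1 with ⟨Y', hY', rfl⟩ | ⟨γ', χ', a', ha', hχ', rfl⟩
      · refine ⟨Y ∩ Y', Filter.inter_mem hY hY', γ, χ, a, ha, hχ, fun w h1 h2 h3 => ?_⟩
        rw [Finset.coe_insert, Set.sInter_insert]
        exact ⟨h1.2, h w h1.1 h2 h3⟩
      · refine ⟨Y, hY, γ ⊕ γ', χ.relabel (Sum.map id Sum.inl) ⊓ χ'.relabel (Sum.map id Sum.inr),
          Sum.elim a a', Sum.rec ha ha', ?_, fun w h1 h2 h3 => ?_⟩
        · rw [Formula.realize_inf, Formula.realize_relabel, Formula.realize_relabel,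
            Sum.elim_comp_map, Sum.elim_comp_map]
          exact ⟨hχ, hχ'⟩
        · rw [Formula.realize_inf, Formula.realize_relabel, Formula.realize_relabel,
            Sum.elim_comp_map, Sum.elim_comp_map] at h3
          rw [Finset.coe_insert, Set.sInter_insert]
          exact ⟨⟨h2, h3.2⟩, h w h1 h2 h3.1⟩
  have hD' : ∀ {γ : Type} (χ : L.Formula (β ⊕ γ)) (a : γ → U), (∀ i, a i ∈ M) →
      χ.Realize (Sum.elim b a) → ∀ᶠ b' : β → U in D, χ.Realize (Sum.elim b' a) := by
    intro γ χ a ha hχ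
    rw [← realize_supportFormula] at hχ
    refine (hD _ _ _ (fun i => ha _) hχ).mono fun b' hb' => ?_
    exact (realize_supportFormula χ b' a).1 hb'
  obtain ⟨D', hD'S⟩ := Ultrafilter.exists_ultrafilter_of_finite_inter_nonempty S (by
    intro t ht
    obtain ⟨Y, hY, γ, χ, a, ha, hχ, h⟩ := hS t ht
    -- Quantifying out the new variables gives a formula true of `b`, hence of `D`-almost all `b'`.
    -- For such `b'` in `M`, elementarity supplies the new coordinates in `M`.
    let θ : L.Formula (β ⊕ γ) := (χ.relabel (Sum.elim (Sum.elim (Sum.inl ∘ Sum.inl) Sum.inr)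
      (Sum.inl ∘ Sum.inr)) : L.Formula ((β ⊕ γ) ⊕ δ)).iExs δ
    have hrel : ∀ {K : Type w} [L.Structure K] (b' : β → K) (d' : δ → K) (a' : γ → K),
        (χ.relabel (Sum.elim (Sum.elim (Sum.inl ∘ Sum.inl) Sum.inr) (Sum.inl ∘ Sum.inr)) :
          L.Formula ((β ⊕ γ) ⊕ δ)).Realize (Sum.elim (Sum.elim b' a') d') ↔
            χ.Realize (Sum.elim (Sum.elim b' d') a') := by
      intro K _ b' d' a'
      rw [Formula.realize_relabel]
      simp only [Sum.comp_elim, ← Function.comp_assoc, Sum.elim_comp_inr, Sum.elim_comp_inl]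
    have hθ : θ.Realize (Sum.elim b a) := by
      rw [Formula.realize_iExs]
      exact ⟨d, (hrel _ _ _).2 hχ⟩
    obtain ⟨b', hb'1, hb'2, hb'3⟩ := ((hD' θ a ha hθ).and (hDM.and hY)).exists
    let b₀ : β → M := fun i => ⟨b' i, hb'2 i⟩
    let a₀ : γ → M := fun i => ⟨a i, ha i⟩
    have h1 : θ.Realize (Sum.elim b₀ a₀) := by
      rw [← M.subtype.map_formula]
      convert hb'1
      ext (i | i) <;> rfl
    rw [Formula.realize_iExs] at h1
    obtain ⟨d', hd'⟩ := h1
    rw [hrel, ← M.subtype.map_formula] at hd'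
    refine ⟨Sum.elim b' fun i => (d' i : U), h _ hb'3 ?_ ?_⟩
    · rintro (i | i)
      · exact hb'2 i
      · exact (d' i).2
    · convert hd'
      ext ((i | i) | i) <;> rfl)
  refine ⟨D', ?_, fun Y hY => hD'S (Or.inl ⟨Y, hY, rfl⟩), fun χ a ha hχ => ?_⟩
  · exact Filter.mem_of_superset
      (hD'S (Or.inr ⟨Empty, ⊤, Empty.elim, fun i => i.elim, by simp, rfl⟩)) fun w hw => hw.1
  · exact Filter.mem_of_superset (hD'S (Or.inr ⟨_, χ, a, ha, hχ, rfl⟩)) fun w hw => hw.2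

variable [Nonempty U]

theorem realizesOver_of_eventually {D : Ultrafilter (β → U)} {b : β → U}
    (hD : ∀ (k : ℕ) (χ : L.Formula (β ⊕ Fin k)) (a : Fin k → U), (∀ i, a i ∈ A) →
      χ.Realize (Sum.elim b a) → ∀ᶠ b' : β → U in D, χ.Realize (Sum.elim b' a))
    {q : (L.elementaryDiagram U).CompleteType β}
    (hq : ∀ {γ : Type} (φ : L.Formula (β ⊕ γ)) (e : γ → U),
      Has q φ e ↔ ∀ᶠ b : β → U in D, φ.Realize (Sum.elim b e)) : RealizesOver A q b := by
  intro k φ e he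
  refine ⟨fun h => ?_, fun h => (hq _ _).2 (hD k φ e he h)⟩
  by_contra hn
  exact (has_not φ e).1 ((hq _ _).2 (hD k φ.not e he hn)) h

/-- A property of an initial segment of a Morley sequence in the limit type of an ultrafilter
is reflected by elements of any set in the ultrafilter. -/
theorem exists_reflection {D : Ultrafilter (β → U)} (hD : ∀ᶠ b : β → U in D, ∀ i, b i ∈ A)
    {q : (L.elementaryDiagram U).CompleteType β}
    (hq : ∀ {γ : Type} (φ : L.Formula (β ⊕ γ)) (e : γ → U),
      Has q φ e ↔ ∀ᶠ b : β → U in D, φ.Realize (Sum.elim b e))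
    {b : ℕ → β → U} (hb : IsMorley A q b) {Y : Set (β → U)} (hY : Y ∈ D) {N : ℕ}
    (χ : L.Formula (Fin N × β)) (hχ : χ.Realize fun p => b p.1 p.2) :
    ∃ b' : ℕ → β → U, (∀ i < N, b' i ∈ Y) ∧ χ.Realize fun p => b' p.1 p.2 := by
  -- Terms are replaced from the last to the first. When term `m` is reached, the other parameters
  -- are `b i` for `i < m` and tuples already moved into `A`; `b m` realizes `q` over these, so
  -- `D`-almost every tuple can take its place.
  have key : ∀ j ≤ N, ∃ b' : ℕ → β → U, (∀ i < N, N - j ≤ i → b' i ∈ Y ∧ ∀ s, b' i s ∈ A) ∧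
      χ.Realize fun p => if (p.1 : ℕ) < N - j then b p.1 p.2 else b' p.1 p.2 := by
    intro j
    induction j with
    | zero =>
      refine fun _ => ⟨b, fun i hi hi' => by omega, ?_⟩
      simpa using hχ
    | succ j ih =>
      intro hj
      obtain ⟨b', hb', hb''⟩ := ih (by omega)
      let m := N - (j + 1)
      have hm : N - j = m + 1 := by omega
      rw [hm] at hb' hb''
      let f : Fin N × β → β ⊕ {p : Fin N × β // (p.1 : ℕ) ≠ m} := fun p =>
        if h : (p.1 : ℕ) = m then Sum.inl p.2 else Sum.inr ⟨p, h⟩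
      let e : {p : Fin N × β // (p.1 : ℕ) ≠ m} → U := fun p =>
        if (p.1.1 : ℕ) < m then b p.1.1 p.1.2 else b' p.1.1 p.1.2
      have hf : ∀ y : β → U, Sum.elim y e ∘ f = fun p =>
          if (p.1 : ℕ) < m then b p.1 p.2 else if (p.1 : ℕ) = m then y p.2 else b' p.1 p.2 := by
        intro y
        ext p
        by_cases h : (p.1 : ℕ) = m
        · simp [f, h]
        · simp [f, e, h]
      have h1 : Has q (χ.relabel f) e := by
        refine ((hb m).has_iff _ ?_).2 ?_
        · rintro ⟨p, hp⟩
          by_cases h : (p.1 : ℕ) < m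
          · simp only [e, h, if_true]
            exact Or.inr (Set.mem_iUnion₂.2 ⟨p.1, h, p.2, rfl⟩)
          · simp only [e, h, if_false]
            exact Or.inl ((hb' p.1 p.1.2 (by omega)).2 p.2)
        · rw [Formula.realize_relabel, hf]
          convert hb'' using 2 with p
          by_cases h : (p.1 : ℕ) < m
          · simp [h, Nat.lt_succ_of_lt h]
          · by_cases h' : (p.1 : ℕ) = m
            · simp [h']
            · have : ¬ (p.1 : ℕ) < m + 1 := by omega
              simp [h, h', this]
      rw [hq] at h1
      obtain ⟨y, hy1, hy2, hy3⟩ := (h1.and (hD.and hY)).exists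
      refine ⟨fun i => if i = m then y else b' i, fun i hi hi' => ?_, ?_⟩
      · by_cases h : i = m
        · simp only [h, if_true]
          exact ⟨hy3, hy2⟩
        · simp only [h, if_false]
          exact hb' i hi (by omega)
      · rw [Formula.realize_relabel, hf] at hy1
        convert hy1 using 2 with p
        by_cases h : (p.1 : ℕ) = m <;> simp [h, m]
  obtain ⟨b', hb', hχ'⟩ := key N le_rfl
  refine ⟨b', fun i hi => (hb' i hi (by omega)).1, ?_⟩
  simpa using hχ'

/-- In an NSOP₁ theory, if `φ(x; b)` Kim-forks over `M`, then no coheir of `tp(b/M)` concentrates on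
a set of parameters where the instances of `φ` are consistent. -/
theorem KimForks.not_consistent {T : L.Theory} [U ⊨ T] (hT : NSOP1 T) {μ : Cardinal.{w}}
    (hU : IsSaturated L U μ) (hμ : ℵ₀ < μ) {M : L.ElementarySubstructure U} (hM : #M < μ)
    [Finite β] {n : ℕ} {φ : L.Formula (Fin n ⊕ β)} {b : β → U} (h : KimForks (M : Set U) φ b)
    {D : Ultrafilter (β → U)} (hDM : ∀ᶠ b' : β → U in D, ∀ i, b' i ∈ M)
    (hD : ∀ (k : ℕ) (χ : L.Formula (β ⊕ Fin k)) (a : Fin k → U), (∀ i, a i ∈ M) →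
      χ.Realize (Sum.elim b a) → ∀ᶠ b' : β → U in D, χ.Realize (Sum.elim b' a))
    {X : Set (β → U)} (hX : X ∈ D) :
    ¬ Consistent fun (b' : X) x => φ.Realize (Sum.elim x b'.1) := by
  classical
  intro hcon
  obtain ⟨k, m, ψ, c, himp, hdiv⟩ := h
  -- Passing to a coheir of the joint type of `b` and all the `c i` makes the implication from `φ`
  -- to the disjunction travel along a Morley sequence.
  obtain ⟨D', hD'M, hD'X, hD'⟩ := exists_ultrafilter_extension M
    (fun p : Σ i, Fin (m i) => c p.1 p.2) hDM hD
  obtain ⟨q, hq⟩ := exists_has_iff_eventually (L := L) D'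
  obtain ⟨y, hy⟩ := exists_realizesOver_seq hU hμ.le (A := (M : Set U)) hM fun _ => q
  let proj : ∀ l, (β ⊕ (Σ i, Fin (m i)) → U) → Fin (m l) → U := fun l w t => w (Sum.inr ⟨l, t⟩)
  -- Each projection of `D'` is a coheir of `tp(c l/M)`. As `ψ l` divides along some invariant
  -- extension of this type, Kim's lemma makes it divide along this one.
  have hql : ∀ l, ∃ ql : (L.elementaryDiagram U).CompleteType (Fin (m l)),
      IsInvariant (M : Set U) ql ∧ QDivides (M : Set U) (ψ l) ql ∧
        ∀ (C : Set U) w, RealizesOver C q w → RealizesOver C ql (proj l w) := by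
    intro l
    obtain ⟨ql, hql⟩ := exists_has_iff_eventually (L := L) (D'.map (proj l))
    have hinv : IsInvariant (M : Set U) ql :=
      isInvariant_of_eventually (D := D'.map (proj l)) (hD'M.mono fun w hw t => hw _) hql
    have hrel : ∀ {γ : Type} (χ : L.Formula (Fin (m l) ⊕ γ)) (w : β ⊕ (Σ i, Fin (m i)) → U)
        (e : γ → U), (χ.relabel (Sum.map (fun t => Sum.inr ⟨l, t⟩) id) :
          L.Formula ((β ⊕ (Σ i, Fin (m i))) ⊕ γ)).Realize (Sum.elim w e) ↔
            χ.Realize (Sum.elim (proj l w) e) := by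
      intro γ χ w e
      rw [Formula.realize_relabel, Sum.elim_comp_map]
      rfl
    have hreal : RealizesOver (M : Set U) ql (c l) := by
      refine realizesOver_of_eventually (D := D'.map (proj l)) (fun k χ a ha hχ => ?_) hql
      refine (hD' (χ.relabel (Sum.map (fun t => Sum.inr ⟨l, t⟩) id)) a ha ?_).mono fun w hw => ?_
      · rw [hrel]
        exact hχ
      · exact (hrel _ _ _).1 hw
    refine ⟨ql, hinv, ?_, fun C w hw j χ e he => ?_⟩
    · obtain ⟨q₀, hq₀, hq₀c, hq₀d⟩ := hdiv l
      exact hq₀d.of_nsop1 hT hU hμ.le hM hq₀ hinv hq₀c hreal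
    · rw [hql, ← hrel, ← hw j _ e he, hq]
      exact Filter.eventually_congr (Filter.Eventually.of_forall fun w => (hrel χ w e).symm)
  -- A finite inconsistency along the Morley sequence would be reflected by tuples whose `β`-part
  -- lies in `X`.
  have hycon : ∀ s : Finset ℕ, ∃ x : Fin n → U, ∀ j ∈ s,
      φ.Realize (Sum.elim x (y j ∘ Sum.inl)) := by
    intro s
    by_contra hn
    let f : s → β → Fin (s.sup id + 1) × (β ⊕ Σ i, Fin (m i)) := fun j t =>
      (⟨j, Nat.lt_succ_of_le (Finset.le_sup (f := id) j.2)⟩, Sum.inl t)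
    obtain ⟨y', hy'1, hy'2⟩ := exists_reflection hD'M hq hy (hD'X X hX)
      (commonSolution φ f).not (by
        rw [Formula.realize_not, realize_commonSolution]
        rintro ⟨x, hx⟩
        exact hn ⟨x, fun j hj => hx ⟨j, hj⟩⟩)
    rw [Formula.realize_not, realize_commonSolution] at hy'2
    obtain ⟨x, hx⟩ := hcon (s.attach.image fun j : s => ⟨y' j ∘ Sum.inl,
      hy'1 j (Nat.lt_succ_of_le (Finset.le_sup (f := id) j.2))⟩)
    exact hy'2 ⟨x, fun j => hx _ (Finset.mem_image.2 ⟨j, Finset.mem_attach _ _, rfl⟩)⟩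
  obtain ⟨x, hx⟩ := hU.exists_realize (β := Fin n) (A := ⋃ j, Set.range (y j ∘ Sum.inl))
    (lt_of_le_of_lt (Cardinal.mk_le_aleph0_iff.2 (Set.countable_iUnion fun j =>
      (Set.finite_range _).countable).to_subtype) hμ)
    (fun _ : ℕ => φ) (fun j => y j ∘ Sum.inl) (fun j t => Set.mem_iUnion.2 ⟨j, t, rfl⟩) hycon
  have hl : ∀ j, ∃ l, (ψ l).Realize (Sum.elim x (proj l (y j))) := by
    intro j
    let θ : L.Formula ((β ⊕ Σ i, Fin (m i)) ⊕ Fin 0) := ((((φ.relabel (Sum.map id Sum.inl)).imp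
      (Formula.iSup fun l => (ψ l).relabel (Sum.map id fun t => Sum.inr ⟨l, t⟩)) :
        L.Formula (Fin n ⊕ (β ⊕ Σ i, Fin (m i)))).relabel Sum.swap).iAlls (Fin n)).relabel Sum.inl
    have hθ : ∀ (w : β ⊕ (Σ i, Fin (m i)) → U) (e : Fin 0 → U), θ.Realize (Sum.elim w e) ↔
        ∀ x : Fin n → U, φ.Realize (Sum.elim x (w ∘ Sum.inl)) →
          ∃ l, (ψ l).Realize (Sum.elim x (proj l w)) := by
      intro w e
      simp only [θ, Formula.realize_relabel, Formula.realize_iAlls, Sum.elim_comp_inl]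
      refine forall_congr' fun x => ?_
      have : (fun a => Sum.elim w x a) ∘ Sum.swap = Sum.elim x w := sumElim_comp_swap w x
      rw [this, Formula.realize_imp, Formula.realize_relabel, Sum.elim_comp_map,
        Formula.realize_iSup]
      refine imp_congr Iff.rfl (exists_congr fun l => ?_)
      rw [Formula.realize_relabel, Sum.elim_comp_map]
      rfl
    have h1 : θ.Realize (Sum.elim (y j) Fin.elim0) := by
      rw [← (hy j).has_iff θ (e := Fin.elim0) (fun i => i.elim0), hq]
      exact hD' θ Fin.elim0 (fun i => i.elim0) ((hθ _ _).2 himp)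
    exact (hθ _ _).1 h1 x (hx j)
  choose l hl using hl
  -- One disjunct holds at `x` for infinitely many terms. The corresponding subsequence is again
  -- Morley, so the disjunct cannot divide along it.
  obtain ⟨l₀, hl₀⟩ := Finite.exists_infinite_fiber l
  let τ := Nat.orderEmbeddingOfSet (l ⁻¹' {l₀})
  have hτ : ∀ i, l (τ i) = l₀ := fun i => (Nat.Subtype.ofNat (l ⁻¹' {l₀}) i).2
  obtain ⟨ql, hinv, hqdiv, hproj⟩ := hql l₀
  refine hqdiv.not_consistent hinv (b := fun i => proj l₀ (y (τ i))) (fun i => ?_) fun s => ?_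
  · refine hproj _ _ ((hy (τ i)).mono ?_)
    refine Set.union_subset_union_right _ (Set.iUnion₂_subset fun j hj => ?_)
    refine Set.subset_iUnion₂_of_subset (τ j) (τ.strictMono hj) ?_
    rintro _ ⟨t, rfl⟩
    exact ⟨_, rfl⟩
  · refine ⟨x, fun i _ => ?_⟩
    have := hl (τ i)
    rwa [hτ i] at this

end Coheir

/-! ### A pressing-down argument. -/

section Reflection

/-- A weak form of the pressing down lemma: if `G j` is an increasing continuous family of sets of
size less than the regular cardinal `κ`, then at some limit `δ < κ` every condition in `G δ` that
holds at `δ` holds already before `δ`. -/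
theorem exists_reflecting_ordinal {κ : Cardinal.{w}} (hκ : κ.IsRegular) (hκ' : ℵ₀ < κ)
    {X : Type w} (G : Ordinal.{w} → Set X) (hmono : ∀ i j, i ≤ j → j < κ.ord → G i ⊆ G j)
    (hcard : ∀ i < κ.ord, #(G i) < κ)
    (hcont : ∀ i < κ.ord, Order.IsSuccLimit i → ∀ x ∈ G i, ∃ j < i, x ∈ G j)
    (P : X → Ordinal.{w} → Prop) :
    ∃ δ < κ.ord, Order.IsSuccLimit δ ∧ ∀ x ∈ G δ, P x δ → ∃ j < δ, P x j := by
  classical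
  have hcof : κ.ord.cof = κ := hκ.cof_ord
  -- Just past the first stage at which `P x` holds; the value is irrelevant when there is no such
  -- stage below `κ`.
  let F : X → Ordinal.{w} := fun x =>
    if sInf {i | P x i} < κ.ord then Order.succ (sInf {i | P x i}) else 0
  have hlim : Order.IsSuccLimit κ.ord := isSuccLimit_ord hκ'.le
  have hF : ∀ x, F x < κ.ord := by
    intro x
    by_cases h : sInf {i | P x i} < κ.ord
    · simp only [F, h, if_true]
      exact hlim.succ_lt h
    · simp only [F, h, if_false]
      exact hlim.bot_lt
  -- Regularity keeps `h` below `κ`. The supremum `δ` of its iterates lies past the first occurrence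
  -- of each condition in `G j`, `j < δ`, that occurs below `κ`; the term `Order.succ j` makes `δ` a
  -- limit.
  let h : Ordinal.{w} → Ordinal.{w} := fun j => max (Order.succ j) (⨆ x : G j, F x)
  have hh : ∀ j < κ.ord, h j < κ.ord := by
    intro j hj
    refine max_lt (hlim.succ_lt hj) (Ordinal.iSup_lt_of_lt_cof ?_ fun x => hF x)
    rw [hcof]
    exact hcard j hj
  let δ := Ordinal.nfp h 0
  have hδ : δ < κ.ord := Ordinal.nfp_lt_ord (by rwa [hcof]) hh hlim.bot_lt
  have hstep : ∀ j < δ, ∃ i < δ, j < i ∧ h i ≤ δ := by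
    intro j hj
    obtain ⟨n, hn⟩ := Ordinal.lt_nfp_iff.1 hj
    have h1 : h (h^[n] 0) ≤ δ := by
      have := Ordinal.iterate_le_nfp h 0 (n + 1)
      rwa [Function.iterate_succ_apply'] at this
    exact ⟨h^[n] 0, (Order.lt_succ _).trans_le ((le_max_left _ _).trans h1), hn, h1⟩
  have hδ0 : (0 : Ordinal) < δ := by
    have h1 : h 0 ≤ δ := Ordinal.iterate_le_nfp h 0 1
    exact (Order.lt_succ _).trans_le ((le_max_left _ _).trans h1)
  have hδlim : Order.IsSuccLimit δ := by
    rw [Ordinal.isSuccLimit_iff]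
    refine ⟨hδ0.ne', Order.isSuccPrelimit_of_succ_lt fun j hj => ?_⟩
    obtain ⟨i, hi, hji, -⟩ := hstep j hj
    exact (Order.succ_le_of_lt hji).trans_lt hi
  refine ⟨δ, hδ, hδlim, fun x hx hP => ?_⟩
  obtain ⟨j, hj, hxj⟩ := hcont δ hδ hδlim x hx
  obtain ⟨i, hi, hji, hiδ⟩ := hstep j hj
  have hxi : x ∈ G i := hmono j i hji.le (hi.trans hδ) hxj
  have hmem : P x (sInf {i | P x i}) := csInf_mem (s := {i | P x i}) ⟨δ, hP⟩
  have hle : sInf {i | P x i} < κ.ord := (csInf_le' hP).trans_lt hδ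
  have h1 : F x ≤ h i := (Ordinal.le_iSup (fun x : G i => F x) ⟨x, hxi⟩).trans (le_max_right _ _)
  simp only [F, hle, if_true] at h1
  exact ⟨_, (Order.lt_succ _).trans_le (h1.trans hiδ), hmem⟩

end Reflection

/-! ### No long Kim-forking chains in NSOP₁ theories. -/

section Chain

variable {L : FirstOrder.Language.{u, v}}

theorem mk_formula_le (α : Type) [Countable α] : #(L.Formula α) ≤ max ℵ₀ L.card := by
  have h1 : #(L.Formula α) ≤ #(Σ n, L.BoundedFormula α n) :=
    Cardinal.mk_le_of_injective (f := fun φ : L.Formula α => (⟨0, φ⟩ : Σ n, L.BoundedFormula α n))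
      fun φ ψ h => eq_of_heq (Sigma.mk.inj h).2
  refine h1.trans (BoundedFormula.card_le.trans (max_le (le_max_left _ _) ?_))
  refine Cardinal.add_le_of_le (le_max_left _ _) ?_ ?_
  · refine le_trans ?_ (le_max_left _ _)
    rw [Cardinal.lift_le_aleph0]
    exact Cardinal.mk_le_aleph0
  · rw [Cardinal.lift_uzero]
    exact le_max_right _ _

theorem mk_sigma_nat_le {F : ℕ → Type w} {c : Cardinal.{w}} (hc : ℵ₀ ≤ c) (h : ∀ n, #(F n) ≤ c) :
    #(Σ n, F n) ≤ c := by
  rw [Cardinal.mk_sigma]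
  refine (Cardinal.sum_le_sum _ _ h).trans ?_
  rw [Cardinal.sum_const, Cardinal.mk_nat, Cardinal.lift_aleph0, Cardinal.lift_uzero]
  exact (Cardinal.mul_eq_max le_rfl hc).le.trans (max_le hc le_rfl)

/-- In an NSOP₁ theory there is no consistent Kim-forking chain of length `|T|⁺`. -/
theorem not_hasKimForkingChain {T : L.Theory} (hT : NSOP1 T) {U : Type (max u v w)}
    [L.Structure U] [Nonempty U] [U ⊨ T]
    (hU : IsSaturated L U (Order.succ (Order.succ (Cardinal.lift.{w} (theoryCard T))))) :
    ¬ HasKimForkingChain L U (Order.succ (Cardinal.lift.{w} (theoryCard T))) := by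
  classical
  rintro ⟨n, N, m, k, φ, c, d, hN, hlim, hcard, hd, hc, hfork, hcon⟩
  let ν : Cardinal.{max u v w} := Cardinal.lift.{w} (theoryCard T)
  have hν : ℵ₀ ≤ ν := by
    simp only [ν, Cardinal.aleph0_le_lift, theoryCard]
    exact le_max_left _ _
  let κ := Order.succ ν
  have hκ : κ.IsRegular := Cardinal.isRegular_succ hν
  have hκ' : ℵ₀ < κ := hν.trans_lt (Order.lt_succ _)
  -- A condition consists of arities, a formula `φ`, and a formula `χ` with parameters. It holds at
  -- stage `j` if the `j`-th formula of the chain is `φ` and its parameter tuple satisfies `χ`.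
  let X : Type (max u v w) := Σ p : ℕ × ℕ, L.Formula (Fin n ⊕ (Fin p.1 ⊕ Fin p.2)) ×
    Σ t : ℕ, L.Formula ((Fin p.1 ⊕ Fin p.2) ⊕ Fin t) × (Fin t → U)
  let tup : Ordinal.{max u v w} → Σ p : ℕ × ℕ, L.Formula (Fin n ⊕ (Fin p.1 ⊕ Fin p.2)) ×
      (Fin p.1 ⊕ Fin p.2 → U) := fun i => ⟨(m i, k i), φ i, Sum.elim (c i) (d i)⟩
  let G : Ordinal.{max u v w} → Set X := fun i => {x | ∀ s, x.2.2.2.2 s ∈ N i}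
  let P : X → Ordinal.{max u v w} → Prop := fun x j =>
    ∃ b, tup j = ⟨x.1, x.2.1, b⟩ ∧ x.2.2.2.1.Realize (Sum.elim b x.2.2.2.2)
  obtain ⟨δ, hδ, hδlim, hrefl⟩ := exists_reflecting_ordinal hκ hκ' G
    (fun i j hij hj x hx s => hN i j hij hj (hx s)) (fun i hi => by
      rw [Order.lt_succ_iff]
      let Y : Type (max u v w) := Σ q : ℕ, Σ p : ℕ, Σ t : ℕ,
        (L.Formula (Fin n ⊕ (Fin q ⊕ Fin p)) ×
          (L.Formula ((Fin q ⊕ Fin p) ⊕ Fin t) × (Fin t → N i)))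
      have hY : #Y ≤ ν := by
        refine mk_sigma_nat_le hν fun q => mk_sigma_nat_le hν fun p => mk_sigma_nat_le hν
          fun t => ?_
        have hform : ∀ (α : Type) [Countable α], Cardinal.lift.{w} #(L.Formula α) ≤ ν :=
          fun α _ => Cardinal.lift_le.2 (mk_formula_le α)
        have hpow : #(Fin t → N i) ≤ ν := by
          rw [Cardinal.mk_arrow, Cardinal.mk_fin, Cardinal.lift_natCast, Cardinal.lift_id',
            Cardinal.power_natCast]
          exact (pow_le_pow_left' (Order.lt_succ_iff.1 (hcard i hi)) t).trans
            (Cardinal.power_nat_le hν)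
        have h2 : ∀ {a b : Cardinal.{max u v w}}, a ≤ ν → b ≤ ν → a * b ≤ ν := fun ha hb =>
          (mul_le_mul' ha hb).trans (Cardinal.mul_eq_self hν).le
        rw [Cardinal.mk_prod, Cardinal.mk_prod, Cardinal.lift_id'.{max u v, max u v w},
          Cardinal.lift_id'.{max u v, max u v w}]
        rw [Cardinal.lift_umax.{max u v, w}]
        exact h2 (hform _) (h2 (hform _) hpow)
      refine le_trans (Cardinal.mk_le_of_surjective (f := fun y : Y =>
        (⟨⟨(y.1, y.2.1), y.2.2.2.1, y.2.2.1, y.2.2.2.2.1, fun s => y.2.2.2.2.2 s⟩,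
          fun s => (y.2.2.2.2.2 s).2⟩ : G i)) ?_) hY
      rintro ⟨⟨⟨p, q⟩, f, t, χ, a⟩, ha⟩
      exact ⟨⟨p, q, t, f, χ, fun s => ⟨a s, ha s⟩⟩, rfl⟩)
    (fun i hi hilim x hx => by
      have hx' : ∀ s, ∃ j < i, x.2.2.2.2 s ∈ N j := fun s => by
        have h1 : x.2.2.2.2 s ∈ (N i : Set U) := hx s
        rw [hlim i hi hilim] at h1
        simpa using h1
      choose f hf hf' using hx'
      have hi0 : (0 : Ordinal) < i := hilim.bot_lt
      let j := Finset.univ.sup f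
      have hj : j < i := by
        rw [Finset.sup_lt_iff hi0]
        exact fun s _ => hf s
      exact ⟨j, hj, fun s => hN _ _ (Finset.le_sup (Finset.mem_univ s)) (hj.trans hi) (hf' s)⟩)
    P
  let b : Fin (m δ) ⊕ Fin (k δ) → U := Sum.elim (c δ) (d δ)
  -- The tuples from earlier stages that carry the same formula as stage `δ`; they lie in `N δ`
  -- because `δ` is a limit.
  let Z : Set (Fin (m δ) ⊕ Fin (k δ) → U) :=
    {b' | ∃ j < δ, tup j = ⟨(m δ, k δ), φ δ, b'⟩}
  have hZN : ∀ b' ∈ Z, ∀ t, b' t ∈ N δ := by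
    rintro b' ⟨j, hj, hb'⟩
    have hj' : Order.succ j < δ := hδlim.succ_lt hj
    have key : ∀ t, (tup j).2.2 t ∈ N δ := by
      rintro (t | t)
      · exact hN _ _ hj'.le hδ (by
          have := hc j (hj.trans hδ) t
          rwa [← Order.succ_eq_add_one] at this)
      · exact hN _ _ hj.le hδ (hd j (hj.trans hδ) t)
    rw [hb'] at key
    exact key
  -- Reflection at `δ` says that the type of `b` over `N δ` is finitely satisfiable in `Z`, which
  -- yields a coheir concentrating on `Z`.
  obtain ⟨D, hD⟩ := Ultrafilter.exists_ultrafilter_of_finite_inter_nonempty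
    {s : Set (Fin (m δ) ⊕ Fin (k δ) → U) | s = Z ∨
      ∃ (t : ℕ) (χ : L.Formula ((Fin (m δ) ⊕ Fin (k δ)) ⊕ Fin t)) (a : Fin t → U),
        (∀ i, a i ∈ N δ) ∧ χ.Realize (Sum.elim b a) ∧ s = {b' | χ.Realize (Sum.elim b' a)}} (by
    intro S hS
    have h1 : ∃ (t : ℕ) (χ : L.Formula ((Fin (m δ) ⊕ Fin (k δ)) ⊕ Fin t)) (a : Fin t → U),
        (∀ i, a i ∈ N δ) ∧ χ.Realize (Sum.elim b a) ∧ ∀ b' ∈ Z, χ.Realize (Sum.elim b' a) →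
          b' ∈ ⋂₀ (S : Set (Set (Fin (m δ) ⊕ Fin (k δ) → U))) := by
      induction S using Finset.induction_on with
      | empty => exact ⟨0, ⊤, Fin.elim0, fun i => i.elim0, by simp, by simp⟩
      | insert s S _ ih =>
        rw [Finset.coe_insert, Set.insert_subset_iff] at hS
        obtain ⟨t, χ, a, ha, hχ, h⟩ := ih hS.2
        rcases hS.1 with rfl | ⟨t', χ', a', ha', hχ', rfl⟩
        · refine ⟨t, χ, a, ha, hχ, fun b' h1 h2 => ?_⟩
          rw [Finset.coe_insert, Set.sInter_insert]
          exact ⟨h1, h b' h1 h2⟩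
        · have hrel : ∀ b', ((χ.relabel (Sum.map id (finSumFinEquiv ∘ Sum.inl)) ⊓
              χ'.relabel (Sum.map id (finSumFinEquiv ∘ Sum.inr)) :
              L.Formula ((Fin (m δ) ⊕ Fin (k δ)) ⊕ Fin (t + t')))).Realize
                (Sum.elim b' (Sum.elim a a' ∘ finSumFinEquiv.symm)) ↔
                χ.Realize (Sum.elim b' a) ∧ χ'.Realize (Sum.elim b' a') := by
            intro b'
            rw [Formula.realize_inf, Formula.realize_relabel, Formula.realize_relabel,
              Sum.elim_comp_map, Sum.elim_comp_map]
            have e1 : (Sum.elim a a' ∘ finSumFinEquiv.symm) ∘ finSumFinEquiv ∘ Sum.inl = a := by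
              ext i; simp
            have e2 : (Sum.elim a a' ∘ finSumFinEquiv.symm) ∘ finSumFinEquiv ∘ Sum.inr = a' := by
              ext i; simp
            rw [e1, e2]
            rfl
          refine ⟨t + t', _, _, fun i => ?_, (hrel b).2 ⟨hχ, hχ'⟩, fun b' h1 h2 => ?_⟩
          · rcases h : finSumFinEquiv.symm i with j | j <;> simp [h, ha, ha']
          · rw [Finset.coe_insert, Set.sInter_insert]
            exact ⟨((hrel b').1 h2).2, h b' h1 ((hrel b').1 h2).1⟩
    obtain ⟨t, χ, a, ha, hχ, h⟩ := h1
    obtain ⟨j, hj, b', hb', hb''⟩ := hrefl ⟨(m δ, k δ), φ δ, t, χ, a⟩ ha ⟨b, rfl, hχ⟩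
    exact ⟨b', h b' ⟨j, hj, hb'⟩ hb''⟩)
  have hZ : Z ∈ D := hD (Or.inl rfl)
  refine (hfork δ hδ).not_consistent hT hU (hκ'.trans (Order.lt_succ _))
    ((hcard δ hδ).trans (Order.lt_succ _)) (D := D) (Filter.mem_of_superset hZ hZN)
    (fun t χ a ha hχ => hD (Or.inr ⟨t, χ, a, ha, hχ, rfl⟩)) hZ fun S => ?_
  -- Instances of `φ δ` at tuples of `Z` are members of the chain, so its consistency applies to
  -- them.
  choose j hj hj' using fun b' : Z => b'.2
  obtain ⟨x, hx⟩ := hcon (S.image fun b' => ⟨j b', (hj b').trans hδ⟩)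
  refine ⟨x, fun b' hb' => ?_⟩
  have h1 := hx _ (Finset.mem_image.2 ⟨b', hb', rfl⟩)
  have h2 : (tup (j b')).2.1.Realize (Sum.elim x (tup (j b')).2.2) := h1
  rw [hj' b'] at h2
  exact h2

end Chain

/-! ### Skolem hulls and the continuous chains they generate. -/

section Hull

variable {L : FirstOrder.Language.{u, v}}

/-- The image of an elementary substructure under an elementary embedding. -/
def mapElementary {M : Type w} [L.Structure M] {U : Type w'} [L.Structure U] (g : M ↪ₑ[L] U)
    (S : L.ElementarySubstructure M) : L.ElementarySubstructure U where
  toSubstructure := S.toSubstructure.map g.toEmbedding.toHom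
  isElementary' := by
    intro n φ x
    let f : S ≃[L] S.toSubstructure.map g.toEmbedding.toHom :=
      g.toEmbedding.substructureEquivMap S.toSubstructure
    obtain ⟨y, rfl⟩ : ∃ y : Fin n → S, f ∘ y = x :=
      ⟨f.symm ∘ x, funext fun i => f.apply_symm_apply (x i)⟩
    exact ((g.comp S.subtype).map_formula φ y).trans
      (f.toElementaryEmbedding.map_formula φ y).symm

variable {M : Type w} [L.Structure M] [(L.sum L.skolem₁).Structure M]

variable (L M) in
/-- The function symbols of `L.skolem₁` are interpreted by Skolem functions. -/
def IsSkolem : Prop :=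
  ∀ (n : ℕ) (φ : L.BoundedFormula Empty (n + 1)) (x : Fin n → M) (a : M),
    φ.Realize default (Fin.snoc x a : Fin (n + 1) → M) →
      φ.Realize default (Fin.snoc x (Structure.funMap
        ((LHom.sumInr : L.skolem₁ →ᴸ L.sum L.skolem₁).onFunction (n := n) φ) x) : Fin (n + 1) → M)

variable [(LHom.sumInl : L →ᴸ L.sum L.skolem₁).IsExpansionOn M]

/-- The Skolem hull of a set. -/
def skolemHull (h : IsSkolem L M) (s : Set M) : L.ElementarySubstructure M :=
  ((LHom.sumInl : L →ᴸ L.sum L.skolem₁).substructureReduct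
    (Substructure.closure (L.sum L.skolem₁) s)).toElementarySubstructure fun n φ x a ha =>
      ⟨⟨_, (Substructure.closure (L.sum L.skolem₁) s).fun_mem
        ((LHom.sumInr : L.skolem₁ →ᴸ L.sum L.skolem₁).onFunction (n := n) φ)
          (fun i => (x i : M)) fun i => (x i).2⟩, h n φ _ a ha⟩

theorem subset_skolemHull (h : IsSkolem L M) (s : Set M) : s ⊆ skolemHull h s :=
  Substructure.subset_closure

theorem skolemHull_mono (h : IsSkolem L M) {s t : Set M} (hst : s ⊆ t) :
    skolemHull h s ≤ skolemHull h t :=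
  fun _ hx => Substructure.closure_mono hst hx

/-- The Skolem hull commutes with increasing unions of limit length. -/
theorem exists_mem_skolemHull (h : IsSkolem L M) {s : Ordinal.{w'} → Set M} (hs : Monotone s)
    {i : Ordinal.{w'}} (hi : Order.IsSuccLimit i) (hsi : ∀ x ∈ s i, ∃ j < i, x ∈ s j) {x : M}
    (hx : x ∈ skolemHull h (s i)) : ∃ j < i, x ∈ skolemHull h (s j) := by
  refine Substructure.closure_induction (L := L.sum L.skolem₁)
    (p := fun x => ∃ j < i, x ∈ skolemHull h (s j)) hx (fun x hx => ?_) fun {n} f x hx => ?_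
  · obtain ⟨j, hj, hxj⟩ := hsi x hx
    exact ⟨j, hj, subset_skolemHull h _ hxj⟩
  · choose k hk hk' using hx
    have hi0 : (0 : Ordinal) < i := hi.bot_lt
    refine ⟨Finset.univ.sup k, (Finset.sup_lt_iff hi0).2 fun t _ => hk t, ?_⟩
    exact (Substructure.closure (L.sum L.skolem₁) (s (Finset.univ.sup k))).fun_mem f x fun t =>
      skolemHull_mono h (hs (Finset.le_sup (Finset.mem_univ t))) (hk' t)

/-- The chain of images of Skolem hulls of initial segments of a sequence of sets. -/
def hullChain {U : Type*} [L.Structure U] (g : M ↪ₑ[L] U) (h : IsSkolem L M) (B : Set M)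
    (A : Ordinal.{w'} → Set M) (i : Ordinal.{w'}) : L.ElementarySubstructure U :=
  mapElementary g (skolemHull h (B ∪ ⋃ j < i, A j))

variable {U : Type*} [L.Structure U] (g : M ↪ₑ[L] U) (h : IsSkolem L M) (B : Set M)
    (A : Ordinal.{w'} → Set M)

theorem hullChain_mono {i j : Ordinal.{w'}} (hij : i ≤ j) :
    hullChain g h B A i ≤ hullChain g h B A j :=
  Set.image_mono (skolemHull_mono h (Set.union_subset_union_right B
    (Set.biUnion_subset_biUnion_left fun _ hk => lt_of_lt_of_le hk hij)))

theorem hullChain_limit {i : Ordinal.{w'}} (hi : Order.IsSuccLimit i) :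
    (hullChain g h B A i : Set U) = ⋃ j < i, (hullChain g h B A j : Set U) := by
  apply Set.Subset.antisymm
  · rintro _ ⟨x, hx, rfl⟩
    obtain ⟨j, hj, hxj⟩ := exists_mem_skolemHull h (s := fun i => B ∪ ⋃ j < i, A j)
      (fun i j hij => Set.union_subset_union_right B
        (Set.biUnion_subset_biUnion_left fun _ hk => lt_of_lt_of_le hk hij)) hi (by
      rintro x (hx | hx)
      · exact ⟨0, hi.bot_lt, Or.inl hx⟩
      · obtain ⟨j, hj, hxj⟩ := Set.mem_iUnion₂.1 hx
        exact ⟨_, hi.succ_lt hj, Or.inr (Set.mem_iUnion₂.2 ⟨j, Order.lt_succ j, hxj⟩)⟩) hx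
    exact Set.mem_iUnion₂.2 ⟨j, hj, x, hxj, rfl⟩
  · exact Set.iUnion₂_subset fun j hj => hullChain_mono g h B A hj.le

theorem mem_hullChain_succ {i : Ordinal.{w'}} {x : M} (hx : x ∈ A i) :
    g x ∈ hullChain g h B A (i + 1) :=
  ⟨x, subset_skolemHull h _ (Or.inr (Set.mem_iUnion₂.2 ⟨i, by
    rw [← Order.succ_eq_add_one]; exact Order.lt_succ i, hx⟩)), rfl⟩

end Hull

/-! ### Cardinality of Skolem hulls. -/

section HullCard

theorem mk_union_biUnion_le {M : Type w} {B : Set M} {A : Ordinal.{w} → Set M} (hB : B.Countable)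
    (hA : ∀ i, (A i).Countable) {i : Ordinal.{w}} {c : Cardinal.{w}} (hc : ℵ₀ ≤ c)
    (hi : i.card ≤ c) : #(B ∪ ⋃ j < i, A j : Set M) ≤ c :=
  (Cardinal.mk_union_le _ _).trans (Cardinal.add_le_of_le hc (hB.le_aleph0.trans hc)
    (Cardinal.mk_biUnion_le_of_le hi hc A fun j _ => (hA j).le_aleph0.trans hc))

variable {L : FirstOrder.Language.{u, v}} {M : Type (max u v w)} [L.Structure M]
  [(L.sum L.skolem₁).Structure M] [(LHom.sumInl : L →ᴸ L.sum L.skolem₁).IsExpansionOn M]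

theorem mk_skolemHull_le (T : L.Theory) (h : IsSkolem L M) {s : Set M}
    {c : Cardinal.{max u v w}} (hc : Cardinal.lift.{w} (theoryCard T) ≤ c) (hs : #s ≤ c) :
    #(skolemHull h s) ≤ c := by
  have h0 : ℵ₀ ≤ c := by
    refine le_trans ?_ hc
    rw [Cardinal.aleph0_le_lift]
    exact le_max_left _ _
  have h1 := Substructure.lift_card_closure_le (L := L.sum L.skolem₁) (s := s)
  rw [Cardinal.lift_id'.{max u v, max u v w}, Cardinal.lift_id'.{max u v, max u v w}] at h1
  refine h1.trans (max_le h0 (Cardinal.add_le_of_le h0 hs ?_))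
  rw [Cardinal.lift_umax.{max u v, w}]
  exact (Cardinal.lift_le.2 card_functions_sum_skolem₁_le).trans hc

theorem mk_hullChain_lt (T : L.Theory) {U : Type (max u v w)} [L.Structure U] (g : M ↪ₑ[L] U) (h : IsSkolem L M) {B : Set M}
    {A : Ordinal.{max u v w} → Set M} (hB : B.Countable) (hA : ∀ i, (A i).Countable)
    {κ : Cardinal.{max u v w}} (hκ : Cardinal.lift.{w} (theoryCard T) < κ)
    {i : Ordinal.{max u v w}} (hi : i < κ.ord) : #(hullChain g h B A i) < κ := by
  let c := max i.card (Cardinal.lift.{w} (theoryCard T))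
  have hc : ℵ₀ ≤ c := by
    refine le_trans ?_ (le_max_right _ _)
    rw [Cardinal.aleph0_le_lift]
    exact le_max_left _ _
  have h1 : #(skolemHull h (B ∪ ⋃ j < i, A j)) ≤ c :=
    mk_skolemHull_le T h (le_max_right _ _) (mk_union_biUnion_le hB hA hc (le_max_left _ _))
  exact (Cardinal.mk_image_le.trans h1).trans_lt (max_lt (Cardinal.lt_ord.1 hi) hκ)

end HullCard

/-! ### Small submodels over which a type does not Kim-fork. -/

section SmallBase

variable {L : FirstOrder.Language.{u, v}}

theorem isSkolem_of_nonempty {M : Type w} [L.Structure M] [Nonempty M] : IsSkolem L M :=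
  fun n φ x a h => Classical.epsilon_spec (p := fun a => φ.Realize default
    (Fin.snoc x a : Fin (n + 1) → M)) ⟨a, h⟩

/-- A type over a model does not Kim-fork over that model. -/
theorem not_typeKimForks_self {U : Type w} [L.Structure U] [Nonempty U]
    (M : L.ElementarySubstructure U) {n : ℕ}
    (p : (L.elementaryDiagram M).CompleteType (Fin n)) : ¬ TypeKimForks (M : Set U) p := by
  rintro ⟨k, θ, m, l, φ, b, hθ, hφ, K, r, ψ, c, himp, hdiv⟩
  obtain ⟨a, ha⟩ := Has.exists_realize (ι := Unit) (φ := fun _ => θ) (e := fun _ => m)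
    fun _ => hθ
  have ha' : θ.Realize (Sum.elim (fun i => (a i : U)) fun i => (m i : U)) := by
    have := (M.subtype.map_formula θ (Sum.elim a m)).2 (ha ())
    rwa [Sum.comp_elim] at this
  -- The tuple `a` from `M` satisfies some disjunct. That disjunct, with `a` plugged in for `x`, is
  -- a formula over `M` in the type of `c i`, so `a` solves its instances at all terms of any Morley
  -- sequence in an extension of this type.
  obtain ⟨i, hi⟩ := himp _ (hφ _ ha')
  obtain ⟨q, -, hqc, d, hd, hcon⟩ := hdiv i
  refine hcon fun s => ⟨fun i => (a i : U), fun j _ => ?_⟩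
  have h1 : Has q ((ψ i).relabel Sum.swap) fun i => (a i : U) := by
    rw [hqc.has_iff _ fun i => (a i).2, Formula.realize_relabel, sumElim_comp_swap]
    exact hi
  rw [(hd j).has_iff _ fun i => Or.inl (a i).2, Formula.realize_relabel, sumElim_comp_swap] at h1
  exact h1

/-- Kim-forking passes to stronger formulas, so a witness can be chosen in `p` itself. -/
theorem TypeKimForks.exists_kimForks {U : Type w} [L.Structure U] {A : Set U}
    {M : L.ElementarySubstructure U} {n : ℕ} {p : (L.elementaryDiagram M).CompleteType (Fin n)}
    (h : TypeKimForks A p) : ∃ (k : ℕ) (θ : L.Formula (Fin n ⊕ Fin k)) (m : Fin k → M),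
      Has p θ m ∧ KimForks A θ fun i => (m i : U) := by
  obtain ⟨k, θ, m, l, φ, b, hθ, hφ, K, r, ψ, c, himp, hdiv⟩ := h
  exact ⟨k, θ, m, hθ, K, r, ψ, c, fun x hx => himp x (hφ x hx), hdiv⟩

/-- In an NSOP₁ theory, a type over a model does not Kim-fork over some submodel of size at most
`|T|`. -/
theorem exists_not_typeKimForks {T : L.Theory} (hT : NSOP1 T) {U : Type (max u v w)}
    [L.Structure U] [Nonempty U] [U ⊨ T] (M : L.ElementarySubstructure U)
    (hU : IsSaturated L U (Order.succ #M)) {n : ℕ}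
    (p : (L.elementaryDiagram M).CompleteType (Fin n)) :
    ∃ M' : L.ElementarySubstructure U, M' ≤ M ∧ #M' ≤ Cardinal.lift.{w} (theoryCard T) ∧
      ¬ TypeKimForks (M' : Set U) p := by
  classical
  rcases le_or_gt #M (Cardinal.lift.{w} (theoryCard T)) with hM | hM
  · exact ⟨M, le_rfl, hM, not_typeKimForks_self M p⟩
  by_contra! hcon
  let ν : Cardinal.{max u v w} := Cardinal.lift.{w} (theoryCard T)
  have hν : ℵ₀ ≤ ν := by
    simp only [ν, Cardinal.aleph0_le_lift, theoryCard]
    exact le_max_left _ _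
  have hsk : IsSkolem L M := isSkolem_of_nonempty
  have hpick : ∀ S : Set M, ∃ d : Σ k : ℕ, L.Formula (Fin n ⊕ Fin k) × (Fin k → M), #S ≤ ν →
      Has p d.2.1 d.2.2 ∧ KimForks (mapElementary M.subtype (skolemHull hsk S) : Set U) d.2.1
        fun i => (d.2.2 i : U) := by
    intro S
    by_cases hS : #S ≤ ν
    · obtain ⟨k, θ, m, h1, h2⟩ :=
        (hcon (mapElementary M.subtype (skolemHull hsk S)) (by
          rintro _ ⟨x, -, rfl⟩
          exact x.2) (Cardinal.mk_image_le.trans (mk_skolemHull_le T hsk le_rfl hS))).exists_kimForks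
      exact ⟨⟨k, θ, m⟩, fun _ => ⟨h1, h2⟩⟩
    · exact ⟨⟨0, ⊤, Fin.elim0⟩, fun h => (hS h).elim⟩
  choose pick hpick using hpick
  -- Recursion on ordinals: the next formula of `p` Kim-forks over the hull of the parameters chosen
  -- so far. The union with `∅` matches the shape of `hullChain` with empty bottom set.
  obtain ⟨d, hd⟩ : ∃ d : Ordinal.{max u v w} → Σ k : ℕ, L.Formula (Fin n ⊕ Fin k) × (Fin k → M),
      ∀ i, d i = pick (∅ ∪ ⋃ j < i, Set.range (d j).2.2) :=
    ⟨WellFounded.fix Ordinal.lt_wf fun i d =>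
      pick (∅ ∪ ⋃ (j) (h : j < i), Set.range (d j h).2.2), fun i => WellFounded.fix_eq _ _ _⟩
  let A : Ordinal.{max u v w} → Set M := fun j => Set.range (d j).2.2
  have hA : ∀ i, (A i).Countable := fun i => Set.countable_range _
  have hprop : ∀ i < (Order.succ ν).ord, Has p (d i).2.1 (d i).2.2 ∧
      KimForks (hullChain M.subtype hsk ∅ A i : Set U) (d i).2.1 fun t => ((d i).2.2 t : U) := by
    intro i hi
    have h1 := hpick (∅ ∪ ⋃ j < i, A j) (mk_union_biUnion_le Set.countable_empty hA hν
      (Order.lt_succ_iff.1 (Cardinal.lt_ord.1 hi)))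
    rw [← hd i] at h1
    exact h1
  have hreal : ∀ (k : ℕ) (θ : L.Formula (Fin n ⊕ Fin k)) (m : Fin k → U) (x : Fin n → U),
      (θ.relabel (Sum.map id Sum.inl) : L.Formula (Fin n ⊕ (Fin k ⊕ Fin 0))).Realize
        (Sum.elim x (Sum.elim m Fin.elim0)) ↔ θ.Realize (Sum.elim x m) := by
    intro k θ m x
    rw [Formula.realize_relabel, Sum.elim_comp_map, Sum.elim_comp_inl, Function.comp_id]
  refine not_hasKimForkingChain hT (hU.mono (Order.succ_le_succ (Order.succ_le_of_lt hM)))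
    ⟨n, hullChain M.subtype hsk ∅ A, fun i => (d i).1, fun _ => 0,
      fun i => (d i).2.1.relabel (Sum.map id Sum.inl), fun i t => (d i).2.2 t,
      fun _ => Fin.elim0, fun i j hij _ => hullChain_mono _ _ _ _ hij,
      fun i _ hi => hullChain_limit _ _ _ _ hi,
      fun i hi => mk_hullChain_lt T _ _ Set.countable_empty hA (Order.lt_succ _) hi,
      fun _ _ t => t.elim0, fun i _ t => mem_hullChain_succ M.subtype hsk ∅ A ⟨t, rfl⟩,
      fun i hi => ?_, fun s => ?_⟩
  · obtain ⟨K, r, ψ, c, himp, hdiv⟩ := (hprop i hi).2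
    exact ⟨K, r, ψ, c, fun x hx => himp x ((hreal _ _ _ _).1 hx), hdiv⟩
  · obtain ⟨a, ha⟩ := Has.exists_realize (ι := Fin s.card) (q := p)
      (φ := fun i => (d (s.equivFin.symm i).1).2.1) (e := fun i => (d (s.equivFin.symm i).1).2.2)
      fun i => (hprop _ (s.equivFin.symm i).1.2).1
    refine ⟨fun t => a t, fun i hi => (hreal _ _ _ _).2 ?_⟩
    obtain ⟨j, rfl⟩ : ∃ j, (s.equivFin.symm j).1 = i :=
      ⟨s.equivFin ⟨i, hi⟩, by rw [Equiv.symm_apply_apply]⟩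
    have := (M.subtype.map_formula _ _).2 (ha j)
    rwa [Sum.comp_elim] at this

end SmallBase

/-! ### Saturated elementary extensions by a Henkin construction. -/

section SaturatedExtension

variable (L : FirstOrder.Language.{u, v}) (N : Type w) (K : Type w)

/-- Names for the elements of a saturated elementary extension of `N`: the elements of `N`, and
witnesses for sets of formulas over `K`-indexed families of names. -/
inductive ElementName : Type (max u v w)
  | base : N → ElementName
  | wit : (K → ElementName) → (n : ℕ) → Set (L.Formula (Fin n ⊕ K)) → Fin n → ElementName

/-- A set of formulas over a `K`-indexed family of names. -/
structure WitnessTask where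
  /-- The parameters. -/
  param : K → ElementName L N K
  /-- The number of variables. -/
  arity : ℕ
  /-- The formulas to be realized. -/
  formulas : Set (L.Formula (Fin arity ⊕ K))

variable {L N K}

/-- The names of the realization of a task. -/
def WitnessTask.wit (τ : WitnessTask L N K) : Fin τ.arity → ElementName L N K :=
  ElementName.wit τ.param τ.arity τ.formulas

/-- The formulas expressing that a task is fulfilled. -/
def WitnessTask.demand (τ : WitnessTask L N K) : Set (L.Formula (ElementName L N K)) :=
  (fun φ => φ.relabel (Sum.elim τ.wit τ.param)) '' τ.formulas

/-- The task `τ'` has a witness of `τ` among its parameters. -/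
def WitnessTask.Precedes (τ τ' : WitnessTask L N K) : Prop := ∃ k t, τ'.param k = τ.wit t

/-- The parameters of a task are immediate subterms of its witness names, so a descent along
`Precedes` is a descent in the inductive type of names. -/
theorem WitnessTask.wellFounded_precedes : WellFounded (WitnessTask.Precedes (L := L) (N := N) (K := K)) := by
  have key : ∀ x : ElementName L N K, ∀ (τ : WitnessTask L N K) t, x = τ.wit t → Acc WitnessTask.Precedes τ := by
    intro x
    induction x with
    | base => intro τ t h; cases h
    | wit f n Γ t ih =>
      rintro ⟨f', n', Γ'⟩ t' h
      obtain ⟨rfl, -⟩ := ElementName.wit.inj h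
      exact Acc.intro _ fun τ ⟨k, s, hs⟩ => ih k τ s hs
  exact ⟨fun τ => Acc.intro _ fun τ' ⟨k, t, h⟩ => key _ τ' t h⟩

theorem WitnessTask.wit_injective {τ τ' : WitnessTask L N K} {t : Fin τ.arity} {t' : Fin τ'.arity}
    (h : τ.wit t = τ'.wit t') : τ = τ' := by
  obtain ⟨f, n, Γ⟩ := τ
  obtain ⟨f', n', Γ'⟩ := τ'
  obtain ⟨rfl, rfl, h1, -⟩ := ElementName.wit.inj h
  have h2 : Γ = Γ' := eq_of_heq h1
  subst h2
  rfl

/-- Every finite subset of `Γ` has a realization. -/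
def FinSat {α : Type w'} (Γ : Set (L.Formula α)) : Prop :=
  ∀ s : Finset (L.Formula α), (s : Set (L.Formula α)) ⊆ Γ →
    ∃ (M : Type (max u v w')) (_ : L.Structure M) (_ : Nonempty M) (v : α → M), ∀ φ ∈ s, φ.Realize v

end SaturatedExtension

section SaturatedExtension

variable {L : FirstOrder.Language.{u, v}} {N : Type (max u v w)} {K : Type (max u v w)}
  [L.Structure N]

variable (L N K) in
/-- The elementary diagram of `N`, as a set of formulas in the names of its elements. -/
def diagramFormulas : Set (L.Formula (ElementName L N K)) :=
  (fun φ : L.Formula N => φ.relabel ElementName.base) '' {φ | φ.Realize id}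

/-- There is a model of the elementary diagram of `N` in which every task that is finitely
satisfiable is fulfilled. -/
theorem exists_task_model [Nonempty N] :
    ∃ (W : Type (max u v w)) (_ : L.Structure W) (_ : Nonempty W) (v : ElementName L N K → W),
      (∀ φ ∈ diagramFormulas L N K, φ.Realize v) ∧
      ∀ τ : WitnessTask L N K, (∀ s : Finset (L.Formula (Fin τ.arity ⊕ K)), (s : Set _) ⊆ τ.formulas →
        ∃ x : Fin τ.arity → W, ∀ φ ∈ s, φ.Realize (Sum.elim x (v ∘ τ.param))) →
        ∀ φ ∈ τ.formulas, φ.Realize (Sum.elim (v ∘ τ.wit) (v ∘ τ.param)) := by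
  classical
  have : IsWellFounded (WitnessTask L N K) WitnessTask.Precedes := ⟨WitnessTask.wellFounded_precedes⟩
  obtain ⟨lt, hle, hwo⟩ :=
    IsWellFounded.exists_well_order_ge (WitnessTask.Precedes (L := L) (N := N) (K := K))
  -- Tasks are considered along a well-order extending `Precedes`. A task is accepted when its
  -- demand is finitely satisfiable together with the diagram and the demands accepted earlier.
  obtain ⟨G, hG⟩ : ∃ G : WitnessTask L N K → Prop, ∀ τ, G τ ↔ FinSat (diagramFormulas L N K ∪
      (⋃ (τ') (_ : lt τ' τ) (_ : G τ'), τ'.demand) ∪ τ.demand) :=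
    ⟨hwo.toIsWellFounded.wf.fix fun τ G => FinSat (diagramFormulas L N K ∪
      (⋃ (τ') (h : lt τ' τ) (_ : G τ' h), τ'.demand) ∪ τ.demand), fun τ => by
        rw [WellFounded.fix_eq]⟩
  let Γ : Set (L.Formula (ElementName L N K)) := diagramFormulas L N K ∪ ⋃ (τ) (_ : G τ), τ.demand
  have hbase : FinSat (diagramFormulas L N K) := by
    intro s hs
    let a : N := Classical.arbitrary N
    refine ⟨N, inferInstance, inferInstance, fun x => ElementName.rec (fun y => y) (fun _ _ _ _ _ => a) x,
      fun φ hφ => ?_⟩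
    obtain ⟨ψ, hψ, rfl⟩ := hs hφ
    rw [Formula.realize_relabel]
    exact hψ
  -- Finitely many accepted demands have a latest one, and its acceptance covers all the others.
  have hfin : ∀ s : Finset (L.Formula (ElementName L N K)), (s : Set _) ⊆ Γ →
      (s : Set _) ⊆ diagramFormulas L N K ∨ ∃ τ, G τ ∧ (s : Set _) ⊆ diagramFormulas L N K ∪
        (⋃ (τ') (_ : lt τ' τ) (_ : G τ'), τ'.demand) ∪ τ.demand := by
    intro s
    induction s using Finset.induction_on with
    | empty => intro _; left; simp
    | insert φ s _ ih =>
      intro hs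
      rw [Finset.coe_insert, Set.insert_subset_iff] at hs
      rw [Finset.coe_insert]
      rcases hs.1 with h1 | h1
      · rcases ih hs.2 with h | ⟨τ, hτ, h⟩
        · exact Or.inl (Set.insert_subset h1 h)
        · exact Or.inr ⟨τ, hτ, Set.insert_subset (Or.inl (Or.inl h1)) h⟩
      · obtain ⟨σ, hσ, hφ⟩ := Set.mem_iUnion₂.1 h1
        right
        rcases ih hs.2 with h | ⟨τ, hτ, h⟩
        · exact ⟨σ, hσ, Set.insert_subset (Or.inr hφ) fun ψ hψ => Or.inl (Or.inl (h hψ))⟩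
        · rcases trichotomous_of lt σ τ with hlt | rfl | hlt
          · refine ⟨τ, hτ, Set.insert_subset (Or.inl (Or.inr ?_)) h⟩
            exact Set.mem_iUnion₂.2 ⟨σ, hlt, Set.mem_iUnion.2 ⟨hσ, hφ⟩⟩
          · exact ⟨σ, hσ, Set.insert_subset (Or.inr hφ) h⟩
          · refine ⟨σ, hσ, Set.insert_subset (Or.inr hφ) fun ψ hψ => Or.inl ?_⟩
            rcases h hψ with (h | h) | h
            · exact Or.inl h
            · obtain ⟨τ', hτ', h⟩ := Set.mem_iUnion₂.1 h
              exact Or.inr (Set.mem_iUnion₂.2 ⟨τ', _root_.trans (r := lt) hτ' hlt, h⟩)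
            · exact Or.inr (Set.mem_iUnion₂.2 ⟨τ, hlt, Set.mem_iUnion.2 ⟨hτ, h⟩⟩)
  obtain ⟨W, _, _, v, hv⟩ := exists_realize_of_finite Γ fun s hs => by
    rcases hfin s hs with h | ⟨τ, hτ, h⟩
    · exact hbase s h
    · exact (hG τ).1 hτ s h
  refine ⟨W, inferInstance, inferInstance, v, fun φ hφ => hv φ (Or.inl hφ), fun τ hτ => ?_⟩
  -- A task finitely satisfiable in `W` must have been accepted: reinterpret just its witness names
  -- by a finite solution `x`. Earlier tasks have other witnesses and do not use these names as
  -- parameters, because `lt` extends `Precedes`, so their demands and the diagram stay true.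
  have hGτ : G τ := by
    rw [hG]
    intro s hs
    choose! g hg hg' using fun (φ : L.Formula (ElementName L N K)) (h : φ ∈ τ.demand) => h
    obtain ⟨x, hx⟩ := hτ ((s.filter (· ∈ τ.demand)).image g) (by
      intro φ hφ
      obtain ⟨ψ, hψ, rfl⟩ := Finset.mem_image.1 hφ
      exact hg ψ (Finset.mem_filter.1 hψ).2)
    let v' : ElementName L N K → W := fun y => if h : ∃ t, y = τ.wit t then x h.choose else v y
    have hv1 : ∀ y, (∀ t, y ≠ τ.wit t) → v' y = v y := fun y hy => by
      have : ¬ ∃ t, y = τ.wit t := fun ⟨t, ht⟩ => hy t ht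
      simp only [v', this, dif_neg, not_false_eq_true]
    have hinj : ∀ t t', τ.wit t = τ.wit t' → t = t' := fun t t' h => by
      have := (ElementName.wit.inj h).2.2.2
      exact eq_of_heq this
    have hv2 : v' ∘ τ.wit = x := by
      ext t
      have : ∃ t', τ.wit t = τ.wit t' := ⟨t, rfl⟩
      simp only [v', Function.comp_apply, this, dif_pos]
      rw [← hinj _ _ this.choose_spec]
    have hne : ∀ τ', ¬ lt τ τ' → ∀ k t, τ'.param k ≠ τ.wit t := fun τ' h k t h' =>
      h (hle _ _ ⟨k, t, h'⟩)
    have hirr : ∀ σ, ¬ lt σ σ := hwo.toIsWellFounded.wf.irrefl.irrefl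
    have hparam : v' ∘ τ.param = v ∘ τ.param := funext fun k => hv1 _ (hne τ (hirr τ) k)
    refine ⟨W, inferInstance, inferInstance, v', fun φ hφ => ?_⟩
    rcases hs hφ with (h | h) | h
    · have h1 := hv φ (Or.inl h)
      obtain ⟨ψ, -, rfl⟩ := h
      rw [Formula.realize_relabel] at h1 ⊢
      convert h1 using 1
      exact funext fun y => hv1 _ fun t ht => by cases ht
    · obtain ⟨σ, hσ, h⟩ := Set.mem_iUnion₂.1 h
      obtain ⟨hGσ, h⟩ := Set.mem_iUnion.1 h
      have h1 := hv φ (Or.inr (Set.mem_iUnion₂.2 ⟨σ, hGσ, h⟩))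
      obtain ⟨ψ, -, rfl⟩ := h
      have hnlt : ¬ lt τ σ := fun h' => hirr _ (_root_.trans (r := lt) h' hσ)
      rw [Formula.realize_relabel, Sum.comp_elim] at h1 ⊢
      have e1 : v' ∘ σ.wit = v ∘ σ.wit := funext fun t => hv1 _ fun t' ht' => by
        have := WitnessTask.wit_injective ht'
        subst this
        exact hirr _ hσ
      have e2 : v' ∘ σ.param = v ∘ σ.param := funext fun k => hv1 _ (hne σ hnlt k)
      rwa [e1, e2]
    · have h1 := hx (g φ) (Finset.mem_image.2 ⟨φ, Finset.mem_filter.2 ⟨hφ, h⟩, rfl⟩)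
      rw [← hg' φ h, Formula.realize_relabel, Sum.comp_elim, hv2, hparam]
      exact h1
  intro φ hφ
  have h1 := hv _ (Or.inr (Set.mem_iUnion₂.2 ⟨τ, hGτ, φ, hφ, rfl⟩))
  rwa [Formula.realize_relabel, Sum.comp_elim] at h1

/-- The formula obtained by turning the constants from `A` into variables. -/
noncomputable def constantsToVars {A : Type*} {n : ℕ} (φ : L[[A]].Formula (Fin n)) :
    L.Formula (Fin n ⊕ A) :=
  Formula.relabel Sum.swap (BoundedFormula.constantsVarsEquiv φ : L.Formula (A ⊕ Fin n))

theorem realize_constantsToVars {W : Type*} [L.Structure W] {A : Set W} {n : ℕ}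
    (φ : L[[A]].Formula (Fin n)) (x : Fin n → W) :
    (constantsToVars φ).Realize (Sum.elim x (↑)) ↔ φ.Realize x := by
  rw [constantsToVars, Formula.realize_relabel, sumElim_comp_swap]
  exact BoundedFormula.realize_constantsVarsEquiv

/-- Every structure has a `κ⁺`-saturated elementary extension. -/
theorem exists_isSaturated (N : Type (max u v w)) [L.Structure N] [Nonempty N]
    {κ : Cardinal.{max u v w}} (hκ : ℵ₀ ≤ κ) :
    ∃ (U : Type (max u v w)) (_ : L.Structure U) (_ : Nonempty U) (_ : N ↪ₑ[L] U),
      IsSaturated L U (Order.succ κ) := by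
  classical
  let K : Type (max u v w) := κ.out
  have hK : #K = κ := Cardinal.mk_out κ
  have hKinf : Infinite K := Cardinal.infinite_iff.2 (by rwa [hK])
  obtain ⟨W, _, _, v, hdiag, hwit⟩ := exists_task_model (L := L) (N := N) (K := K)
  have hsol : ∀ {δ : Type (max u v w)} (i : δ ↪ K) (e : δ → ElementName L N K) (n : ℕ)
      (Γ : Set (L.Formula (Fin n ⊕ δ))),
      (∀ s : Finset (L.Formula (Fin n ⊕ δ)), (s : Set _) ⊆ Γ →
        ∃ x : Fin n → W, ∀ φ ∈ s, φ.Realize (Sum.elim x (v ∘ e))) →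
      ∃ b : Fin n → ElementName L N K, ∀ φ ∈ Γ, φ.Realize (Sum.elim (v ∘ b) (v ∘ e)) := by
    intro δ i e n Γ hΓ
    -- A smaller family of parameters is padded to a `K`-indexed one by an arbitrary name.
    let f : K → ElementName L N K :=
      Function.extend i e fun _ => ElementName.base (Classical.arbitrary N)
    have hf : f ∘ i = e := funext fun t => i.injective.extend_apply e
      (fun _ => ElementName.base (Classical.arbitrary N)) t
    have hrel : ∀ (φ : L.Formula (Fin n ⊕ δ)) (x : Fin n → W),
        (φ.relabel (Sum.map id i)).Realize (Sum.elim x (v ∘ f)) ↔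
          φ.Realize (Sum.elim x (v ∘ e)) := by
      intro φ x
      rw [Formula.realize_relabel, Sum.elim_comp_map, Function.comp_assoc, hf, Function.comp_id]
    let τ : WitnessTask L N K := ⟨f, n, (fun φ => φ.relabel (Sum.map id i)) '' Γ⟩
    have h1 := hwit τ (by
      intro s hs
      choose! g hg hg' using hs
      obtain ⟨x, hx⟩ := hΓ (s.image g) (by
        intro φ hφ
        obtain ⟨ψ, hψ, rfl⟩ := Finset.mem_image.1 hφ
        exact hg hψ)
      refine ⟨x, fun φ hφ => ?_⟩
      rw [← hg' hφ]
      exact (hrel _ _).2 (hx _ (Finset.mem_image_of_mem g hφ)))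
    exact ⟨τ.wit, fun φ hφ => (hrel φ _).1 (h1 _ ⟨φ, hφ, rfl⟩)⟩
  -- Tarski–Vaught test: a single satisfiable formula over named elements is a task, so it has a
  -- named solution.
  have hmeets : L.MeetsDefinable (Set.range v) := by
    rintro D ⟨y, hy⟩ ⟨φ, hφ⟩
    let ψ : L.Formula (Fin 1 ⊕ Set.range v) := constantsToVars φ
    choose e he using fun a : Set.range v => a.2
    let c := ULift.{max u v w} (Fin (support ψ).card)
    obtain ⟨i⟩ : Nonempty (c ↪ K) := by
      rw [← Cardinal.le_def]
      exact (Cardinal.lt_aleph0_of_finite c).le.trans (by rwa [hK])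
    let d : c → Set.range v := fun s => supportMap ψ s.down
    let χ : L.Formula (Fin 1 ⊕ c) := (supportFormula ψ).relabel (Sum.map id ULift.up)
    have hχ : ∀ x : Fin 1 → W, χ.Realize (Sum.elim x (v ∘ e ∘ d)) ↔ φ.Realize x := by
      intro x
      rw [Formula.realize_relabel, Sum.elim_comp_map, Function.comp_id, ← realize_constantsToVars]
      have : (v ∘ e ∘ d) ∘ ULift.up = (↑) ∘ supportMap ψ := funext fun s => he _
      rw [this]
      exact realize_supportFormula ψ x _
    obtain ⟨b, hb⟩ := hsol i (e ∘ d) 1 {χ} fun s hs => ⟨fun _ => y, fun θ hθ => by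
      rw [hs hθ, hχ]
      have : (fun _ => y : Fin 1 → W) ∈ {x : Fin 1 → W | x 0 ∈ D} := hy
      rwa [hφ] at this⟩
    have h1 := (hχ _).1 (hb χ rfl)
    have h2 : v ∘ b ∈ {x : Fin 1 → W | x 0 ∈ D} := by
      rw [hφ]
      exact h1
    exact ⟨_, h2, b 0, rfl⟩
  let U : L.ElementarySubstructure W := hmeets.toElementarySubstructure
  have hU : (U : Set W) = Set.range v := hmeets.closure_eq_self
  have hvU : ∀ y, v y ∈ U := fun y => by
    rw [← SetLike.mem_coe, hU]
    exact ⟨y, rfl⟩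
  refine ⟨U, inferInstance, inferInstance, ⟨fun a => ⟨v (ElementName.base a), hvU _⟩, ?_⟩, ?_⟩
  · intro n φ x
    rw [← U.subtype.map_formula]
    have h1 : ∀ φ : L.Formula (Fin n), φ.Realize x → φ.Realize (v ∘ ElementName.base ∘ x) := by
      intro φ hφ
      have := hdiag _ ⟨φ.relabel x, by
        rw [Set.mem_ofPred_eq, Formula.realize_relabel]
        exact hφ, rfl⟩
      rwa [Formula.realize_relabel, Formula.realize_relabel] at this
    refine ⟨fun h => ?_, h1 φ⟩
    by_contra hn
    exact h1 φ.not (Formula.realize_not.2 hn) h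
  · intro A hA n Γ hΓ
    rw [Order.lt_succ_iff, ← hK, Cardinal.le_def] at hA
    obtain ⟨i⟩ := hA
    have hname : ∀ a : A, ∃ y, v y = (a : U) := fun a => by
      have h1 : ((a : U) : W) ∈ (U : Set W) := (a : U).2
      rwa [hU] at h1
    choose e he using hname
    have hΓrel : ∀ (φ : L[[A]].Formula (Fin n)) (x : Fin n → U),
        (constantsToVars φ).Realize
          (Sum.elim (fun t => (x t : W)) (v ∘ e)) ↔ φ.Realize x := by
      intro φ x
      have h1 : (Sum.elim (fun t => (x t : W)) (v ∘ e)) =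
          U.subtype ∘ (Sum.elim x (fun a : A => (a : U))) := by
        rw [Sum.comp_elim]
        congr 1
        exact funext he
      rw [h1, U.subtype.map_formula]
      exact realize_constantsToVars φ x
    obtain ⟨b, hb⟩ := hsol i e n (constantsToVars '' Γ) (by
      intro s hs
      choose! g hg hg' using hs
      obtain ⟨x, hx⟩ := hΓ (s.image g) (by
        intro φ hφ
        obtain ⟨ψ, hψ, rfl⟩ := Finset.mem_image.1 hφ
        exact hg hψ)
      refine ⟨fun t => x t, fun φ hφ => ?_⟩
      rw [← hg' hφ]
      exact (hΓrel _ _).2 (hx _ (Finset.mem_image_of_mem g hφ)))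
    exact ⟨fun t => ⟨v (b t), hvU _⟩, fun φ hφ => (hΓrel φ _).1 (hb _ ⟨φ, hφ, rfl⟩)⟩

end SaturatedExtension

/-! ### From SOP₁ trees to arrays over arbitrary linear orders. -/

section Arrays

variable {L : FirstOrder.Language.{u, v}} {n m : ℕ}

/-- The sentences in `S`, together with the statements that the formulas `φ(x; c (i, 0))` are
consistent and the formulas `φ(x; c (i, 1))` are pairwise inconsistent, for an array
`(c (i, b))_{i ∈ I, b < 2}` of tuples of variables. -/
def coreFormulas (S : Set L.Sentence) (φ : L.Formula (Fin n ⊕ Fin m)) (I : Type w) :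
    Set (L.Formula (I × Bool × Fin m)) :=
  {θ | (∃ σ ∈ S, θ = Formula.relabel Empty.elim σ) ∨
    (∃ s : Finset I, θ = commonSolution φ fun (i : s) t => (i.1, false, t)) ∨
    ∃ i j, i ≠ j ∧ θ = (commonSolution φ fun (b : Bool) t => (bif b then i else j, true, t)).not}

/-- The statement that the tuples `c p` and `c p'` of an array agree on `χ(y; e)`. -/
noncomputable def agreeFormula {I : Type w} {k : ℕ} (χ : L.Formula (Fin m ⊕ Fin k))
    (e : Fin k → I × Bool × Fin m) (p p' : I × Bool) : L.Formula (I × Bool × Fin m) :=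
  (χ.relabel (Sum.elim (fun t => (p.1, p.2, t)) e)).iff
    (χ.relabel (Sum.elim (fun t => (p'.1, p'.2, t)) e))

/-- The statements that for `R p p'` the tuples `c p` and `c p'` have the same type over the tuples
that come before both of them. -/
def agreeFormulas {I : Type w} [LT I] (R : I × Bool → I × Bool → Prop) :
    Set (L.Formula (I × Bool × Fin m)) :=
  {θ | ∃ (k : ℕ) (χ : L.Formula (Fin m ⊕ Fin k)) (e : Fin k → I × Bool × Fin m) (p p' : I × Bool),
    (∀ s, (e s).1 < p.1) ∧ (∀ s, (e s).1 < p'.1) ∧ R p p' ∧ θ = agreeFormula χ e p p'}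

variable {N : Type w'} [L.Structure N] {I : Type w}

theorem realize_agreeFormula {k : ℕ} (χ : L.Formula (Fin m ⊕ Fin k))
    (e : Fin k → I × Bool × Fin m) (p p' : I × Bool) (v : I × Bool × Fin m → N) :
    (agreeFormula χ e p p').Realize v ↔
      (χ.Realize (Sum.elim (fun t => v (p.1, p.2, t)) (v ∘ e)) ↔
        χ.Realize (Sum.elim (fun t => v (p'.1, p'.2, t)) (v ∘ e))) := by
  rw [agreeFormula, Formula.realize_iff, Formula.realize_relabel, Formula.realize_relabel,
    Sum.comp_elim, Sum.comp_elim]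
  rfl

theorem realize_coreFormulas_iff {S : Set L.Sentence} {φ : L.Formula (Fin n ⊕ Fin m)}
    {v : I × Bool × Fin m → N} :
    (∀ θ ∈ coreFormulas S φ I, θ.Realize v) ↔ (∀ σ ∈ S, N ⊨ σ) ∧
      (∀ s : Finset I, ∃ x : Fin n → N, ∀ i ∈ s,
        φ.Realize (Sum.elim x fun t => v (i, false, t))) ∧
      ∀ i j, i ≠ j → ¬ ∃ x : Fin n → N, φ.Realize (Sum.elim x fun t => v (i, true, t)) ∧
        φ.Realize (Sum.elim x fun t => v (j, true, t)) := by
  have h0 : ∀ σ : L.Sentence, (Formula.relabel Empty.elim σ : L.Formula _).Realize v ↔ N ⊨ σ := by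
    intro σ
    rw [Formula.realize_relabel, Sentence.Realize, Subsingleton.elim (v ∘ Empty.elim) default]
  have h1 : ∀ s : Finset I, (commonSolution φ fun (i : s) t => (i.1, false, t)).Realize v ↔
      ∃ x : Fin n → N, ∀ i ∈ s, φ.Realize (Sum.elim x fun t => v (i, false, t)) := by
    intro s
    rw [realize_commonSolution]
    exact exists_congr fun x => ⟨fun h i hi => h ⟨i, hi⟩, fun h i => h i.1 i.2⟩
  have h2 : ∀ i j, ((commonSolution φ fun (b : Bool) t =>
      (bif b then i else j, true, t)).not : L.Formula _).Realize v ↔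
      ¬ ∃ x : Fin n → N, φ.Realize (Sum.elim x fun t => v (i, true, t)) ∧
        φ.Realize (Sum.elim x fun t => v (j, true, t)) := by
    intro i j
    rw [Formula.realize_not, realize_commonSolution]
    exact not_congr (exists_congr fun x => ⟨fun h => ⟨h true, h false⟩, fun h b => by
      cases b
      · exact h.2
      · exact h.1⟩)
  constructor
  · exact fun h => ⟨fun σ hσ => (h0 σ).1 (h _ (Or.inl ⟨σ, hσ, rfl⟩)),
      fun s => (h1 s).1 (h _ (Or.inr (Or.inl ⟨s, rfl⟩))),
      fun i j hij => (h2 i j).1 (h _ (Or.inr (Or.inr ⟨i, j, hij, rfl⟩)))⟩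
  · rintro ⟨hS, hcon, hinc⟩ θ (⟨σ, hσ, rfl⟩ | ⟨s, rfl⟩ | ⟨i, j, hij, rfl⟩)
    · exact (h0 σ).2 (hS σ hσ)
    · exact (h1 s).2 (hcon s)
    · exact (h2 i j).2 (hinc i j hij)

/-- A chain of nodes of the binary tree lies on a branch. -/
theorem exists_branch {η : ℕ → List Bool} (h : ∀ i, η i <+: η (i + 1))
    (hlen : ∀ i, i ≤ (η i).length) : ∃ β : ℕ → Bool, ∀ i, η i = (List.range (η i).length).map β := by
  have hmono : ∀ i j, i ≤ j → η i <+: η j := fun i j hij =>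
    Nat.le_induction (List.prefix_rfl) (fun k _ ih => ih.trans (h k)) j hij
  refine ⟨fun k => (η (k + 1))[k]'(hlen (k + 1)), fun i => ?_⟩
  refine List.ext_getElem (by simp) fun k h1 h2 => ?_
  rw [List.getElem_map, List.getElem_range]
  rcases le_total i (k + 1) with h' | h'
  · exact (hmono _ _ h').getElem h1
  · exact ((hmono _ _ h').getElem (hlen (k + 1))).symm

/-- Finitely many agreements can be achieved in an array constructed from an SOP₁ tree. -/
theorem exists_array_of_finite {φ : L.Formula (Fin n ⊕ Fin m)} (h : FormulaSOP1 N φ)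
    {S : Set L.Sentence} (hS : ∀ σ ∈ S, N ⊨ σ) (s : Finset (L.Formula (ℕ × Bool × Fin m)))
    (hs : (s : Set (L.Formula (ℕ × Bool × Fin m))) ⊆ agreeFormulas fun p p' => p.1 = p'.1) :
    ∃ v : ℕ × Bool × Fin m → N, (∀ θ ∈ coreFormulas S φ ℕ, θ.Realize v) ∧ ∀ θ ∈ s, θ.Realize v := by
  classical
  obtain ⟨a, hcon, hinc⟩ := h
  choose k χ e p p' he he' hp hθ using fun θ : s => hs θ.2
  -- The node η⌢0^α⌢1. By pigeonhole two values of α agree on the finitely many relevant formulas.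
  -- The smaller gives the `true` entry, the larger the `false` entry, and the construction
  -- continues above the latter.
  let nd : List Bool → ℕ → List Bool := fun η α => η ++ List.replicate α false ++ [true]
  have hpig : ∀ (η : List Bool) (v : ℕ × Bool × Fin m → N), ∃ α β : ℕ, α < β ∧ ∀ θ : s,
      (χ θ).Realize (Sum.elim (a (nd η α)) (v ∘ e θ)) ↔
        (χ θ).Realize (Sum.elim (a (nd η β)) (v ∘ e θ)) := by
    intro η v
    obtain ⟨α, β, hne, heq⟩ := Finite.exists_ne_map_eq_of_infinite fun (α : ℕ) (θ : s) =>
      (χ θ).Realize (Sum.elim (a (nd η α)) (v ∘ e θ))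
    rcases lt_or_gt_of_ne hne with hlt | hlt
    · exact ⟨α, β, hlt, fun θ => iff_of_eq (congrFun heq θ)⟩
    · exact ⟨β, α, hlt, fun θ => iff_of_eq (congrFun heq θ).symm⟩
  choose f g hfg hagree using hpig
  -- The current node and the entries found so far; columns not yet built carry a dummy value.
  let st : ℕ → List Bool × (ℕ × Bool × Fin m → N) := Nat.rec ([], fun x => a [] x.2.2) fun j q =>
    (nd q.1 (g q.1 q.2), fun x => if x.1 = j then
      a (nd q.1 (bif x.2.1 then f q.1 q.2 else g q.1 q.2)) x.2.2 else q.2 x)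
  let F : ℕ → ℕ := fun j => f (st j).1 (st j).2
  let G : ℕ → ℕ := fun j => g (st j).1 (st j).2
  have hFG : ∀ j, F j < G j := fun j => hfg _ _
  let v : ℕ × Bool × Fin m → N := fun x => (st (x.1 + 1)).2 x
  have hst1 : ∀ j, (st (j + 1)).1 = nd (st j).1 (G j) := fun j => rfl
  have hst2 : ∀ j x, (st (j + 1)).2 x = if x.1 = j then
      a (nd (st j).1 (bif x.2.1 then F j else G j)) x.2.2 else (st j).2 x := fun j x => rfl
  have hv : ∀ j x, x.1 < j → (st j).2 x = v x := by
    intro j x hx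
    induction j, hx using Nat.le_induction with
    | base => rfl
    | succ j hj ih =>
      rw [hst2, if_neg (by omega)]
      exact ih
  have hvt : ∀ j, (fun t => v (j, true, t)) = a (nd (st j).1 (F j)) := fun j => by
    ext t
    change (st (j + 1)).2 (j, true, t) = _
    rw [hst2, if_pos rfl]
    rfl
  have hvf : ∀ j, (fun t => v (j, false, t)) = a (st (j + 1)).1 := fun j => by
    ext t
    change (st (j + 1)).2 (j, false, t) = _
    rw [hst2, if_pos rfl]
    rfl
  have hpre : ∀ j, (st j).1 <+: (st (j + 1)).1 := fun j => by
    rw [hst1]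
    simp only [nd, List.append_assoc]
    exact List.prefix_append _ _
  have hmono : ∀ i j, i ≤ j → (st i).1 <+: (st j).1 := fun i j hij =>
    Nat.le_induction (List.prefix_rfl) (fun k _ ih => ih.trans (hpre k)) j hij
  have hlen : ∀ j, j ≤ (st j).1.length := by
    intro j
    induction j with
    | zero => exact Nat.zero_le _
    | succ j ih =>
      rw [hst1]
      simp only [nd, List.length_append, List.length_singleton]
      omega
  refine ⟨v, realize_coreFormulas_iff.2 ⟨hS, fun t => ?_, ?_⟩, fun θ hθs => ?_⟩
  · obtain ⟨β, hβ⟩ := exists_branch hpre hlen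
    obtain ⟨x, hx⟩ := hcon β (t.image fun i => (st (i + 1)).1.length)
    refine ⟨x, fun i hi => ?_⟩
    rw [hvf]
    have h1 : φ.Realize (Sum.elim x (a ((List.range (st (i + 1)).1.length).map β))) :=
      hx _ (Finset.mem_image_of_mem _ hi)
    rwa [← hβ (i + 1)] at h1
  · have key : ∀ i j, i < j → ¬ ∃ x : Fin n → N, φ.Realize (Sum.elim x fun t => v (j, true, t)) ∧
        φ.Realize (Sum.elim x fun t => v (i, true, t)) := by
      intro i j hij
      rw [hvt, hvt]
      refine hinc ((st i).1 ++ List.replicate (F i) false) _ ?_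
      -- Since `F i < G i`, all later nodes extend η⌢0^F⌢0, while the `true` entry of column `i`
      -- sits at η⌢0^F⌢1; here SOP₁ gives inconsistency.
      have h1 : (st i).1 ++ List.replicate (F i) false ++ [false] <+: (st (i + 1)).1 := by
        rw [hst1]
        obtain ⟨d, hd⟩ : ∃ d, G i = F i + (1 + d) := ⟨G i - F i - 1, by have := hFG i; omega⟩
        simp only [nd, hd, List.replicate_add, List.append_assoc, List.replicate_one]
        rw [List.prefix_append_right_inj, List.prefix_append_right_inj]
        exact List.prefix_append _ _
      refine (h1.trans (hmono _ _ hij)).trans ?_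
      simp only [nd, List.append_assoc]
      exact List.prefix_append _ _
    intro i j hij
    rcases lt_or_gt_of_ne hij with hlt | hlt
    · rintro ⟨x, h1, h2⟩
      exact key i j hlt ⟨x, h2, h1⟩
    · exact key j i hlt
  · have h1 := hθ ⟨θ, hθs⟩
    change θ = _ at h1
    rw [h1, realize_agreeFormula]
    set τ : s := ⟨θ, hθs⟩
    have h2 : v ∘ e τ = (st (p τ).1).2 ∘ e τ := funext fun t => (hv _ _ (he τ t)).symm
    have h3 := hagree (st (p τ).1).1 (st (p τ).1).2 τ
    rw [← h2] at h3
    have h4 : ∀ b, (χ τ).Realize (Sum.elim (fun t => v ((p τ).1, b, t)) (v ∘ e τ)) ↔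
        (χ τ).Realize (Sum.elim (fun t => v ((p τ).1, true, t)) (v ∘ e τ)) := by
      rintro (_ | _)
      · rw [hvt, hvf]
        exact h3.symm
      · rfl
    rw [← hp τ]
    exact (h4 _).trans (h4 _).symm

/-- An SOP₁ tree gives an array with the same type over what comes before in each column. -/
theorem exists_array [Nonempty N] {φ : L.Formula (Fin n ⊕ Fin m)} (h : FormulaSOP1 N φ)
    {S : Set L.Sentence} (hS : ∀ σ ∈ S, N ⊨ σ) :
    ∃ (M : Type (max u v)) (_ : L.Structure M) (_ : Nonempty M) (v : ℕ × Bool × Fin m → M),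
      ∀ θ ∈ coreFormulas S φ ℕ ∪ agreeFormulas fun p p' => p.1 = p'.1, θ.Realize v := by
  classical
  refine exists_realize_of_finite _ fun s hs => ?_
  obtain ⟨v, h1, h2⟩ := exists_array_of_finite h hS
    (s.filter (· ∈ agreeFormulas fun p p' : ℕ × Bool => p.1 = p'.1)) fun θ hθ =>
      (Finset.mem_filter.1 hθ).2
  refine ⟨N, inferInstance, inferInstance, v, fun θ hθ => ?_⟩
  rcases hs hθ with h | h
  · exact h1 θ h
  · exact h2 θ (Finset.mem_filter.2 ⟨hθ, h⟩)

/-- Indices can be chosen so that the tuples `v (i, 1)` agree with their limit type over what comes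
before. -/
theorem exists_index_map {M : Type*} [L.Structure M] (D : Ultrafilter ℕ)
    (hD : (D : Filter ℕ) ≤ Filter.atTop) (v : ℕ × Bool × Fin m → M) [LinearOrder I]
    {ι : Type*} (H : Finset ι) (k : ι → ℕ) (χ : ∀ h, L.Formula (Fin m ⊕ Fin (k h)))
    (e : ∀ h, Fin (k h) → I × Bool × Fin m) (F : Finset I) :
    ∃ r : I → ℕ, (∀ i ∈ F, ∀ j ∈ F, i < j → r i < r j) ∧
      ∀ j ∈ F, ∀ h ∈ H, (∀ s, (e h s).1 ∈ F ∧ (e h s).1 < j) →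
        ((χ h).Realize (Sum.elim (fun t => v (r j, true, t))
          (v ∘ Prod.map r id ∘ e h)) ↔ ∀ᶠ i in D, (χ h).Realize (Sum.elim (fun t => v (i, true, t))
            (v ∘ Prod.map r id ∘ e h))) := by
  classical
  induction F using Finset.induction_on_max with
  | empty => exact ⟨fun _ => 0, by simp, by simp⟩
  | insert j F hj ih =>
    obtain ⟨r, hr, hagree⟩ := ih
    -- Each of the finitely many formulas has at `D`-almost every index the truth value of its
    -- `D`-limit, and almost every index exceeds those already chosen. The ultrafilter does the work
    -- of Ramsey's theorem.
    have hev : ∀ᶠ N in D, (∀ i ∈ F, r i < N) ∧ ∀ h ∈ H,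
        ((χ h).Realize (Sum.elim (fun t => v (N, true, t)) (v ∘ Prod.map r id ∘ e h)) ↔
          ∀ᶠ i in D, (χ h).Realize (Sum.elim (fun t => v (i, true, t))
            (v ∘ Prod.map r id ∘ e h))) := by
      rw [Filter.eventually_and, Filter.eventually_all_finset, Filter.eventually_all_finset]
      refine ⟨fun i _ => hD (Filter.eventually_gt_atTop _), fun h _ => ?_⟩
      by_cases hc : ∀ᶠ i in D, (χ h).Realize (Sum.elim (fun t => v (i, true, t))
        (v ∘ Prod.map r id ∘ e h))
      · simp only [hc, iff_true]
      · simpa only [hc, iff_false] using Ultrafilter.eventually_not.2 hc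
    obtain ⟨N, hN, hN'⟩ := hev.exists
    have hne : ∀ i ∈ F, i ≠ j := fun i hi => (hj i hi).ne
    have hrj : Function.update r j N j = N := Function.update_self _ _ _
    have hri : ∀ i ∈ F, Function.update r j N i = r i := fun i hi =>
      Function.update_of_ne (hne i hi) _ _
    have hcomp : ∀ h, (∀ s, (e h s).1 ∈ F) →
        v ∘ Prod.map (Function.update r j N) id ∘ e h = v ∘ Prod.map r id ∘ e h := by
      intro h he
      ext s
      simp only [Function.comp_apply, Prod.map, hri _ (he s)]
    refine ⟨Function.update r j N, ?_, ?_⟩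
    · intro i hi i' hi' hlt
      rcases Finset.mem_insert.1 hi with rfl | hiF
      · rcases Finset.mem_insert.1 hi' with rfl | hiF'
        · exact (lt_irrefl _ hlt).elim
        · exact (lt_asymm hlt (hj i' hiF')).elim
      · rw [hri i hiF]
        rcases Finset.mem_insert.1 hi' with rfl | hiF'
        · rw [hrj]
          exact hN i hiF
        · rw [hri i' hiF']
          exact hr i hiF i' hiF' hlt
    · intro i hi h hh he
      have he' : ∀ s, (e h s).1 ∈ F := by
        intro s
        rcases Finset.mem_insert.1 (he s).1 with h1 | h1
        · rcases Finset.mem_insert.1 hi with rfl | hi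
          · exact ((he s).2.ne h1).elim
          · exact (lt_asymm (h1 ▸ (he s).2) (hj i hi)).elim
        · exact h1
      rw [hcomp h he']
      rcases Finset.mem_insert.1 hi with rfl | hi
      · rw [hrj]
        exact hN' h hh
      · rw [hri i hi]
        exact hagree i hi h hh fun s => ⟨he' s, (he s).2⟩

/-- An SOP₁ tree gives, for every linear order `I`, an array indexed by `I` in which all tuples have
the same type over what comes before them. -/
theorem exists_indexed_array [Nonempty N] {φ : L.Formula (Fin n ⊕ Fin m)} (h : FormulaSOP1 N φ)
    {S : Set L.Sentence} (hS : ∀ σ ∈ S, N ⊨ σ) (I : Type w) [LinearOrder I] :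
    ∃ (M : Type (max u v w)) (_ : L.Structure M) (_ : Nonempty M) (v : I × Bool × Fin m → M),
      ∀ θ ∈ coreFormulas S φ I ∪ agreeFormulas fun _ _ => True, θ.Realize v := by
  classical
  obtain ⟨M, _, _, v, hv⟩ := exists_array h hS
  obtain ⟨hS', hcon, hinc⟩ := realize_coreFormulas_iff.1 fun θ hθ => hv θ (Or.inl hθ)
  refine exists_realize_of_finite _ fun s hs => ?_
  -- Core statements survive every re-indexing that is increasing on a suitable finite set.
  have hcore : ∀ θ ∈ coreFormulas S φ I, ∃ F : Finset I, ∀ r : I → ℕ,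
      (∀ i ∈ F, ∀ j ∈ F, i < j → r i < r j) → θ.Realize (v ∘ Prod.map r id) := by
    rintro θ (⟨σ, hσ, rfl⟩ | ⟨t, rfl⟩ | ⟨i, j, hij, rfl⟩)
    · refine ⟨∅, fun r _ => ?_⟩
      rw [Formula.realize_relabel, Subsingleton.elim (_ ∘ Empty.elim) default]
      exact hS' σ hσ
    · refine ⟨∅, fun r _ => ?_⟩
      obtain ⟨x, hx⟩ := hcon (t.image r)
      rw [realize_commonSolution]
      exact ⟨x, fun i => hx _ (Finset.mem_image_of_mem r i.2)⟩
    · refine ⟨{i, j}, fun r hr => ?_⟩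
      have hne : r i ≠ r j := by
        rcases lt_or_gt_of_ne hij with hlt | hlt
        · exact (hr i (by simp) j (by simp) hlt).ne
        · exact (hr j (by simp) i (by simp) hlt).ne'
      rw [Formula.realize_not, realize_commonSolution]
      rintro ⟨x, hx⟩
      exact hinc _ _ hne ⟨x, hx true, hx false⟩
  choose! FC hFC using hcore
  obtain ⟨H, hH⟩ : ∃ H : Finset (L.Formula (I × Bool × Fin m)),
      ∀ θ, θ ∈ H ↔ θ ∈ s ∧ θ ∈ agreeFormulas fun _ _ => True :=
    ⟨s.filter (· ∈ agreeFormulas fun _ _ => True), fun _ => Finset.mem_filter⟩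
  choose k χ e p p' he he' _ hθ using fun θ : H =>
    ((hH θ).1 θ.2).2
  let F : Finset I := s.biUnion FC ∪ (Finset.univ : Finset H).biUnion fun θ =>
    {(p θ).1, (p' θ).1} ∪ Finset.univ.image fun t => (e θ t).1
  have hF1 : ∀ θ ∈ s, FC θ ⊆ F := fun θ h =>
    (Finset.subset_biUnion_of_mem FC h).trans Finset.subset_union_left
  have hF2 : ∀ θ : H, (p θ).1 ∈ F ∧ (p' θ).1 ∈ F ∧ ∀ t, (e θ t).1 ∈ F := by
    intro θ
    have h1 : {(p θ).1, (p' θ).1} ∪ Finset.univ.image (fun t => (e θ t).1) ⊆ F :=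
      (Finset.subset_biUnion_of_mem (fun θ : H => {(p θ).1, (p' θ).1} ∪
        Finset.univ.image fun t => (e θ t).1) (Finset.mem_univ θ)).trans Finset.subset_union_right
    exact ⟨h1 (by simp), h1 (by simp), fun t => h1 (by simp)⟩
  obtain ⟨r, hr, hlim⟩ := exists_index_map (Filter.hyperfilter ℕ) Nat.hyperfilter_le_atTop v
    (Finset.univ : Finset H) k χ e F
  refine ⟨M, inferInstance, inferInstance, v ∘ Prod.map r id, fun θ hθs => ?_⟩
  rcases hs hθs with hc | hc
  · exact hFC θ hc r fun i hi j hj => hr i (hF1 θ hθs hi) j (hF1 θ hθs hj)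
  · let τ : H := ⟨θ, (hH θ).2 ⟨hθs, hc⟩⟩
    -- Within a column both entries agree over the preceding columns, and the `true` entry agrees
    -- with the limit. So every entry beyond the parameters gives the same truth value, namely that
    -- of the limit.
    have key : ∀ q : I × Bool, q.1 ∈ F → (∀ t, (e τ t).1 < q.1) →
        ((χ τ).Realize (Sum.elim (fun t => v (r q.1, q.2, t)) (v ∘ Prod.map r id ∘ e τ)) ↔
          ∀ᶠ i in (Filter.hyperfilter ℕ : Filter ℕ), (χ τ).Realize
            (Sum.elim (fun t => v (i, true, t)) (v ∘ Prod.map r id ∘ e τ))) := by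
      intro q hq heq
      rw [← hlim q.1 hq τ (Finset.mem_univ τ) fun t => ⟨(hF2 τ).2.2 t, heq t⟩]
      have hlt : ∀ t, ((Prod.map r id ∘ e τ) t).1 < r q.1 := fun t =>
        hr _ ((hF2 τ).2.2 t) _ hq (heq t)
      exact (realize_agreeFormula (χ τ) (Prod.map r id ∘ e τ) (r q.1, q.2) (r q.1, true) v).1
        (hv _ (Or.inr ⟨_, _, _, (r q.1, q.2), (r q.1, true), hlt, hlt, rfl, rfl⟩))
    have h1 : θ = agreeFormula (χ τ) (e τ) (p τ) (p' τ) := hθ τ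
    rw [h1, realize_agreeFormula]
    exact (key (p τ) (hF2 τ).1 (he τ)).trans (key (p' τ) (hF2 τ).2.1 (he' τ)).symm

end Arrays

/-! ### Kim-dividing from arrays. -/

section ArrayDivides

variable {L : FirstOrder.Language.{u, v}} {M : Type w'} [L.Structure M]
  [(L.sum L.skolem₁).Structure M] [(LHom.sumInl : L →ᴸ L.sum L.skolem₁).IsExpansionOn M]

theorem exists_term_of_mem_skolemHull (h : IsSkolem L M) {X : Type*} {f : X → M} {x : M}
    (hx : x ∈ skolemHull h (Set.range f)) : ∃ t : (L.sum L.skolem₁).Term X, t.realize f = x := by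
  obtain ⟨t, ht⟩ := Substructure.mem_closure_iff_exists_term.1 hx
  choose g hg using fun y : Set.range f => y.2
  refine ⟨t.relabel g, ?_⟩
  rw [Term.realize_relabel, ← ht]
  exact congrArg (fun f => t.realize f) (funext hg)

/-- A formula over a Skolem hull is equivalent to a formula of the Skolem language over the
generators. -/
theorem exists_formula_over_generators (h : IsSkolem L M) {X : Type*} {f : X → M} {β : Type*}
    {k : ℕ} (χ : L.Formula (β ⊕ Fin k)) {x : Fin k → M}
    (hx : ∀ i, x i ∈ skolemHull h (Set.range f)) :
    ∃ χ' : (L.sum L.skolem₁).Formula (β ⊕ X), ∀ d : β → M,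
      χ'.Realize (Sum.elim d f) ↔ χ.Realize (Sum.elim d x) := by
  choose t ht using fun i => exists_term_of_mem_skolemHull h (hx i)
  refine ⟨((LHom.sumInl : L →ᴸ L.sum L.skolem₁).onFormula χ).subst
    (Sum.elim (fun b => Term.var (Sum.inl b)) fun i => (t i).relabel Sum.inr), fun d => ?_⟩
  rw [← LHom.realize_onFormula (LHom.sumInl : L →ᴸ L.sum L.skolem₁) χ, Formula.Realize,
    BoundedFormula.realize_subst, ← Formula.Realize]
  refine iff_of_eq (congrArg _ (funext ?_))
  rintro (b | i)
  · rfl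
  · simp only [Sum.elim_inr, Term.realize_relabel, Sum.elim_comp_inr, ht]

variable {U : Type w} [L.Structure U] [Nonempty U] {n m : ℕ} {I : Type*} [LinearOrder I]

/-- In an array of tuples with the same type over what comes before them, in which the formulas
`φ(x; v (p, 1))` are pairwise inconsistent, the formula `φ(x; v (z, 0))` Kim-divides over the Skolem
hull of what comes before `z`. -/
theorem kimDivides_of_array {μ : Cardinal.{w}} (hU : IsSaturated L U μ) (hμ : ℵ₀ ≤ μ)
    (hsk : IsSkolem L M) (g : M ↪ₑ[L] U) {φ : L.Formula (Fin n ⊕ Fin m)}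
    {v : I × Bool × Fin m → M}
    (hagree : ∀ (k : ℕ) (χ : (L.sum L.skolem₁).Formula (Fin m ⊕ Fin k))
      (e : Fin k → I × Bool × Fin m) (p p' : I × Bool), (∀ s, (e s).1 < p.1) →
      (∀ s, (e s).1 < p'.1) → (χ.Realize (Sum.elim (fun t => v (p.1, p.2, t)) (v ∘ e)) ↔
        χ.Realize (Sum.elim (fun t => v (p'.1, p'.2, t)) (v ∘ e))))
    (hinc : ∀ i j, i ≠ j → ¬ ∃ x : Fin n → M, φ.Realize (Sum.elim x fun t => v (i, true, t)) ∧
        φ.Realize (Sum.elim x fun t => v (j, true, t))) {z : I} (hz : ∃ p, p < z)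
    (hz' : ∀ p < z, ∃ p', p < p' ∧ p' < z) {S : Set M}
    (hS : S = Set.range fun y : {y : I × Bool × Fin m // y.1 < z} => v y)
    (hcard : #(mapElementary g (skolemHull hsk S)) < μ) :
    KimDivides (mapElementary g (skolemHull hsk S) : Set U) φ fun t => g (v (z, false, t)) := by
  subst hS
  let X := {y : I × Bool × Fin m // y.1 < z}
  let f : X → M := fun y => v y
  let P := {p : I // p < z}
  have : Nonempty P := ⟨⟨hz.choose, hz.choose_spec⟩⟩
  have : NoMaxOrder P := ⟨fun p => by
    obtain ⟨p', h1, h2⟩ := hz' p.1 p.2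
    exact ⟨⟨p', h2⟩, h1⟩⟩
  let c : P → Fin m → U := fun p t => g (v (p, true, t))
  -- The limit of the entries `v (p, true)` as `p` tends to `z`. They lie in the hull, so the limit
  -- type is invariant over it.
  let D₀ : Ultrafilter P := Ultrafilter.of Filter.atTop
  have hD₀ : (D₀ : Filter P) ≤ Filter.atTop := Ultrafilter.of_le _
  let D : Ultrafilter (Fin m → U) := D₀.map c
  have hcmem : ∀ (p : P) t, c p t ∈ mapElementary g (skolemHull hsk (Set.range f)) :=
    fun p t => ⟨_, subset_skolemHull hsk _ ⟨⟨(p.1, true, t), p.2⟩, rfl⟩, rfl⟩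
  obtain ⟨q, hq⟩ := exists_has_iff_eventually (L := L) D
  have hev : ∀ {Q : (Fin m → U) → Prop}, (∀ᶠ b in D, Q b) ↔ ∀ᶠ p in D₀, Q (c p) := Iff.rfl
  have hinv : IsInvariant (mapElementary g (skolemHull hsk (Set.range f)) : Set U) q :=
    isInvariant_of_eventually (D := D) (hev.2 (Filter.Eventually.of_forall hcmem)) hq
  have hreal : RealizesOver (mapElementary g (skolemHull hsk (Set.range f)) : Set U) q
      fun t => g (v (z, false, t)) := by
    refine realizesOver_of_eventually (D := D) (fun k χ a ha hχ => ?_) hq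
    choose x hx hxa using ha
    have hga : a = g ∘ x := funext fun i => (hxa i).symm
    obtain ⟨χ', hχ'⟩ := exists_formula_over_generators hsk χ hx
    have htrans : ∀ d : Fin m → M, χ.Realize (Sum.elim (fun t => g (d t)) a) ↔
        (supportFormula χ').Realize (Sum.elim d (f ∘ supportMap χ')) := by
      intro d
      rw [realize_supportFormula, hχ', ← g.map_formula, Sum.comp_elim, hga]
      rfl
    rw [hev]
    -- A formula over the hull involves finitely many generators. For `p` beyond these, `v (p,
    -- true)` and `v (z, false)` agree on its translation into the Skolem language.
    have hlt : ∀ᶠ p : P in D₀, ∀ s, (supportMap χ' s).1.1 < p.1 :=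
      Filter.eventually_all.2 fun s =>
        hD₀ (Filter.eventually_gt_atTop (⟨(supportMap χ' s).1.1, (supportMap χ' s).2⟩ : P))
    filter_upwards [hlt] with p hp
    refine (htrans _).2 ((hagree _ (supportFormula χ') (fun s => (supportMap χ' s).1) (z, false)
      (p.1, true) (fun s => (supportMap χ' s).2) hp).1 ((htrans _).1 hχ))
  refine ⟨q, hinv, hreal, ?_⟩
  obtain ⟨b, hb⟩ := exists_realizesOver_seq hU hμ hcard fun _ => q
  refine ⟨b, hb, fun hcon => ?_⟩
  -- Two terms suffice. A common solution for `b 0` and `b 1` reflects, first replacing `b 1` and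
  -- then `b 0`, to one for two distinct `true` entries.
  obtain ⟨x, hx⟩ := hcon {0, 1}
  let ξ : L.Formula (Fin m ⊕ Fin m) :=
    commonSolution φ fun (i : Bool) t => bif i then Sum.inl t else Sum.inr t
  have hξ : ∀ d d' : Fin m → U, ξ.Realize (Sum.elim d d') ↔
      ∃ x : Fin n → U, φ.Realize (Sum.elim x d) ∧ φ.Realize (Sum.elim x d') := by
    intro d d'
    rw [realize_commonSolution]
    exact exists_congr fun x => ⟨fun h => ⟨h true, h false⟩, fun h i => by
      cases i
      · exact h.2
      · exact h.1⟩
  have h1 : ξ.Realize (Sum.elim (b 1) (b 0)) :=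
    (hξ _ _).2 ⟨x, hx 1 (by simp), hx 0 (by simp)⟩
  rw [← (hb 1).has_iff ξ (e := b 0) fun t => Or.inr (Set.mem_iUnion₂.2 ⟨0, one_pos, t, rfl⟩), hq,
    hev] at h1
  obtain ⟨p, hp⟩ := h1.exists
  have h2 : ξ.Realize (Sum.elim (b 0) (c p)) := by
    rw [hξ] at hp ⊢
    obtain ⟨x, h, h'⟩ := hp
    exact ⟨x, h', h⟩
  rw [← (hb 0).has_iff ξ (e := c p) fun t => Or.inl (hcmem p t), hq, hev] at h2
  obtain ⟨p', hp', hlt⟩ := (h2.and (hD₀ (Filter.eventually_gt_atTop p))).exists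
  have h3 : ξ.Realize (g ∘ Sum.elim (fun t => v (p'.1, true, t)) fun t => v (p.1, true, t)) := by
    rw [Sum.comp_elim]
    exact hp'
  rw [g.map_formula, realize_commonSolution] at h3
  obtain ⟨x, hx⟩ := h3
  exact hinc p'.1 p.1 (Subtype.coe_injective.ne hlt.ne') ⟨x, hx true, hx false⟩

end ArrayDivides

/-! ### Axioms for Skolem functions. -/

section SkolemSentence

variable {L : FirstOrder.Language.{u, v}}

/-- The sentence stating that the Skolem function for `φ` is a Skolem function. -/
noncomputable def skolemSentence {n : ℕ} (φ : L.BoundedFormula Empty (n + 1)) :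
    (L.sum L.skolem₁).Sentence :=
  (((LHom.sumInl : L →ᴸ L.sum L.skolem₁).onBoundedFormula φ).ex.imp
    ((Term.bdEqual (Term.var (Sum.inr (Fin.last n)))
      (Term.func ((LHom.sumInr : L.skolem₁ →ᴸ L.sum L.skolem₁).onFunction (n := n) φ)
        fun i => Term.var (Sum.inr i.castSucc))) ⊓
      (LHom.sumInl : L →ᴸ L.sum L.skolem₁).onBoundedFormula φ).ex).alls

theorem realize_skolemSentence {M : Type w} [L.Structure M] [(L.sum L.skolem₁).Structure M]
    [(LHom.sumInl : L →ᴸ L.sum L.skolem₁).IsExpansionOn M] {n : ℕ}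
    (φ : L.BoundedFormula Empty (n + 1)) : M ⊨ skolemSentence φ ↔ ∀ (x : Fin n → M) (a : M),
      φ.Realize default (Fin.snoc x a : Fin (n + 1) → M) →
        φ.Realize default (Fin.snoc x (Structure.funMap ((LHom.sumInr : L.skolem₁ →ᴸ
          L.sum L.skolem₁).onFunction (n := n) φ) x) : Fin (n + 1) → M) := by
  rw [skolemSentence, Sentence.Realize, BoundedFormula.realize_alls]
  simp [LHom.realize_onBoundedFormula]

end SkolemSentence

/-! ### Long Kim-forking chains from SOP₁. -/

section ChainOfSOP1

variable {L : FirstOrder.Language.{u, v}}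

/-- If `T` has SOP₁, there are consistent Kim-forking chains of every length above `|T|`. -/
theorem exists_hasKimForkingChain {T : L.Theory} (h : SOP1 T) {κ : Cardinal.{max u v w}}
    (hκ : Cardinal.lift.{w} (theoryCard T) < κ) :
    ∃ (U : Type (max u v w)) (_ : L.Structure U) (_ : Nonempty U) (_ : U ⊨ T),
      IsSaturated L U (Order.succ κ) ∧ HasKimForkingChain L U κ := by
  classical
  obtain ⟨N, n, m, φ, a, hcon, hinc⟩ := h
  let L' := L.sum L.skolem₁
  let inl : L →ᴸ L' := LHom.sumInl
  have hκ0 : ℵ₀ ≤ κ := by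
    refine le_trans ?_ hκ.le
    rw [Cardinal.aleph0_le_lift]
    exact le_max_left _ _
  have hsop : FormulaSOP1 N (inl.onFormula φ) := by
    refine ⟨a, fun η s => ?_, fun η ν hν => ?_⟩
    · simpa only [inl, LHom.realize_onFormula] using hcon η s
    · simpa only [inl, LHom.realize_onFormula] using hinc η ν hν
  let J := κ.ord.ToType
  -- Blocks of type ω indexed by κ, above one bottom block. Thus the points below each `(i, 0)` are
  -- nonempty in number and have no greatest element, even for `i = 0`.
  let I : Type (max u v w) := WithBot J ×ₗ ℕ
  -- Preserving the complete theory of `N` in the Skolemized language transfers both `T` and the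
  -- Skolem axioms to `M`.
  obtain ⟨M, _, _, v, hv⟩ := exists_indexed_array hsop (S := L'.completeTheory N)
    (fun σ hσ => hσ) I
  let _ : L.Structure M := inl.reduct M
  have hexp : inl.IsExpansionOn M := inferInstance
  obtain ⟨hS, hcon', hinc'⟩ := realize_coreFormulas_iff.1 fun θ hθ => hv θ (Or.inl hθ)
  have hsk : IsSkolem L M := fun k ψ =>
    (realize_skolemSentence ψ).1 (hS _ ((realize_skolemSentence ψ).2 (isSkolem_of_nonempty k ψ)))
  have hMT : M ⊨ T := (Theory.model_iff T).2 fun σ hσ =>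
    (LHom.realize_onSentence M inl σ).1 (hS _ ((LHom.realize_onSentence N inl σ).2
      (Theory.realize_sentence_of_mem T hσ)))
  obtain ⟨U, _, _, g, hU⟩ := exists_isSaturated (L := L) M hκ0
  have hUT : U ⊨ T := (g.theory_model_iff T).1 hMT
  refine ⟨U, inferInstance, inferInstance, hUT, hU, ?_⟩
  let pos : Ordinal.{max u v w} → WithBot J := fun i =>
    if hi : i < κ.ord then (Ordinal.ToType.mk ⟨i, hi⟩ : J) else ⊥
  have hpos : ∀ i, (hi : i < κ.ord) → pos i = (Ordinal.ToType.mk ⟨i, hi⟩ : J) :=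
    fun i hi => dif_pos hi
  let z : Ordinal.{max u v w} → I := fun i => toLex (pos i, 0)
  let B : Set M := Set.range fun y : ℕ × Bool × Fin m => v (toLex (⊥, y.1), y.2)
  let A : Ordinal.{max u v w} → Set M := fun j =>
    Set.range fun y : ℕ × Bool × Fin m => v (toLex (pos j, y.1), y.2)
  have hB : B.Countable := Set.countable_range _
  have hA : ∀ j, (A j).Countable := fun j => Set.countable_range _
  have hlt : ∀ i < κ.ord, ∀ (x : WithBot J) (k : ℕ), (toLex (x, k) : I) < z i ↔
      x = ⊥ ∨ ∃ j < i, x = pos j := by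
    intro i hi x k
    simp only [z, Prod.Lex.toLex_lt_toLex, hpos i hi, Nat.not_lt_zero, and_false, or_false]
    induction x with
    | bot => simp
    | coe y =>
      obtain ⟨⟨j, hj⟩, rfl⟩ := Ordinal.ToType.mk.surjective y
      simp only [WithBot.coe_lt_coe, OrderIso.lt_iff_lt, WithBot.coe_ne_bot, false_or]
      refine ⟨fun h => ⟨j, h, (hpos j hj).symm⟩, ?_⟩
      rintro ⟨j', hj', heq⟩
      rw [hpos j' (hj'.trans hi), WithBot.coe_inj] at heq
      rw [Ordinal.ToType.mk.injective heq]
      exact hj'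
  have hset : ∀ i < κ.ord, B ∪ ⋃ j < i, A j =
      Set.range fun y : {y : I × Bool × Fin m // y.1 < z i} => v y := by
    intro i hi
    apply Set.Subset.antisymm
    · rintro _ (⟨y, rfl⟩ | hy)
      · exact ⟨⟨(toLex (⊥, y.1), y.2), (hlt i hi _ _).2 (Or.inl rfl)⟩, rfl⟩
      · obtain ⟨j, hj, y, rfl⟩ := Set.mem_iUnion₂.1 hy
        exact ⟨⟨(toLex (pos j, y.1), y.2), (hlt i hi _ _).2 (Or.inr ⟨j, hj, rfl⟩)⟩, rfl⟩
    · rintro _ ⟨⟨⟨p, y⟩, hp⟩, rfl⟩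
      rcases (hlt i hi (ofLex p).1 (ofLex p).2).1 hp with h | ⟨j, hj, h⟩
      · refine Or.inl ⟨((ofLex p).2, y), ?_⟩
        rw [← h]
        rfl
      · refine Or.inr (Set.mem_iUnion₂.2 ⟨j, hj, ((ofLex p).2, y), ?_⟩)
        rw [← h]
        rfl
  have hreal : ∀ (d : Fin m → U) (x : Fin n → U),
      (φ.relabel (Sum.map id Sum.inl) : L.Formula (Fin n ⊕ (Fin m ⊕ Fin 0))).Realize
        (Sum.elim x (Sum.elim d Fin.elim0)) ↔ φ.Realize (Sum.elim x d) := by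
    intro d x
    rw [Formula.realize_relabel, Sum.elim_comp_map, Sum.elim_comp_inl, Function.comp_id]
  refine ⟨n, hullChain g hsk B A, fun _ => m, fun _ => 0, fun _ => φ.relabel (Sum.map id Sum.inl),
    fun i t => g (v (z i, false, t)), fun _ => Fin.elim0, fun i j hij _ => hullChain_mono _ _ _ _ hij,
    fun i _ hi => hullChain_limit _ _ _ _ hi,
    fun i hi => mk_hullChain_lt T g hsk hB hA hκ hi, fun _ _ t => t.elim0,
    fun i _ t => mem_hullChain_succ g hsk B A ⟨(0, false, t), rfl⟩, fun i hi => ?_, fun s => ?_⟩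
  · have hdiv := kimDivides_of_array (φ := φ) (v := v) (z := z i) hU
      (hκ0.trans (Order.le_succ κ)) hsk g (fun k χ e p p' h1 h2 =>
        (realize_agreeFormula χ e p p' v).1 (hv _ (Or.inr ⟨k, χ, e, p, p', h1, h2, trivial, rfl⟩)))
      (by simpa only [inl, LHom.realize_onFormula] using hinc')
      ⟨toLex (⊥, 0), (hlt i hi _ _).2 (Or.inl rfl)⟩
      (fun p hp => ⟨toLex ((ofLex p).1, (ofLex p).2 + 1), by
        rw [Prod.Lex.lt_iff]
        exact Or.inr ⟨rfl, Nat.lt_succ_self _⟩, (hlt i hi _ _).2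
          ((hlt i hi (ofLex p).1 (ofLex p).2).1 hp)⟩) (hset i hi)
      ((mk_hullChain_lt T g hsk hB hA hκ hi).trans (Order.lt_succ κ))
    exact ⟨1, fun _ => m, fun _ => φ, fun _ t => g (v (z i, false, t)),
      fun x hx => ⟨0, (hreal _ _).1 hx⟩, fun _ => hdiv⟩
  -- Consistency of the chain is consistency of the `false` column, carried to `U` by `g`.
  · obtain ⟨x, hx⟩ := hcon' (s.image fun i : Set.Iio κ.ord => z i)
    refine ⟨g ∘ x, fun i hi => (hreal _ _).2 ?_⟩
    have h1 := hx (z i) (Finset.mem_image_of_mem (fun i : Set.Iio κ.ord => z i) hi)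
    rw [LHom.realize_onFormula] at h1
    have h2 := (g.map_formula φ _).2 h1
    rwa [Sum.comp_elim] at h2

end ChainOfSOP1

end KimIndependence

theorem theorem4p5 {L : FirstOrder.Language.{u, v}} (T : L.Theory) (hT : T.IsComplete) :
    (KimIndependence.NSOP1 T →
      ∀ (U : Type (max u v w)) [L.Structure U] [Nonempty U] [U ⊨ T]
        (M : L.ElementarySubstructure U),
        KimIndependence.IsSaturated L U (Order.succ #M) →
        ∀ (n : ℕ) (p : (L.elementaryDiagram M).CompleteType (Fin n)),
          ∃ M' : L.ElementarySubstructure U, M' ≤ M ∧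
            #M' ≤ Cardinal.lift.{w} ((2 : Cardinal) ^ KimIndependence.theoryCard T) ∧
            ¬ KimIndependence.TypeKimForks (M' : Set U) p) ∧
    ((∃ κ : Cardinal.{max u v w}, Cardinal.lift.{w} (KimIndependence.theoryCard T) < κ ∧
        ∀ (U : Type (max u v w)) [L.Structure U] [Nonempty U] [U ⊨ T],
          KimIndependence.IsSaturated L U (Order.succ κ) →
            ¬ KimIndependence.HasKimForkingChain L U κ) ↔
      KimIndependence.NSOP1 T) := by
  refine ⟨fun hT U _ _ _ M hU n p => ?_, fun ⟨κ, hκ, hchain⟩ hsop => ?_, fun hT => ?_⟩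
  · obtain ⟨M', hM', hcard, hp⟩ := KimIndependence.exists_not_typeKimForks hT M hU p
    -- The bound obtained is |T|, weakened here to 2^|T|.
    exact ⟨M', hM', hcard.trans (Cardinal.lift_le.2 (Cardinal.cantor _).le), hp⟩
  · obtain ⟨U, _, _, _, hU, h⟩ := KimIndependence.exists_hasKimForkingChain hsop hκ
    exact hchain U hU h
  · exact ⟨_, Order.lt_succ _, fun U _ _ _ hU => KimIndependence.not_hasKimForkingChain hT hU⟩
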